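/- Let $\mathbb R_{\max}=\mathbb R\cup\{-\infty\}$ with addition $\max$ and multiplication $+$, and $\mathbb Z_{\max}=\mathbb Z\cup\{-\infty\}$; write $\bot$ for the vector identically $-\infty$. On $\mathbb R_{\max}^n$ let $$d(x,y)=\inf\{\lambda-\mu \mid \lambda,\mu\in\mathbb R,\ \mu+y_i\le x_i\le\lambda+y_i \text{ for all } i\}\in[0,+\infty]$$ if $x,y$ are not both $\bot$, and $d(\bot,\bot)=0$ (Hilbert's projective metric). For $a\in\mathbb R_{\max}^n$, $a\neq\bot$, let $\mathcal H_a$ be the tropical hyperplane of all $x\in\mathbb R_{\max}^n$ for which $\max_i(a_i+x_i)$ is achieved at least twice. Consider the following problems, in which integers are written in binary. 1. *Mean payoff games.* Input: a finite bipartite digraph with nodes $i\in I$ (Player Min) and $j\in J$ (Player Max), integer weights $w$ on the arcs, at least one outgoing arc at every node, and an initial node $\imath\in I$. Question: is the mean payoff $\chi_\imath(T)=\lim_{k\to\infty}(T^k(0))_\imath/k$ nonnegative, where $T_i(x)=\min_{j:(i,j)\text{ arc}}\bigl(w_{ij}+\max_{l:(j,l)\text{ arc}}(w_{jl}+x_l)\bigr)$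 for $x\in\mathbb R^{I}$? 2. *Tropical linear regression.* Input: the vectors $v^{(1)},\dots,v^{(p)}\in\mathbb Z_{\max}^n$ ($n,p\ge1$) of a set $\mathcal V$. Goal: compute the value $$\inf_{a\in\mathbb R_{\max}^n,\ a\ne\bot}\ \max_{v\in\mathcal V}\ \inf_{x\in\mathcal H_a} d(v,x)\in\mathbb Q\cup\{+\infty\}.$$ 3. *Inner radius.* Input: a matrix $V\in\mathbb Z_{\max}^{n\times p}$ ($n,p\ge1$). Goal: compute the inner radius of the tropical cone $\operatorname{Col}(V)\subset\mathbb R_{\max}^n$ generated by the columns of $V$, that is, the supremum in $\mathbb Q\cup\{\pm\infty\}$ of the $r\in[0,\infty)$ such that $\{x \mid d(x,a)\le r\}\subset\operatorname{Col}(V)$ for some $a\in\mathbb R^n$ (the supremum of the empty set is $-\infty$). Then tropical linear regression (2) is polynomial-time Turing equivalent to mean payoff games (1): each of the two problems can be solved in time polynomial in the bit size of the input by a program with an oracle for the other one. Likewise, computing the inner radius (3) is polynomial-time Turing equivalent to mean payoff games (1). -/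

import Mathlib

namespace TropReg

/-! ## Oracle programs and their bit cost

Programs act on finite binary trees whose leaves are integers written in binary.  They are built
from elementary operations by pairing, composition, branching, while-loops and oracle calls.  An
elementary operation (and an oracle call) is charged one unit plus the number of bits that it reads
and writes, a control step is charged one unit; hence the running time is, up to a polynomial, the
running time of a multitape oracle Turing machine. -/

/-- Data: binary trees with integer leaves. -/
inductive Data : Type
  | int (z : ℤ) : Data
  | pair (x y : Data) : Data

namespace Data

/-- The bit size of a datum; integers are written in binary. -/
def size : Data → ℕ
  | int z => 1 + Nat.size z.natAbs
  | pair x y => 1 + x.size + y.size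

/-- Lists as data. -/
def ofList : List Data → Data
  | [] => int 0
  | x :: l => pair x (ofList l)

theorem ofList_injective : Function.Injective ofList := by
  intro l
  induction l with
  | nil =>
    intro l' h
    cases l' with
    | nil => rfl
    | cons y l' => simp [ofList] at h
  | cons x l ih =>
    intro l' h
    cases l' with
    | nil => simp [ofList] at h
    | cons y l' =>
      simp only [ofList, pair.injEq] at h
      rw [h.1, ih h.2]

/-- Matrices as lists of rows. -/
def ofMatrix {α : Type} (e : α → Data) {m n : ℕ} (A : Fin m → Fin n → α) : Data :=
  ofList (List.ofFn fun i => ofList (List.ofFn fun j => e (A i j)))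

theorem ofMatrix_injective {α : Type} {e : α → Data} (he : Function.Injective e) {m n : ℕ} :
    Function.Injective (ofMatrix e : (Fin m → Fin n → α) → Data) := by
  intro A B h
  have h1 := List.ofFn_injective (ofList_injective h)
  funext i j
  have h2 := List.ofFn_injective (ofList_injective (congrFun h1 i))
  exact he (congrFun h2 j)

/-- Integers completed by one extra symbol (standing for `-∞` or for a missing arc). -/
def ofOption : Option ℤ → Data
  | none => int 0
  | some z => pair (int 0) (int z)

theorem ofOption_injective : Function.Injective ofOption := by
  intro x y h
  cases x <;> cases y <;> simp_all [ofOption]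

end Data

/-- The elementary operations. -/
inductive Op : Type
  | id : Op
  | const (z : ℤ) : Op
  | fst : Op
  | snd : Op
  | isPair : Op
  | add : Op
  | sub : Op
  | mul : Op
  | div : Op

/-- The effect of an elementary operation; ill-formed arguments give `0`. -/
def Op.run : Op → Data → Data
  | .id, x => x
  | .const z, _ => .int z
  | .fst, .pair x _ => x
  | .snd, .pair _ y => y
  | .isPair, .pair _ _ => .int 1
  | .add, .pair (.int a) (.int b) => .int (a + b)
  | .sub, .pair (.int a) (.int b) => .int (a - b)
  | .mul, .pair (.int a) (.int b) => .int (a * b)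
  | .div, .pair (.int a) (.int b) => .int (a / b)
  | _, _ => .int 0

/-- Oracle programs. -/
inductive Prog : Type
  /-- an elementary operation -/
  | op (o : Op) : Prog
  /-- apply the oracle to the input -/
  | oracle : Prog
  /-- run both programs on the input and pair the results -/
  | pair (f g : Prog) : Prog
  /-- run `f`, then `g` on its result -/
  | seq (f g : Prog) : Prog
  /-- run `f` if the test `c` returns a positive integer on the input, and `g` otherwise -/
  | cond (c f g : Prog) : Prog
  /-- as long as the test `c` returns a positive integer, replace the input by its image by `f` -/
  | loop (c f : Prog) : Prog

/-- The outcome `true` of a test. -/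
def Data.IsPos : Data → Prop
  | .int z => 0 < z
  | .pair _ _ => False

/-- `Eval O c x y t`: with oracle `O`, the program `c` halts on input `x`, with output `y`, after
time `t`. -/
inductive Eval (O : Data → Data) : Prog → Data → Data → ℕ → Prop
  | op (o : Op) (x : Data) : Eval O (.op o) x (o.run x) (1 + x.size + (o.run x).size)
  | oracle (x : Data) : Eval O .oracle x (O x) (1 + x.size + (O x).size)
  | pair {f g : Prog} {x y z : Data} {s t : ℕ} :
      Eval O f x y s → Eval O g x z t → Eval O (.pair f g) x (.pair y z) (1 + s + t)
  | seq {f g : Prog} {x y z : Data} {s t : ℕ} :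
      Eval O f x y s → Eval O g y z t → Eval O (.seq f g) x z (1 + s + t)
  | cond_true {c f g : Prog} {x b y : Data} {s t : ℕ} :
      Eval O c x b s → b.IsPos → Eval O f x y t → Eval O (.cond c f g) x y (1 + s + t)
  | cond_false {c f g : Prog} {x b y : Data} {s t : ℕ} :
      Eval O c x b s → ¬ b.IsPos → Eval O g x y t → Eval O (.cond c f g) x y (1 + s + t)
  | loop_true {c f : Prog} {x b y z : Data} {s t u : ℕ} :
      Eval O c x b s → b.IsPos → Eval O f x y t → Eval O (.loop c f) y z u →
        Eval O (.loop c f) x z (1 + s + t + u)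
  | loop_false {c f : Prog} {x b : Data} {s : ℕ} :
      Eval O c x b s → ¬ b.IsPos → Eval O (.loop c f) x x (1 + s)

/-- A computational problem: instances with their encoding, and the relation telling which data
are (encodings of) correct answers to an instance. -/
structure Problem where
  Inst : Type
  enc : Inst → Data
  enc_injective : Function.Injective enc
  IsAnswer : Inst → Data → Prop

/-- An oracle solving a problem: it is correct on all instances, and unspecified on the data that do
not encode an instance. -/
def Problem.SolvedBy (P : Problem) (O : Data → Data) : Prop :=
  ∀ i : P.Inst, P.IsAnswer i (O (P.enc i))

/-- Polynomial-time Turing reduction of `P` to `Q`: one program with an oracle for `Q` solves all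
instances of `P`, in a time bounded by one polynomial in the bit size of the instance. -/
def PolyTimeTuringReduces (P Q : Problem) : Prop :=
  ∃ (c : Prog) (B : Polynomial ℕ), ∀ O : Data → Data, Q.SolvedBy O →
    ∀ i : P.Inst, ∃ (y : Data) (t : ℕ),
      Eval O c (P.enc i) y t ∧ P.IsAnswer i y ∧ t ≤ B.eval (P.enc i).size

/-- Polynomial-time Turing equivalence. -/
def PolyTimeTuringEquivalent (P Q : Problem) : Prop :=
  PolyTimeTuringReduces P Q ∧ PolyTimeTuringReduces Q P

/-! ## Mean payoff games -/

/-- A bipartite digraph with integer weights, on the nodes `Fin m` of Player Min and `Fin n` of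
Player Max, in which every node has an outgoing arc, together with an initial node of Player Min. -/
structure Game where
  m : ℕ
  n : ℕ
  /-- `minArc i j` is the weight of the arc from node `i` of Min to node `j` of Max, if any -/
  minArc : Fin m → Fin n → Option ℤ
  /-- `maxArc j i` is the weight of the arc from node `j` of Max to node `i` of Min, if any -/
  maxArc : Fin n → Fin m → Option ℤ
  exists_minArc : ∀ i, ∃ j, (minArc i j).isSome
  exists_maxArc : ∀ j, ∃ i, (maxArc j i).isSome
  init : Fin m

/-- The Shapley operator
`T_i(x) = min_{j, (i,j) arc} (w_{ij} + max_{l, (j,l) arc} (w_{jl} + x_l))`;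
both index sets are finite and non-empty. -/
noncomputable def Game.shapley (G : Game) (x : Fin G.m → ℝ) : Fin G.m → ℝ := fun i =>
  ⨅ j : {j : Fin G.n // (G.minArc i j).isSome},
    (((G.minArc i j.1).get j.2 : ℤ) : ℝ) +
      ⨆ l : {l : Fin G.m // (G.maxArc j.1 l).isSome},
        ((((G.maxArc j.1 l.1).get l.2 : ℤ) : ℝ) + x l.1)

/-- `c` is the mean payoff from the initial node: the limit of `T^k(0)/k` at this node. -/
def Game.HasMeanPayoff (G : Game) (c : ℝ) : Prop :=
  Filter.Tendsto (fun k : ℕ => (G.shapley^[k] 0) G.init / (k : ℝ)) Filter.atTop (nhds c)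

def Game.enc (G : Game) : Data :=
  .pair (.pair (.int G.m) (.int G.n)) <| .pair (.int (G.init : ℕ)) <|
    .pair (.ofMatrix .ofOption G.minArc) (.ofMatrix .ofOption G.maxArc)

theorem Game.enc_injective : Function.Injective Game.enc := by
  rintro ⟨m, n, a, b, ha, hb, i⟩ ⟨m', n', a', b', ha', hb', i'⟩ h
  simp only [Game.enc, Data.pair.injEq, Data.int.injEq, Nat.cast_inj] at h
  obtain ⟨⟨rfl, rfl⟩, hi, h1, h2⟩ := h
  obtain rfl := Data.ofMatrix_injective Data.ofOption_injective h1
  obtain rfl := Data.ofMatrix_injective Data.ofOption_injective h2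
  obtain rfl := Fin.ext hi
  rfl

/-- The decision problem: is the mean payoff from the initial node nonnegative?
(`1` is yes, `0` is no.) -/
def meanPayoffGames : Problem where
  Inst := Game
  enc := Game.enc
  enc_injective := Game.enc_injective
  IsAnswer G y := ∃ c : ℝ, G.HasMeanPayoff c ∧
    ((0 ≤ c ∧ y = .int 1) ∨ (c < 0 ∧ y = .int 0))

/-! ## Tropical geometry

The max-plus semifield is `WithBot ℝ`, with addition `⊔` and multiplication `+`. -/

/-- Tropical convex cones, i.e. tropical submodules. -/
def IsTropicalCone {n : ℕ} (C : Set (Fin n → WithBot ℝ)) : Prop :=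
  (∀ x ∈ C, ∀ y ∈ C, x ⊔ y ∈ C) ∧ ∀ (a : WithBot ℝ), ∀ x ∈ C, (fun i => a + x i) ∈ C

/-- The tropical cone generated by a set. -/
def tropicalSpan {n : ℕ} (S : Set (Fin n → WithBot ℝ)) : Set (Fin n → WithBot ℝ) :=
  ⋂₀ {C | IsTropicalCone C ∧ S ⊆ C}

/-- Hilbert's projective metric, with values in `[0, +∞]`. -/
noncomputable def hilbertDist {n : ℕ} (x y : Fin n → WithBot ℝ) : EReal :=
  open Classical in
  if x = ⊥ ∧ y = ⊥ then 0
  else sInf {r : EReal | ∃ s t : ℝ,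
    (∀ i, (t : WithBot ℝ) + y i ≤ x i ∧ x i ≤ (s : WithBot ℝ) + y i) ∧ r = ((s - t : ℝ) : EReal)}

/-- The closed Hilbert ball centered at a finite vector. -/
def hilbertBall {n : ℕ} (a : Fin n → ℝ) (r : ℝ) : Set (Fin n → WithBot ℝ) :=
  {x | hilbertDist x (fun i => (a i : WithBot ℝ)) ≤ (r : EReal)}

/-- The inner radius of `S`: the supremum in `[-∞, +∞]` of the radii of the Hilbert balls that are
centered at a finite vector and included in the tropical cone generated by `S`. -/
noncomputable def innerRadius {n : ℕ} (S : Set (Fin n → WithBot ℝ)) : EReal :=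
  sSup {ρ : EReal | ∃ (r : ℝ) (a : Fin n → ℝ),
    0 ≤ r ∧ hilbertBall a r ⊆ tropicalSpan S ∧ ρ = (r : EReal)}

/-- The tropical hyperplane with parameter `a`: the vectors `x` such that the maximum of the
`a i + x i` is achieved at least twice. -/
def tropicalHyperplane {n : ℕ} (a : Fin n → WithBot ℝ) : Set (Fin n → WithBot ℝ) :=
  {x | ∃ i j, i ≠ j ∧ (∀ k, a k + x k ≤ a i + x i) ∧ ∀ k, a k + x k ≤ a j + x j}

/-- The one-sided Hausdorff distance from a (non-empty) set `S` to a set `H`. -/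
noncomputable def hausdorffDist {n : ℕ} (S H : Set (Fin n → WithBot ℝ)) : EReal :=
  ⨆ v ∈ S, ⨅ x ∈ H, hilbertDist v x

/-- The value of the tropical linear regression problem. -/
noncomputable def regressionValue {n : ℕ} (S : Set (Fin n → WithBot ℝ)) : EReal :=
  ⨅ a ∈ {a : Fin n → WithBot ℝ | a ≠ ⊥}, hausdorffDist S (tropicalHyperplane a)

/-- A (non-empty) matrix with entries in `ℤ ∪ {-∞}`, given as input. -/
structure IntMatrix where
  n : ℕ
  p : ℕ
  n_pos : 0 < n
  p_pos : 0 < p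
  entry : Fin n → Fin p → WithBot ℤ

/-- The set of columns, as real max-plus vectors. -/
def IntMatrix.columns (V : IntMatrix) : Set (Fin V.n → WithBot ℝ) :=
  Set.range fun (k : Fin V.p) (i : Fin V.n) => (V.entry i k).map (Int.cast : ℤ → ℝ)

def IntMatrix.enc (V : IntMatrix) : Data :=
  .pair (.pair (.int V.n) (.int V.p)) (.ofMatrix .ofOption V.entry)

theorem IntMatrix.enc_injective : Function.Injective IntMatrix.enc := by
  rintro ⟨n, p, hn, hp, a⟩ ⟨n', p', hn', hp', a'⟩ h
  simp only [IntMatrix.enc, Data.pair.injEq, Data.int.injEq, Nat.cast_inj] at h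
  obtain ⟨⟨rfl, rfl⟩, h1⟩ := h
  obtain rfl := Data.ofMatrix_injective Data.ofOption_injective h1
  rfl

/-- `y` is the encoding of `v ∈ ℚ ∪ {-∞, +∞}`; a rational number is given by its numerator and
denominator in lowest terms. -/
def Encodes (v : EReal) (y : Data) : Prop :=
  (v = ⊥ ∧ y = .int (-1)) ∨ (v = ⊤ ∧ y = .int 1) ∨
    ∃ q : ℚ, v = ((q : ℝ) : EReal) ∧ y = .pair (.int q.num) (.int q.den)

/-- Computing the inner radius of the tropical polyhedral cone generated by the columns. -/
def innerRadiusProblem : Problem where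
  Inst := IntMatrix
  enc := IntMatrix.enc
  enc_injective := IntMatrix.enc_injective
  IsAnswer V y := Encodes (innerRadius V.columns) y

/-- Computing the value of the tropical linear regression problem for the columns. -/
def regressionProblem : Problem where
  Inst := IntMatrix
  enc := IntMatrix.enc
  enc_injective := IntMatrix.enc_injective
  IsAnswer V y := Encodes (regressionValue V.columns) y

end TropReg

/-!
The proof reduces both geometric problems to two-sided tropical linear systems, and these to mean
payoff games, by explicit constructions that are then shown to be computable in polynomial time.

*Games.* For a discount factor `α < 1` the game has a value and optimal positional strategies
(Banach's fixed point theorem). One pair of strategies is optimal for infinitely many factors tending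
to `1`; it yields an invariant half-line `s ↦ u + s χ` of the Shapley operator `T`
(`Game.exists_halfLine`). Hence the mean payoff exists and is equal to `χ`, its entries are means of
cycles, so they have denominators at most `m`, and truncating the half-line gives, for every level
`c`, a vector `x` with `c + x ≤ T x` supported by `{χ ≥ c}` (`Game.exists_subsolution`), and a finite
vector `b` with `T b ≤ b + χ` (`Game.exists_supersolution`).

*Duality.* The regression value is the infimum of the `c` such that some `a ≠ ⊥` satisfies
`a i + v i ≤ c + max_{j ≠ i} (a j + v j)` for all data `v` and all `i` (`NearHyperplane`), and the
cone contains a ball of radius `r` iff a reversed system has a finite solution (`HasBall`). When no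
row of the matrix is empty, these two systems describe subsolutions and supersolutions of one game
(`IntMatrix.toGame`), in whose weights `c` enters as the fraction `P / D`. Therefore the regression
value and the inner radius coincide, and their common value is `+∞` or a rational number with
denominator at most `n + 1` (`IntMatrix.exists_nearHyperplane_and_hasBall`). Matrices with an empty
row are treated directly.

*From matrices to games.* An oracle call for each row decides whether the value is at most a given
rational number. As finite values are bounded by the entries and belong to the grid of step
`1 / (n + 1)!`, a dichotomy determines the value (`IntMatrix.polyTime_value`).

*From games to matrices.* The mean payoff at the initial node is nonnegative iff there is a vector
`x` with `x ≤ T x` and `x` finite at the initial node. To force the latter, Player Min can also move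
from any node to a new node of Player Max, from which the only move leads to the initial node with a
large gain `M`; by compressing the large gaps between the entries of a solution
(`exists_gap_compression`), one sees that a value of `M` of polynomial bit size suffices. With three
copies of every variable, each inequality becomes a condition that a maximum is attained twice, so
that the whole system says that the matrix `Game.toMatrix` has the regression value `0`.

*Complexity.* `PolyTime` is closed under composition, branching, bounded loops and oracle calls, the
main point being `PolyTime.exists_while`; the two reductions are assembled from these combinators.
-/

namespace TropReg

/-! ### Mean payoff games: discounted games and invariant half-lines -/

namespace Game

/-- The weight of an arc of Player Min; `0` when the arc is missing. -/
noncomputable def minW (G : Game) (i : Fin G.m) (j : Fin G.n) : ℝ := ((G.minArc i j).getD 0 : ℤ)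

/-- The weight of an arc of Player Max; `0` when the arc is missing. -/
noncomputable def maxW (G : Game) (j : Fin G.n) (i : Fin G.m) : ℝ := ((G.maxArc j i).getD 0 : ℤ)

theorem minW_eq {G : Game} {i : Fin G.m} {j : Fin G.n} {w : ℤ} (h : G.minArc i j = some w) :
    G.minW i j = w := by
  rw [minW, h]
  rfl

theorem maxW_eq {G : Game} {i : Fin G.m} {j : Fin G.n} {w : ℤ} (h : G.maxArc j i = some w) :
    G.maxW j i = w := by
  rw [maxW, h]
  rfl

theorem shapley_eq (G : Game) (x : Fin G.m → ℝ) (i : Fin G.m) :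
    G.shapley x i = ⨅ j : {j : Fin G.n // (G.minArc i j).isSome},
      (G.minW i j.1 + ⨆ l : {l : Fin G.m // (G.maxArc j.1 l).isSome}, (G.maxW j.1 l.1 + x l.1)) := by
  simp only [shapley, minW, maxW]
  have h : ∀ (o : Option ℤ) (ho : o.isSome), o.get ho = o.getD 0 := fun o ho => by
    cases o <;> simp_all
  simp only [h]

/-- An optimal move of Player Max at each of its nodes, against the continuation payoff `x`. -/
theorem exists_maxMove (G : Game) (x : Fin G.m → ℝ) (j : Fin G.n) :
    ∃ l, (G.maxArc j l).isSome ∧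
      (∀ i, (G.minArc i j).isSome → G.shapley x i ≤ G.minW i j + (G.maxW j l + x l)) := by
  have hne : Nonempty {l : Fin G.m // (G.maxArc j l).isSome} :=
    let ⟨l, h⟩ := G.exists_maxArc j; ⟨⟨l, h⟩⟩
  obtain ⟨l, hl⟩ := exists_eq_ciSup_of_finite
    (f := fun l : {l : Fin G.m // (G.maxArc j l).isSome} => G.maxW j l.1 + x l.1)
  refine ⟨l.1, l.2, fun i hi => ?_⟩
  rw [shapley_eq]
  refine (ciInf_le (Finite.bddBelow_range _) (⟨j, hi⟩ : {j : Fin G.n // (G.minArc i j).isSome})).trans ?_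
  simp only
  rw [← hl]

/-- An optimal move of Player Min at each of its nodes, against the continuation payoff `x`. -/
theorem exists_minMove (G : Game) (x : Fin G.m → ℝ) (i : Fin G.m) :
    ∃ j, (G.minArc i j).isSome ∧
      ∀ l, (G.maxArc j l).isSome → G.minW i j + (G.maxW j l + x l) ≤ G.shapley x i := by
  have hne : Nonempty {j : Fin G.n // (G.minArc i j).isSome} :=
    let ⟨l, h⟩ := G.exists_minArc i; ⟨⟨l, h⟩⟩
  obtain ⟨j, hj⟩ := exists_eq_ciInf_of_finite
    (f := fun j : {j : Fin G.n // (G.minArc i j).isSome} =>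
      (G.minW i j.1 + ⨆ l : {l : Fin G.m // (G.maxArc j.1 l).isSome}, (G.maxW j.1 l.1 + x l.1)))
  refine ⟨j.1, j.2, fun l hl => ?_⟩
  rw [shapley_eq, ← hj]
  gcongr
  exact le_ciSup (f := fun l : {l : Fin G.m // (G.maxArc j.1 l).isSome} => G.maxW j.1 l.1 + x l.1)
    (Finite.bddAbove_range _) ⟨l, hl⟩

/-- Monotonicity and additive homogeneity of the Shapley operator, in one inequality. -/
theorem shapley_le_add (G : Game) {x y : Fin G.m → ℝ} {c : ℝ} (h : ∀ i, x i ≤ y i + c)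
    (i : Fin G.m) : G.shapley x i ≤ G.shapley y i + c := by
  obtain ⟨j, hj, hy⟩ := G.exists_minMove y i
  obtain ⟨l, hl, hx⟩ := G.exists_maxMove x j
  linarith [hy l hl, hx i hj, h l]

theorem iterate_shapley_le_add (G : Game) {x y : Fin G.m → ℝ} {c : ℝ} (h : ∀ i, x i ≤ y i + c)
    (k : ℕ) (i : Fin G.m) : G.shapley^[k] x i ≤ G.shapley^[k] y i + c := by
  induction k generalizing i with
  | zero => exact h i
  | succ k ih =>
    rw [Function.iterate_succ_apply', Function.iterate_succ_apply']
    exact G.shapley_le_add ih i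

theorem lipschitzWith_discounted (G : Game) {α : ℝ} (h0 : 0 ≤ α) :
    LipschitzWith (NNReal.mk α h0) fun x : Fin G.m → ℝ => G.shapley (fun i => α * x i) := by
  refine LipschitzWith.of_dist_le_mul fun x y => ?_
  have key : ∀ x y : Fin G.m → ℝ, ∀ i, α * x i ≤ α * y i + α * dist x y := by
    intro x y i
    rw [← mul_add]
    refine mul_le_mul_of_nonneg_left ?_ h0
    have := (le_abs_self _).trans ((Real.dist_eq (x i) (y i)).ge.trans (dist_le_pi_dist x y i))
    linarith
  refine (dist_pi_le_iff (by positivity)).2 fun i => ?_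
  rw [Real.dist_eq, abs_le]
  have h1 := G.shapley_le_add (key x y) i
  have h2 := G.shapley_le_add (key y x) i
  rw [dist_comm y x] at h2
  change -(α * dist x y) ≤ _ ∧ _ ≤ α * dist x y
  constructor <;> linarith

/-- The discounted game has a value and positional optimal strategies. -/
theorem exists_discounted (G : Game) {α : ℝ} (h0 : 0 ≤ α) (h1 : α < 1) :
    ∃ (v : Fin G.m → ℝ) (σ : Fin G.m → Fin G.n) (τ : Fin G.n → Fin G.m),
      (∀ i, (G.minArc i (σ i)).isSome) ∧ (∀ j, (G.maxArc j (τ j)).isSome) ∧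
      (∀ i j, (G.minArc i j).isSome → v i ≤ G.minW i j + G.maxW j (τ j) + α * v (τ j)) ∧
      ∀ i l, (G.maxArc (σ i) l).isSome → G.minW i (σ i) + G.maxW (σ i) l + α * v l ≤ v i := by
  have hc : ContractingWith (NNReal.mk α h0) fun x : Fin G.m → ℝ => G.shapley (fun i => α * x i) :=
    ⟨by exact_mod_cast h1, G.lipschitzWith_discounted h0⟩
  have hv := hc.fixedPoint_isFixedPt
  set v := hc.fixedPoint
  choose τ hτ hτ' using G.exists_maxMove (fun i => α * v i)
  choose σ hσ hσ' using G.exists_minMove (fun i => α * v i)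
  refine ⟨v, σ, τ, hσ, hτ, fun i j hij => ?_, fun i l hl => ?_⟩
  · have := hτ' j i hij
    rw [show G.shapley (fun i => α * v i) i = v i from congrFun hv i] at this
    linarith
  · have := hσ' i l hl
    rw [show G.shapley (fun i => α * v i) i = v i from congrFun hv i] at this
    linarith

end Game

/-- The one-player case: a map `f` of a finite set with rewards `r` has a mean payoff `χ` and a bias
`u`. Both are averages over a common period of the orbits. -/
theorem exists_bias {I : Type*} [Finite I] (f : I → I) (r : I → ℝ) :
    ∃ χ u : I → ℝ, (∀ i, χ (f i) = χ i) ∧ ∀ i, χ i + u i = r i + u (f i) := by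
  obtain ⟨N, M, hNM, hf⟩ : ∃ N M : ℕ, N < M ∧ f^[N] = f^[M] := by
    obtain ⟨a, b, hab, h⟩ := Finite.exists_ne_map_eq_of_infinite (fun k : ℕ => f^[k])
    rcases lt_or_gt_of_ne hab with h' | h'
    exacts [⟨a, b, h', h⟩, ⟨b, a, h', h.symm⟩]
  obtain ⟨L, rfl⟩ : ∃ L, M = N + L := ⟨M - N, by omega⟩
  have hL : (0 : ℝ) < L := by exact_mod_cast (by omega : 0 < L)
  set s : ℕ → I → ℝ := fun t i => ∑ k ∈ Finset.range t, r (f^[k] i) with hs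
  have s_succ : ∀ t i, s (t + 1) i = s t i + r (f^[t] i) := fun t i => Finset.sum_range_succ _ _
  have s_succ' : ∀ t i, s (t + 1) i = r i + s t (f i) := fun t i => by
    simp only [hs, Finset.sum_range_succ', Function.iterate_succ_apply, Function.iterate_zero, id]
    ring
  have per : ∀ i, r (f^[N + L] i) = r (f^[N] i) := fun i => by rw [hf]
  set χ : I → ℝ := fun i => (s (N + L) i - s N i) / L with hχ
  have χL : ∀ i, χ i * L = s (N + L) i - s N i := fun i => div_mul_cancel₀ _ hL.ne'
  have hχf : ∀ i, χ (f i) = χ i := fun i => by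
    simp only [hχ]
    congr 1
    have h1 := s_succ (N + L) i
    have h2 := s_succ' (N + L) i
    have h3 := s_succ N i
    have h4 := s_succ' N i
    linarith [per i]
  refine ⟨χ, fun i => (∑ t ∈ Finset.range L, (s (N + t) i - ((N + t : ℕ) : ℝ) * χ i)) / L,
    hχf, fun i => ?_⟩
  have key : ∑ t ∈ Finset.range L, (s (N + t) i - ((N + t : ℕ) : ℝ) * χ i)
      = ∑ t ∈ Finset.range L, (s (N + (t + 1)) i - ((N + (t + 1) : ℕ) : ℝ) * χ i) := by
    have h1 := Finset.sum_range_succ (fun t => s (N + t) i - ((N + t : ℕ) : ℝ) * χ i) L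
    have h2 := Finset.sum_range_succ' (fun t => s (N + t) i - ((N + t : ℕ) : ℝ) * χ i) L
    have h3 := χL i
    push_cast at h1 h2 ⊢
    simp only [add_zero] at h2
    linarith
  have key2 : ∑ t ∈ Finset.range L, (s (N + (t + 1)) i - ((N + (t + 1) : ℕ) : ℝ) * χ i)
      = ∑ t ∈ Finset.range L, ((s (N + t) (f i) - ((N + t : ℕ) : ℝ) * χ (f i)) + (r i - χ i)) := by
    refine Finset.sum_congr rfl fun t _ => ?_
    rw [← add_assoc, s_succ', hχf]
    push_cast
    ring
  simp only
  rw [key, key2, Finset.sum_add_distrib, Finset.sum_const, Finset.card_range, nsmul_eq_mul, add_div,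
    mul_div_cancel_left₀ _ hL.ne']
  ring

/-- In the one-player case with integer rewards, the mean payoff is the mean of a cycle, hence a
rational number with a denominator bounded by the number of states. -/
theorem exists_denom_of_bias {I : Type*} [Fintype I] {f : I → I} {r χ u : I → ℝ}
    (hχ : ∀ i, χ (f i) = χ i) (hu : ∀ i, χ i + u i = r i + u (f i))
    (hr : ∀ i, ∃ z : ℤ, r i = z) (i : I) :
    ∃ (q : ℕ) (z : ℤ), 0 < q ∧ q ≤ Fintype.card I ∧ q * χ i = z := by
  obtain ⟨a, b, hab, hfab⟩ : ∃ a b : Fin (Fintype.card I + 1), a < b ∧ f^[a.1] i = f^[b.1] i := by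
    obtain ⟨a, b, hab, h⟩ := Fintype.exists_ne_map_eq_of_card_lt
      (fun k : Fin (Fintype.card I + 1) => f^[k.1] i) (by simp)
    rcases lt_or_gt_of_ne hab with h' | h'
    exacts [⟨a, b, h', h⟩, ⟨b, a, h', h.symm⟩]
  have hχk : ∀ k, χ (f^[k] i) = χ i := fun k => by
    induction k with
    | zero => rfl
    | succ k ih => rw [Function.iterate_succ_apply', hχ, ih]
  choose z hz using hr
  have tel : ∀ k, ∃ w : ℤ, k * χ i + u (f^[a.1] i) = w + u (f^[a.1 + k] i) := fun k => by
    induction k with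
    | zero => exact ⟨0, by simp⟩
    | succ k ih =>
      obtain ⟨w, hw⟩ := ih
      refine ⟨w + z (f^[a.1 + k] i), ?_⟩
      have h1 := hu (f^[a.1 + k] i)
      rw [hχk, hz, ← Function.iterate_succ_apply' f] at h1
      push_cast
      rw [show a.1 + (k + 1) = (a.1 + k).succ from rfl]
      linarith
  obtain ⟨w, hw⟩ := tel (b.1 - a.1)
  have hlt : a.1 < b.1 := hab
  rw [show a.1 + (b.1 - a.1) = b.1 by omega, ← hfab] at hw
  exact ⟨b.1 - a.1, w, by omega, by have := b.2; omega, by linarith⟩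

end TropReg

namespace TropReg
open Filter Topology

/-- An invariant half-line `s ↦ u + s χ` of a game, in the form of two lexicographic optimality
conditions: they say that `T (u + s χ) = u + (s + 1) χ` for all large `s`. -/
structure Game.HalfLine (G : Game) (χ u : Fin G.m → ℝ) : Prop where
  le : ∀ i j, (G.minArc i j).isSome → ∃ l, (G.maxArc j l).isSome ∧
    (χ i < χ l ∨ (χ i = χ l ∧ χ i + u i ≤ G.minW i j + G.maxW j l + u l))
  ge : ∀ i, ∃ j, (G.minArc i j).isSome ∧ ∀ l, (G.maxArc j l).isSome →
    (χ l < χ i ∨ (χ l = χ i ∧ G.minW i j + G.maxW j l + u l ≤ χ i + u i))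

/-- If `v k = χ / (1 - α k) + e k` satisfies an optimality inequality of the discounted game along
`α k → 1`, then `χ` and `lim e k` satisfy the lexicographic inequality in the limit. -/
theorem lex_le_of_discounted {α e e' : ℕ → ℝ} {χ χ' u u' c : ℝ} (h1 : ∀ k, α k < 1)
    (hα : Tendsto α atTop (𝓝 1)) (he : Tendsto e atTop (𝓝 u)) (he' : Tendsto e' atTop (𝓝 u'))
    (h : ∀ k, χ / (1 - α k) + e k ≤ c + α k * (χ' / (1 - α k) + e' k)) :
    χ < χ' ∨ (χ = χ' ∧ χ + u ≤ c + u') := by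
  have hpos : ∀ k, 0 < 1 - α k := fun k => sub_pos.2 (h1 k)
  have h' : ∀ k, χ + (1 - α k) * e k ≤ (1 - α k) * c + α k * (χ' + (1 - α k) * e' k) := fun k => by
    have := mul_le_mul_of_nonneg_left (h k) (hpos k).le
    have e1 : (1 - α k) * (χ / (1 - α k) + e k) = χ + (1 - α k) * e k := by
      rw [mul_add, mul_div_cancel₀ _ (hpos k).ne']
    have e2 : (1 - α k) * (c + α k * (χ' / (1 - α k) + e' k))
        = (1 - α k) * c + α k * (χ' + (1 - α k) * e' k) := by
      field_simp [(hpos k).ne']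
    rwa [e1, e2] at this
  have hα' : Tendsto (fun k => 1 - α k) atTop (𝓝 0) := by
    simpa using hα.const_sub 1
  have hle : χ ≤ χ' := by
    have t1 : Tendsto (fun k => χ + (1 - α k) * e k) atTop (𝓝 χ) := by
      simpa using (hα'.mul he).const_add χ
    have t2 : Tendsto (fun k => (1 - α k) * c + α k * (χ' + (1 - α k) * e' k)) atTop (𝓝 χ') := by
      simpa using (hα'.mul_const c).add (hα.mul ((hα'.mul he').const_add χ'))
    exact le_of_tendsto_of_tendsto' t1 t2 h'
  refine hle.lt_or_eq.imp id fun heq => ⟨heq, ?_⟩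
  subst heq
  have t1 : Tendsto (fun k => χ + e k) atTop (𝓝 (χ + u)) := he.const_add χ
  have t2 : Tendsto (fun k => c + α k * e' k) atTop (𝓝 (c + u')) := by
    simpa using (hα.mul he').const_add c
  refine le_of_tendsto_of_tendsto' t1 t2 fun k => ?_
  have := h k
  have e3 : χ / (1 - α k) = χ + α k * (χ / (1 - α k)) := by
    field_simp [(hpos k).ne']
    ring
  linarith

/-- The value of a one-player discounted problem is within a bounded distance of `χ / (1 - α)`,
uniformly in the discount factor. -/
theorem abs_discounted_sub_le {m : ℕ} {f : Fin m → Fin m} {r χ u v : Fin m → ℝ} {α : ℝ}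
    (h0 : 0 ≤ α) (h1 : α < 1) (hχ : ∀ i, χ (f i) = χ i) (hu : ∀ i, χ i + u i = r i + u (f i))
    (hv : ∀ i, v i = r i + α * v (f i)) :
    ‖fun i => v i - χ i / (1 - α)‖ ≤ 2 * ‖u‖ := by
  have hpos : 0 < 1 - α := sub_pos.2 h1
  set d : Fin m → ℝ := fun i => v i - χ i / (1 - α) - u i with hd
  have hdf : ∀ i, d i = α * d (f i) - (1 - α) * u (f i) := fun i => by
    simp only [hd, hχ]
    rw [hv i]
    have : χ i / (1 - α) = χ i + α * (χ i / (1 - α)) := by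
      field_simp [hpos.ne']
      ring
    linarith [hu i]
  have hdn : ‖d‖ ≤ α * ‖d‖ + (1 - α) * ‖u‖ := by
    refine (pi_norm_le_iff_of_nonneg (by positivity)).2 fun i => ?_
    rw [hdf]
    refine (norm_sub_le _ _).trans ?_
    rw [norm_mul, norm_mul, Real.norm_of_nonneg h0, Real.norm_of_nonneg hpos.le]
    gcongr <;> exact norm_le_pi_norm _ _
  have hdu : ‖d‖ ≤ ‖u‖ := le_of_mul_le_mul_left (by linarith) hpos
  calc ‖fun i => v i - χ i / (1 - α)‖ = ‖d + u‖ := by congr 1; funext i; simp [hd]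
    _ ≤ ‖d‖ + ‖u‖ := norm_add_le _ _
    _ ≤ 2 * ‖u‖ := by linarith

/-- Every mean payoff game has an invariant half-line, with slopes that are means of cycles. One
pair of positional strategies is optimal for a sequence of discount factors tending to `1`; it
determines `χ`, and `u` is a limit point of `v - χ / (1 - α)`. -/
theorem Game.exists_halfLine (G : Game) : ∃ χ u : Fin G.m → ℝ, G.HalfLine χ u ∧
    ∀ i, ∃ (q : ℕ) (z : ℤ), 0 < q ∧ q ≤ G.m ∧ q * χ i = z := by
  set β : ℕ → ℝ := fun k => 1 - 1 / ((k : ℝ) + 1) with hβ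
  have hβ0 : ∀ k, 0 ≤ β k := fun k => by
    simp only [hβ, sub_nonneg]
    rw [div_le_one (by positivity)]
    linarith [(Nat.cast_nonneg k : (0 : ℝ) ≤ k)]
  have hβ1 : ∀ k, β k < 1 := fun k => by
    have : 0 < 1 / ((k : ℝ) + 1) := by positivity
    simp only [hβ]
    linarith
  have hβt : Tendsto β atTop (𝓝 1) := by
    simpa [hβ] using (tendsto_one_div_add_atTop_nhds_zero_nat (𝕜 := ℝ)).const_sub 1
  choose V S Θ hS hΘ hle hge using fun k => G.exists_discounted (hβ0 k) (hβ1 k)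
  obtain ⟨⟨σ, τ⟩, hinf⟩ := Finite.exists_infinite_fiber (fun k => (S k, Θ k))
  have hinf' : ∃ᶠ k in atTop, (S k, Θ k) = (σ, τ) :=
    Nat.frequently_atTop_iff_infinite.2 (Set.infinite_coe_iff.1 hinf)
  obtain ⟨φ, hφ, hφe⟩ := extraction_of_frequently_atTop hinf'
  have hSφ : ∀ k, S (φ k) = σ := fun k => congrArg Prod.fst (hφe k)
  have hΘφ : ∀ k, Θ (φ k) = τ := fun k => congrArg Prod.snd (hφe k)
  have hσ : ∀ i, (G.minArc i (σ i)).isSome := fun i => hSφ 0 ▸ hS (φ 0) i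
  have hτ : ∀ j, (G.maxArc j (τ j)).isSome := fun j => hΘφ 0 ▸ hΘ (φ 0) j
  set f : Fin G.m → Fin G.m := fun i => τ (σ i)
  set r : Fin G.m → ℝ := fun i => G.minW i (σ i) + G.maxW (σ i) (τ (σ i)) with hr
  obtain ⟨χ, u, hχ, hu⟩ := exists_bias f r
  have hle' : ∀ k i j, (G.minArc i j).isSome →
      V (φ k) i ≤ G.minW i j + G.maxW j (τ j) + β (φ k) * V (φ k) (τ j) := fun k i j hij => by
    have := hle (φ k) i j hij
    rwa [hΘφ] at this
  have hge' : ∀ k i l, (G.maxArc (σ i) l).isSome →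
      G.minW i (σ i) + G.maxW (σ i) l + β (φ k) * V (φ k) l ≤ V (φ k) i := fun k i l hl => by
    have := hge (φ k) i l
    rw [hSφ] at this
    exact this hl
  have hVf : ∀ k i, V (φ k) i = r i + β (φ k) * V (φ k) (f i) := fun k i =>
    le_antisymm (hle' k i _ (hσ i)) (hge' k i _ (hτ _))
  obtain ⟨w, -, ψ, hψ, hw⟩ := tendsto_subseq_of_bounded
    (x := fun k i => V (φ k) i - χ i / (1 - β (φ k)))
    (Metric.isBounded_closedBall (x := (0 : Fin G.m → ℝ)) (r := 2 * ‖u‖)) fun k => by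
      rw [mem_closedBall_zero_iff]
      exact abs_discounted_sub_le (hβ0 _) (hβ1 _) hχ hu (hVf k)
  have hw' : ∀ i, Tendsto (fun k => V (φ (ψ k)) i - χ i / (1 - β (φ (ψ k)))) atTop (𝓝 (w i)) :=
    fun i => (tendsto_pi_nhds.1 hw) i
  have hα : Tendsto (fun k => β (φ (ψ k))) atTop (𝓝 1) :=
    hβt.comp (hφ.tendsto_atTop.comp hψ.tendsto_atTop)
  refine ⟨χ, w, ⟨fun i j hij => ⟨τ j, hτ j, ?_⟩, fun i => ⟨σ i, hσ i, fun l hl => ?_⟩⟩, fun i => ?_⟩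
  · refine lex_le_of_discounted (fun k => hβ1 _) hα (hw' i) (hw' (τ j)) fun k => ?_
    have := hle' (ψ k) i j hij
    simpa using this
  · have key := lex_le_of_discounted (χ := -χ i) (χ' := -χ l) (u := -w i) (u' := -w l)
      (c := -(G.minW i (σ i) + G.maxW (σ i) l)) (fun k => hβ1 _) hα (hw' i).neg (hw' l).neg
      fun k => by
        have := hge' (ψ k) i l hl
        ring_nf at this ⊢
        linarith
    rcases key with h | ⟨h, h'⟩
    · exact Or.inl (by linarith)
    · exact Or.inr ⟨by linarith, by linarith⟩
  · have := exists_denom_of_bias hχ hu (fun i => ⟨(G.minArc i (σ i)).getD 0 +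
      (G.maxArc (σ i) (τ (σ i))).getD 0, by simp [hr, minW, maxW]⟩) i
    simpa using this

end TropReg

namespace TropReg
open Filter Topology

/-! ### Mean payoffs, subsolutions and supersolutions -/

namespace Game

theorem HalfLine.eventually_le {G : Game} {χ u : Fin G.m → ℝ} (h : G.HalfLine χ u) :
    ∀ᶠ s : ℝ in atTop, ∀ i j, (G.minArc i j).isSome → ∃ l, (G.maxArc j l).isSome ∧ χ i ≤ χ l ∧
      u i + (s + 1) * χ i ≤ G.minW i j + (G.maxW j l + (u l + s * χ l)) := by
  simp only [eventually_all]
  intro i j hij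
  obtain ⟨l, hl, h | ⟨h, h'⟩⟩ := h.le i j hij
  · filter_upwards [eventually_ge_atTop
      ((u i + χ i - G.minW i j - G.maxW j l - u l) / (χ l - χ i))] with s hs
    rw [div_le_iff₀ (by linarith)] at hs
    exact ⟨l, hl, h.le, by linarith⟩
  · exact Eventually.of_forall fun s => ⟨l, hl, h.le, by rw [h] at h' ⊢; linarith⟩

theorem HalfLine.eventually_ge {G : Game} {χ u : Fin G.m → ℝ} (h : G.HalfLine χ u) :
    ∀ᶠ s : ℝ in atTop, ∀ i, ∃ j, (G.minArc i j).isSome ∧ ∀ l, (G.maxArc j l).isSome →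
      G.minW i j + (G.maxW j l + (u l + s * χ l)) ≤ u i + (s + 1) * χ i := by
  rw [eventually_all]
  intro i
  obtain ⟨j, hj, h⟩ := h.ge i
  suffices H : ∀ᶠ s : ℝ in atTop, ∀ l, (G.maxArc j l).isSome →
      G.minW i j + (G.maxW j l + (u l + s * χ l)) ≤ u i + (s + 1) * χ i from
    H.mono fun s hs => ⟨j, hj, hs⟩
  simp only [eventually_all]
  intro l hl
  rcases h l hl with h | ⟨h, h'⟩
  · filter_upwards [eventually_ge_atTop
      ((G.minW i j + G.maxW j l + u l - u i - χ i) / (χ i - χ l))] with s hs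
    rw [div_le_iff₀ (by linarith)] at hs
    linarith
  · exact Eventually.of_forall fun s => by rw [h]; linarith

/-- The slope of an invariant half-line is the vector of mean payoffs. -/
theorem HalfLine.tendsto {G : Game} {χ u : Fin G.m → ℝ} (h : G.HalfLine χ u) (i : Fin G.m) :
    Tendsto (fun k : ℕ => (G.shapley^[k] 0) i / (k : ℝ)) atTop (𝓝 (χ i)) := by
  obtain ⟨s, hs⟩ := eventually_atTop.1 (h.eventually_le.and h.eventually_ge)
  have half : ∀ t ≥ s, ∀ i, G.shapley (fun i => u i + t * χ i) i = u i + (t + 1) * χ i := by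
    intro t ht i
    obtain ⟨h1, h2⟩ := hs t ht
    refine le_antisymm ?_ ?_
    · obtain ⟨j, hj, hj'⟩ := h2 i
      obtain ⟨l, hl, hl'⟩ := G.exists_maxMove (fun i => u i + t * χ i) j
      exact (hl' i hj).trans (hj' l hl)
    · obtain ⟨j, hj, hj'⟩ := G.exists_minMove (fun i => u i + t * χ i) i
      obtain ⟨l, hl, -, hl'⟩ := h1 i j hj
      exact hl'.trans (hj' l hl)
  have iter : ∀ k : ℕ, G.shapley^[k] (fun i => u i + s * χ i) = fun i => u i + (s + k) * χ i := by
    intro k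
    induction k with
    | zero => simp
    | succ k ih =>
      rw [Function.iterate_succ_apply', ih]
      funext i
      rw [half _ (by linarith [(Nat.cast_nonneg k : (0 : ℝ) ≤ k)])]
      push_cast
      ring
  set C := ‖fun i => u i + s * χ i‖ with hC
  have hCi : ∀ i, |u i + s * χ i| ≤ C := fun i => norm_le_pi_norm (fun i => u i + s * χ i) i
  have hle : ∀ k : ℕ, |G.shapley^[k] 0 i - k * χ i| ≤ 2 * C := by
    intro k
    have h1 := G.iterate_shapley_le_add (x := 0) (y := fun i => u i + s * χ i) (c := C)
      (fun i => by have := (abs_le.1 (hCi i)).1; simp only [Pi.zero_apply]; linarith) k i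
    have h2 := G.iterate_shapley_le_add (y := 0) (x := fun i => u i + s * χ i) (c := C)
      (fun i => by have := (abs_le.1 (hCi i)).2; simp only [Pi.zero_apply]; linarith) k i
    rw [iter] at h1 h2
    simp only at h1 h2
    have h3 := abs_le.1 (hCi i)
    rw [abs_le]
    constructor <;> linarith [h3.1, h3.2]
  rw [tendsto_iff_norm_sub_tendsto_zero]
  refine squeeze_zero' (Eventually.of_forall fun _ => norm_nonneg _) ?_
    (tendsto_const_div_atTop_nhds_zero_nat (2 * C))
  filter_upwards [eventually_gt_atTop 0] with k hk
  have hk' : (0 : ℝ) < k := by exact_mod_cast hk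
  rw [Real.norm_eq_abs, show G.shapley^[k] 0 i / (k : ℝ) - χ i = (G.shapley^[k] 0 i - k * χ i) / k by
    field_simp, abs_div, abs_of_pos hk']
  gcongr
  exact hle k

/-- The vector of mean payoffs of a game. -/
noncomputable def payoff (G : Game) : Fin G.m → ℝ := G.exists_halfLine.choose

theorem exists_halfLine_payoff (G : Game) : ∃ u, G.HalfLine G.payoff u :=
  let ⟨u, h, _⟩ := G.exists_halfLine.choose_spec
  ⟨u, h⟩

theorem tendsto_payoff (G : Game) (i : Fin G.m) :
    Tendsto (fun k : ℕ => (G.shapley^[k] 0) i / (k : ℝ)) atTop (𝓝 (G.payoff i)) :=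
  let ⟨_, h⟩ := G.exists_halfLine_payoff
  h.tendsto i

theorem exists_denom_payoff (G : Game) (i : Fin G.m) :
    ∃ (q : ℕ) (z : ℤ), 0 < q ∧ q ≤ G.m ∧ q * G.payoff i = z :=
  let ⟨_, _, h⟩ := G.exists_halfLine.choose_spec
  h i

/-- Above the level `c` of the mean payoff there is a subsolution `c + x ≤ T x`. -/
theorem exists_subsolution (G : Game) (c : ℝ) : ∃ x : Fin G.m → WithBot ℝ,
    (∀ i, x i ≠ ⊥ ↔ c ≤ G.payoff i) ∧
    ∀ i j w, G.minArc i j = some w → ∃ l w', G.maxArc j l = some w' ∧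
      (c : WithBot ℝ) + x i ≤ ((w + w' : ℝ) : WithBot ℝ) + x l := by
  obtain ⟨u, h⟩ := G.exists_halfLine_payoff
  obtain ⟨s, hs⟩ := h.eventually_le.exists
  refine ⟨fun i => if c ≤ G.payoff i then ((u i + s * G.payoff i : ℝ) : WithBot ℝ) else ⊥,
    fun i => ?_, fun i j w hw => ?_⟩
  · by_cases hc : c ≤ G.payoff i
    · simp only [hc, if_true, iff_true]
      exact WithBot.coe_ne_bot
    · simp [hc]
  obtain ⟨l, hl, hil, hle⟩ := hs i j (Option.isSome_iff_exists.2 ⟨w, hw⟩)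
  obtain ⟨w', hw'⟩ := Option.isSome_iff_exists.1 hl
  rw [minW_eq hw, maxW_eq hw'] at hle
  refine ⟨l, w', hw', ?_⟩
  by_cases hc : c ≤ G.payoff i
  · simp only [hc, hc.trans hil, if_true]
    norm_cast
    push_cast
    linarith
  · simp [hc]

/-- There is a finite supersolution `T b ≤ b + χ`. -/
theorem exists_supersolution (G : Game) : ∃ b : Fin G.m → ℝ, ∀ i, ∃ j w, G.minArc i j = some w ∧
    ∀ l w', G.maxArc j l = some w' → w + w' + b l ≤ b i + G.payoff i := by
  obtain ⟨u, h⟩ := G.exists_halfLine_payoff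
  obtain ⟨s, hs⟩ := h.eventually_ge.exists
  refine ⟨fun i => u i + s * G.payoff i, fun i => ?_⟩
  obtain ⟨j, hj, hj'⟩ := hs i
  obtain ⟨w, hw⟩ := Option.isSome_iff_exists.1 hj
  refine ⟨j, w, hw, fun l w' hw' => ?_⟩
  have := hj' l (Option.isSome_iff_exists.2 ⟨w', hw'⟩)
  rw [minW_eq hw, maxW_eq hw'] at this
  linarith

/-- A subsolution `c + x ≤ T x` bounds the mean payoff from below on its support. -/
theorem le_payoff_of_subsolution (G : Game) {c : ℝ} {x : Fin G.m → WithBot ℝ}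
    (hx : ∀ i j w, G.minArc i j = some w → ∃ l w', G.maxArc j l = some w' ∧
      (c : WithBot ℝ) + x i ≤ ((w + w' : ℝ) : WithBot ℝ) + x l)
    {i : Fin G.m} (hi : x i ≠ ⊥) : c ≤ G.payoff i := by
  obtain ⟨C, hC⟩ : ∃ C : ℝ, ∀ i (y : ℝ), x i = y → y ≤ C := by
    obtain ⟨C, hC⟩ := Finite.bddAbove_range fun i => (x i).unbotD 0
    exact ⟨C, fun i y hy => by simpa [hy] using hC (Set.mem_range_self i)⟩
  have key : ∀ (k : ℕ) i (y : ℝ), x i = y → k * c + y ≤ C + G.shapley^[k] 0 i := by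
    intro k
    induction k with
    | zero => intro i y hy; simpa using hC i y hy
    | succ k ih =>
      intro i y hy
      obtain ⟨j, hj, hj'⟩ := G.exists_minMove (G.shapley^[k] 0) i
      obtain ⟨w, hw⟩ := Option.isSome_iff_exists.1 hj
      obtain ⟨l, w', hw', hle⟩ := hx i j w hw
      have hjl := hj' l (Option.isSome_iff_exists.2 ⟨w', hw'⟩)
      rw [minW_eq hw, maxW_eq hw'] at hjl
      obtain ⟨z, hz⟩ : ∃ z : ℝ, x l = z := by
        rw [hy] at hle
        cases h : x l with
        | bot => rw [h] at hle; simp [← WithBot.coe_add] at hle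
        | coe z => exact ⟨z, rfl⟩
      rw [hy, hz] at hle
      norm_cast at hle
      rw [Function.iterate_succ_apply']
      push_cast at hle ⊢
      linarith [ih l z hz]
  obtain ⟨y, hy⟩ := WithBot.ne_bot_iff_exists.1 hi
  have t1 : Tendsto (fun k : ℕ => c + (y - C) / k) atTop (𝓝 (c + 0)) :=
    (tendsto_const_div_atTop_nhds_zero_nat (y - C)).const_add c
  rw [add_zero] at t1
  refine le_of_tendsto_of_tendsto t1 (G.tendsto_payoff i) ?_
  filter_upwards [eventually_gt_atTop 0] with k hk
  have hk' : (0 : ℝ) < k := by exact_mod_cast hk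
  have := key k i y hy.symm
  rw [le_div_iff₀ hk', add_mul, div_mul_cancel₀ _ hk'.ne']
  linarith

theorem hasMeanPayoff_iff (G : Game) (c : ℝ) : G.HasMeanPayoff c ↔ c = G.payoff G.init :=
  ⟨fun h => tendsto_nhds_unique h (G.tendsto_payoff G.init), fun h => h ▸ G.tendsto_payoff G.init⟩

end Game

end TropReg

namespace TropReg

/-! ### Tropical linear regression and inner radius as two-sided linear systems -/

/-- Some tropical hyperplane is at distance at most `c` from all the vectors `v k`, in the form of a
two-sided tropical linear system in its parameter `a`. -/
def NearHyperplane {K : Type*} {n : ℕ} (v : K → Fin n → WithBot ℝ) (c : ℝ) : Prop :=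
  ∃ a : Fin n → WithBot ℝ, a ≠ ⊥ ∧
    ∀ k i, a i + v k i ≠ ⊥ → ∃ j, j ≠ i ∧ a i + v k i ≤ c + (a j + v k j)

/-- Some Hilbert ball of radius `r` with finite center, here `-b`, is included in the tropical cone
generated by the vectors `v k`, in the form of a tropical inequality on `b`. -/
def HasBall {K : Type*} {n : ℕ} (v : K → Fin n → WithBot ℝ) (r : ℝ) : Prop :=
  ∃ b : Fin n → ℝ, ∀ i, ∃ k, v k i ≠ ⊥ ∧ ∀ l, l ≠ i → (r : WithBot ℝ) + (b l + v k l) ≤ b i + v k i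

section

variable {n : ℕ}

theorem hilbertDist_le {x y : Fin n → WithBot ℝ} {s t : ℝ} (hts : t ≤ s)
    (h : ∀ i, (t : WithBot ℝ) + y i ≤ x i ∧ x i ≤ (s : WithBot ℝ) + y i) :
    hilbertDist x y ≤ ((s - t : ℝ) : EReal) := by
  rw [hilbertDist]
  split_ifs
  · exact_mod_cast sub_nonneg.2 hts
  · exact sInf_le ⟨s, t, h, rfl⟩

theorem exists_of_hilbertDist_lt {x y : Fin n → WithBot ℝ} {c : EReal} (h : hilbertDist x y < c) :
    (x = ⊥ ∧ y = ⊥) ∨ ∃ s t : ℝ,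
      (∀ i, (t : WithBot ℝ) + y i ≤ x i ∧ x i ≤ (s : WithBot ℝ) + y i) ∧ ((s - t : ℝ) : EReal) < c := by
  rw [hilbertDist] at h
  split_ifs at h with h0
  · exact Or.inl h0
  · obtain ⟨_, ⟨s, t, hst, rfl⟩, hlt⟩ := sInf_lt_iff.1 h
    exact Or.inr ⟨s, t, hst, hlt⟩

theorem hilbertDist_nonneg (x y : Fin n → WithBot ℝ) : 0 ≤ hilbertDist x y := by
  rw [hilbertDist]
  split_ifs with h0
  · exact le_rfl
  · refine le_sInf ?_
    rintro _ ⟨s, t, h, rfl⟩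
    obtain ⟨i, hi⟩ : ∃ i, ¬ (x i = ⊥ ∧ y i = ⊥) := by
      by_contra! H
      exact h0 ⟨funext fun i => (H i).1, funext fun i => (H i).2⟩
    have h1 := h i
    generalize x i = a at h1 hi
    generalize y i = b at h1 hi
    cases a <;> cases b
    · simp at hi
    · simp [← WithBot.coe_add] at h1
    · simp at h1
    · norm_cast at h1
      exact_mod_cast (by linarith [h1.1, h1.2] : (0 : ℝ) ≤ s - t)

theorem nearHyperplane_of_regressionValue_lt {K : Type*} {v : K → Fin n → WithBot ℝ} {c : ℝ}
    (h : regressionValue (Set.range v) < c) : NearHyperplane v c := by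
  rw [regressionValue] at h
  simp only [iInf_lt_iff, Set.mem_ofPred_eq, exists_prop] at h
  obtain ⟨a, ha, h⟩ := h
  refine ⟨a, ha, fun k i hi => ?_⟩
  have h1 : ⨅ x ∈ tropicalHyperplane a, hilbertDist (v k) x < c :=
    (le_iSup₂ (f := fun w (_ : w ∈ Set.range v) => ⨅ x ∈ tropicalHyperplane a, hilbertDist w x)
      (v k) (Set.mem_range_self k)).trans_lt h
  simp only [iInf_lt_iff, exists_prop] at h1
  obtain ⟨x, hx, hd⟩ := h1
  rcases exists_of_hilbertDist_lt hd with ⟨h0, -⟩ | ⟨s, t, hst, hlt⟩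
  · simp [h0] at hi
  obtain ⟨j, hji, hj⟩ : ∃ j, j ≠ i ∧ ∀ l, a l + x l ≤ a j + x j := by
    obtain ⟨j, j', hjj, hj, hj'⟩ := hx
    by_cases hji : j = i
    · exact ⟨j', fun h => hjj (hji.trans h.symm), hj'⟩
    · exact ⟨j, hji, hj⟩
  refine ⟨j, hji, ?_⟩
  have hlt' : s - t < c := by exact_mod_cast hlt
  have h1 := (hst i).2
  have h2 := (hst j).1
  have h3 := hj i
  generalize a i = ai at *
  generalize a j = aj at *
  generalize x i = xi at *
  generalize x j = xj at *
  generalize v k i = vi at *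
  generalize v k j = vj at *
  cases ai <;> cases vi <;> simp at hi
  cases xi
  · simp at h1
  cases aj
  · simp [← WithBot.coe_add] at h3
  cases xj
  · simp [← WithBot.coe_add] at h3
  cases vj
  · simp [← WithBot.coe_add] at h2
  norm_cast at *
  linarith

theorem regressionValue_le {K : Type*} [Finite K] {v : K → Fin n → WithBot ℝ} {c : ℝ} (hn : 2 ≤ n)
    (hc : 0 ≤ c) (h : NearHyperplane v c) : regressionValue (Set.range v) ≤ c := by
  obtain ⟨a, ha, h⟩ := h
  refine iInf₂_le_of_le a ha (iSup₂_le ?_)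
  rintro _ ⟨k, rfl⟩
  have : Nontrivial (Fin n) := Fin.nontrivial_iff_two_le.2 hn
  have : NeZero n := ⟨by omega⟩
  obtain ⟨i, hi⟩ := Finite.exists_max fun i => a i + v k i
  by_cases h0 : a i + v k i = ⊥
  · -- `v k` itself is on the hyperplane
    obtain ⟨j, hj⟩ := exists_ne i
    refine iInf₂_le_of_le (v k) ⟨i, j, hj.symm, hi, fun l => ?_⟩ ?_
    · rw [le_bot_iff.1 ((hi l).trans h0.le)]
      exact bot_le
    · refine (hilbertDist_le (s := 0) (t := 0) le_rfl fun i => by simp).trans ?_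
      simpa using hc
  · -- lower the `i`-th entry of `v k` until the maximum is achieved twice
    have : Nonempty {j : Fin n // j ≠ i} := let ⟨j, hj⟩ := exists_ne i; ⟨⟨j, hj⟩⟩
    obtain ⟨j, hj⟩ := Finite.exists_max fun j : {j : Fin n // j ≠ i} => a j.1 + v k j.1
    obtain ⟨j', hj', hle⟩ := h k i h0
    have hle' : a i + v k i ≤ c + (a j.1 + v k j.1) :=
      hle.trans (by have := hj ⟨j', hj'⟩; gcongr)
    obtain ⟨A, W, hA, hW⟩ : ∃ A W : ℝ, a i = A ∧ v k i = W := by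
      cases hA : a i
      · simp [hA] at h0
      cases hW : v k i
      · simp [hW] at h0
      exact ⟨_, _, rfl, rfl⟩
    obtain ⟨A', W', hA', hW'⟩ : ∃ A' W' : ℝ, a j.1 = A' ∧ v k j.1 = W' := by
      rw [hA, hW] at hle'
      cases hA' : a j.1
      · simp [hA', ← WithBot.coe_add] at hle'
      cases hW' : v k j.1
      · simp [hW', ← WithBot.coe_add] at hle'
      exact ⟨_, _, rfl, rfl⟩
    have hji : A' + W' ≤ A + W := by
      have := hi j.1
      rw [hA, hW, hA', hW'] at this
      exact_mod_cast this
    have hij : A + W ≤ c + (A' + W') := by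
      rw [hA, hW, hA', hW'] at hle'
      exact_mod_cast hle'
    refine iInf₂_le_of_le (Function.update (v k) i ((A' + W' - A : ℝ) : WithBot ℝ))
      ⟨i, j.1, j.2.symm, ?_⟩ ?_
    · have e1 : a i + Function.update (v k) i ((A' + W' - A : ℝ) : WithBot ℝ) i
          = a j.1 + v k j.1 := by
        rw [Function.update_self, hA, hA', hW']
        norm_cast
        ring
      have e2 : ∀ l, l ≠ i → Function.update (v k) i ((A' + W' - A : ℝ) : WithBot ℝ) l = v k l :=
        fun l hl => Function.update_of_ne hl _ _
      have e3 : ∀ l, a l + Function.update (v k) i ((A' + W' - A : ℝ) : WithBot ℝ) l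
          ≤ a j.1 + v k j.1 := fun l => by
        by_cases hl : l = i
        · rw [hl, e1]
        · rw [e2 l hl]
          exact hj ⟨l, hl⟩
      exact ⟨fun l => (e3 l).trans e1.ge, fun l => by rw [e2 _ j.2]; exact e3 l⟩
    · refine (hilbertDist_le (s := c) (t := 0) hc fun l => ?_).trans (by simp)
      by_cases hl : l = i
      · subst hl
        rw [Function.update_self, hW]
        norm_cast
        constructor <;> linarith
      · rw [Function.update_of_ne hl]
        refine ⟨by simp, ?_⟩
        cases v k l
        · simp
        · norm_cast
          linarith

theorem regressionValue_nonneg {K : Type*} [Nonempty K] (v : K → Fin n → WithBot ℝ) :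
    0 ≤ regressionValue (Set.range v) := by
  refine le_iInf₂ fun a _ => ?_
  obtain ⟨k⟩ := ‹Nonempty K›
  exact (le_iInf₂ fun x _ => hilbertDist_nonneg _ _).trans
    (le_iSup₂ (f := fun w (_ : w ∈ Set.range v) => ⨅ x ∈ tropicalHyperplane a, hilbertDist w x)
      (v k) (Set.mem_range_self k))

theorem exists_of_mem_tropicalSpan {K : Type*} {v : K → Fin n → WithBot ℝ} {x : Fin n → WithBot ℝ}
    (hx : x ∈ tropicalSpan (Set.range v)) {i : Fin n} (hi : x i ≠ ⊥) :
    ∃ k, v k i ≠ ⊥ ∧ ∀ l, v k l + x i ≤ x l + v k i := by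
  refine hx {x | ∀ i, x i ≠ ⊥ → ∃ k, v k i ≠ ⊥ ∧ ∀ l, v k l + x i ≤ x l + v k i}
    ⟨⟨fun x hx y hy i hi => ?_, fun a x hx i hi => ?_⟩, ?_⟩ i hi
  · rw [Pi.sup_apply] at hi ⊢
    rcases le_total (x i) (y i) with h | h
    · rw [sup_eq_right.2 h] at hi ⊢
      obtain ⟨k, hk, hk'⟩ := hy i hi
      exact ⟨k, hk, fun l => (hk' l).trans (by gcongr; exact le_sup_right)⟩
    · rw [sup_eq_left.2 h] at hi ⊢
      obtain ⟨k, hk, hk'⟩ := hx i hi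
      exact ⟨k, hk, fun l => (hk' l).trans (by gcongr; exact le_sup_left)⟩
  · obtain ⟨k, hk, hk'⟩ := hx i (by rintro h; simp [h] at hi)
    refine ⟨k, hk, fun l => ?_⟩
    have h1 : a + (v k l + x i) ≤ a + (x l + v k i) := add_le_add le_rfl (hk' l)
    rwa [add_left_comm, ← add_assoc a (x l)] at h1
  · rintro _ ⟨k, rfl⟩ i hi
    exact ⟨k, hi, fun l => le_rfl⟩

theorem exists_real_of_mem_hilbertBall [NeZero n] {a : Fin n → ℝ} {r : ℝ} {x : Fin n → WithBot ℝ}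
    (hx : x ∈ hilbertBall a r) :
    ∃ y : Fin n → ℝ, (x = fun i => (y i : WithBot ℝ)) ∧ ∀ i l, y i - a i - (y l - a l) ≤ r := by
  have key : ∀ ε : ℝ, 0 < ε → ∃ s t : ℝ,
      (∀ i, (t : WithBot ℝ) + a i ≤ x i ∧ x i ≤ (s : WithBot ℝ) + a i) ∧ s - t < r + ε := by
    intro ε hε
    have h : hilbertDist x (fun i => (a i : WithBot ℝ)) < ((r + ε : ℝ) : EReal) :=
      lt_of_le_of_lt hx (by exact_mod_cast (by linarith : r < r + ε))
    rcases exists_of_hilbertDist_lt h with ⟨-, h0⟩ | ⟨s, t, hst, hlt⟩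
    · exact absurd (congrFun h0 0) (by simp)
    · exact ⟨s, t, hst, by exact_mod_cast hlt⟩
  have hfin : ∀ i, ∃ y : ℝ, x i = y := fun i => by
    obtain ⟨s, t, hst, -⟩ := key 1 one_pos
    have := (hst i).1
    cases h : x i
    · rw [h] at this
      simp [← WithBot.coe_add] at this
    · exact ⟨_, rfl⟩
  choose y hy using hfin
  refine ⟨y, funext hy, fun i l => le_of_forall_pos_lt_add fun ε hε => ?_⟩
  obtain ⟨s, t, hst, hlt⟩ := key ε hε
  have h1 := (hst i).2
  have h2 := (hst l).1
  rw [hy] at h1 h2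
  norm_cast at h1 h2
  linarith

/-- A Hilbert ball of radius `r` is included in the cone as soon as its `n` extreme points, obtained
from the center by adding `r` to one entry, belong to the cone. -/
theorem exists_ball_iff_hasBall [NeZero n] {K : Type*} {v : K → Fin n → WithBot ℝ} {r : ℝ}
    (hr : 0 ≤ r) : (∃ a, hilbertBall a r ⊆ tropicalSpan (Set.range v)) ↔ HasBall v r := by
  constructor
  · rintro ⟨a, ha⟩
    refine ⟨fun i => -a i, fun i => ?_⟩
    set x : Fin n → WithBot ℝ := fun l => (((if l = i then r else 0) + a l : ℝ) : WithBot ℝ) with hx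
    have hxb : x ∈ hilbertBall a r := by
      refine (hilbertDist_le (s := r) (t := 0) hr fun l => ?_).trans (by simp)
      simp only [hx]
      norm_cast
      split_ifs <;> constructor <;> linarith
    obtain ⟨k, hk, hk'⟩ := exists_of_mem_tropicalSpan (ha hxb) (i := i) WithBot.coe_ne_bot
    refine ⟨k, hk, fun l hl => ?_⟩
    have h1 := hk' l
    simp only [hx, if_true, hl, if_false] at h1
    generalize v k i = vi at *
    generalize v k l = vl at *
    cases vi
    · simp at hk
    cases vl
    · simp
    norm_cast at h1 ⊢
    linarith
  · rintro ⟨b, hb⟩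
    choose k hk hk' using hb
    refine ⟨fun i => -b i, fun x hx => ?_⟩
    obtain ⟨y, rfl, hy⟩ := exists_real_of_mem_hilbertBall hx
    have hW : ∀ i, ∃ W : ℝ, v (k i) i = W := fun i => by
      cases h : v (k i) i
      · exact absurd h (hk i)
      · exact ⟨_, rfl⟩
    choose W hW using hW
    rintro C ⟨⟨hsup, hadd⟩, hS⟩
    have hmem : Finset.univ.sup' Finset.univ_nonempty
        (fun i l => ((y i - W i : ℝ) : WithBot ℝ) + v (k i) l) ∈ C :=
      Finset.sup'_induction _ _ hsup fun i _ => hadd _ _ (hS (Set.mem_range_self _))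
    convert hmem using 1
    funext l
    rw [Finset.sup'_apply]
    refine le_antisymm ?_ (Finset.sup'_le _ _ fun i _ => ?_)
    · refine le_trans ?_ (Finset.le_sup' _ (Finset.mem_univ l))
      rw [hW]
      norm_cast
      linarith
    · by_cases hil : l = i
      · subst hil
        rw [hW]
        norm_cast
        linarith
      · have h1 := hk' i l hil
        rw [hW] at h1
        generalize v (k i) l = vl at *
        cases vl
        · simp
        · norm_cast at h1 ⊢
          linarith [hy i l]

theorem innerRadius_eq [NeZero n] {K : Type*} (v : K → Fin n → WithBot ℝ) :
    innerRadius (Set.range v) = sSup {ρ : EReal | ∃ r : ℝ, 0 ≤ r ∧ HasBall v r ∧ ρ = (r : EReal)} := by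
  rw [innerRadius]
  congr 1
  ext ρ
  constructor
  · rintro ⟨r, a, hr, ha, rfl⟩
    exact ⟨r, hr, (exists_ball_iff_hasBall hr).1 ⟨a, ha⟩, rfl⟩
  · rintro ⟨r, hr, h, rfl⟩
    obtain ⟨a, ha⟩ := (exists_ball_iff_hasBall hr).2 h
    exact ⟨r, a, hr, ha, rfl⟩

/-- Weak duality between the two problems. -/
theorem HasBall.le_of_nearHyperplane {K : Type*} {v : K → Fin n → WithBot ℝ} {r c : ℝ}
    (hr : HasBall v r) (hc : NearHyperplane v c) : r ≤ c := by
  obtain ⟨b, hb⟩ := hr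
  obtain ⟨a, ha, h⟩ := hc
  obtain ⟨i₀, hi₀⟩ : ∃ i, a i ≠ ⊥ := Function.ne_iff.1 ha
  have : Nonempty (Fin n) := ⟨i₀⟩
  obtain ⟨i, hi⟩ := Finite.exists_max fun i => a i + ((-b i : ℝ) : WithBot ℝ)
  obtain ⟨A, hA⟩ : ∃ A : ℝ, a i = A := by
    cases hA : a i
    · have := hi i₀
      rw [hA, WithBot.bot_add, le_bot_iff, WithBot.add_eq_bot] at this
      simp [hi₀] at this
    · exact ⟨_, rfl⟩
  obtain ⟨k, hk, hk'⟩ := hb i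
  obtain ⟨j, hji, hj⟩ := h k i (by simp [hA, hk])
  have h1 := hk' j hji
  have h2 := hi j
  rw [hA] at h2 hj
  generalize v k i = vi at *
  generalize v k j = vj at *
  generalize a j = aj at *
  cases vi
  · simp at hk
  cases aj
  · simp [← WithBot.coe_add] at hj
  cases vj
  · simp [← WithBot.coe_add] at hj
  norm_cast at *
  linarith

end

end TropReg

namespace TropReg

/-! ### The game of a matrix -/

namespace IntMatrix

/-- The columns of a matrix, as a family of max-plus vectors. -/
noncomputable def vec (V : IntMatrix) (k : Fin V.p) (i : Fin V.n) : WithBot ℝ :=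
  (V.entry i k).map (Int.cast : ℤ → ℝ)

/-- The entries of a matrix, extended by `none` to all pairs of natural numbers. -/
def ent (V : IntMatrix) (i k : ℕ) : Option ℤ :=
  if h : i < V.n ∧ k < V.p then V.entry ⟨i, h.1⟩ ⟨k, h.2⟩ else none

theorem ent_val (V : IntMatrix) (i : Fin V.n) (k : Fin V.p) : V.ent i k = V.entry i k :=
  dif_pos ⟨i.2, k.2⟩

theorem vec_eq_bot_iff {V : IntMatrix} {k : Fin V.p} {i : Fin V.n} :
    V.vec k i = ⊥ ↔ V.ent i k = none := by
  rw [vec, ent_val]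
  exact WithBot.map_eq_bot_iff

theorem vec_eq_coe {V : IntMatrix} {k : Fin V.p} {i : Fin V.n} {z : ℤ} (h : V.ent i k = some z) :
    V.vec k i = ((z : ℝ) : WithBot ℝ) := by
  rw [ent_val] at h
  rw [vec, h]
  rfl

theorem exists_vec_eq_coe {V : IntMatrix} {k : Fin V.p} {i : Fin V.n} (h : V.vec k i ≠ ⊥) :
    ∃ z : ℤ, V.ent i k = some z ∧ V.vec k i = ((z : ℝ) : WithBot ℝ) := by
  obtain ⟨z, hz⟩ := Option.ne_none_iff_exists'.1 fun h' => h (vec_eq_bot_iff.2 h')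
  exact ⟨z, hz, vec_eq_coe hz⟩

/-- Every row of the matrix has a finite entry. -/
def RowsFinite (V : IntMatrix) : Prop := ∀ i < V.n, ∃ k < V.p, V.ent i k ≠ none

/-- The arcs of Player Min in the game of `V`: at the node `i < n`, Min chooses a column `k` with a
finite entry `V i k` and moves to the node `k n + i` of Max; the node `n` of Min is a sink, from
which Min moves to the last node of Max. -/
def gameMin (V : IntMatrix) (D P : ℤ) (i j : ℕ) : Option ℤ :=
  if j < V.p * V.n then
    if j % V.n = i then (V.ent i (j / V.n)).map (fun z => P - D * z) else none
  else if i = V.n then some 0 else none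

/-- The arcs of Player Max in the game of `V`: at the node `k n + i`, Max chooses a row `l ≠ i` with
a finite entry `V l k` and moves to the node `l` of Min, or else moves to the losing sink. -/
def gameMax (V : IntMatrix) (D : ℤ) (j l : ℕ) : Option ℤ :=
  if l = V.n then some (-1)
  else if j < V.p * V.n ∧ j % V.n ≠ l then (V.ent l (j / V.n)).map (fun z => D * z) else none

theorem index_lt (V : IntMatrix) {i k : ℕ} (hi : i < V.n) (hk : k < V.p) :
    k * V.n + i < V.p * V.n := by
  calc k * V.n + i < k * V.n + V.n := by omega
    _ = (k + 1) * V.n := by ring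
    _ ≤ V.p * V.n := Nat.mul_le_mul_right _ hk

theorem gameMin_index (V : IntMatrix) (D P : ℤ) {i k : ℕ} (hi : i < V.n) (hk : k < V.p) :
    V.gameMin D P i (k * V.n + i) = (V.ent i k).map (fun z => P - D * z) := by
  have h1 : (k * V.n + i) % V.n = i := by rw [mul_comm, Nat.mul_add_mod, Nat.mod_eq_of_lt hi]
  have h2 : (k * V.n + i) / V.n = k := by
    rw [mul_comm, Nat.mul_add_div V.n_pos, Nat.div_eq_of_lt hi, add_zero]
  rw [gameMin, if_pos (V.index_lt hi hk), if_pos h1, h2]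

theorem gameMin_eq_some {V : IntMatrix} {D P w : ℤ} {i j : ℕ} : V.gameMin D P i j = some w ↔
    (j < V.p * V.n ∧ j % V.n = i ∧ ∃ z, V.ent i (j / V.n) = some z ∧ w = P - D * z) ∨
      (V.p * V.n ≤ j ∧ i = V.n ∧ w = 0) := by
  rw [gameMin]
  split_ifs with h1 h2 h2
  · simp [h1, h2, h1.not_ge, eq_comm]
  · simp [h2, h1.not_ge]
  · simp [h1, h2, not_lt.1 h1, eq_comm]
  · simp [h1, h2]

theorem gameMax_eq_some {V : IntMatrix} {D w : ℤ} {j l : ℕ} : V.gameMax D j l = some w ↔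
    (l = V.n ∧ w = -1) ∨ (l ≠ V.n ∧ j < V.p * V.n ∧ j % V.n ≠ l ∧
      ∃ z, V.ent l (j / V.n) = some z ∧ w = D * z) := by
  rw [gameMax]
  split_ifs with h1 h2
  · simp [h1, eq_comm]
  · simp [h1, h2, eq_comm]
  · simp only [h1, false_and, false_or, false_iff]
    tauto

/-- The game of the tropical linear system `NearHyperplane V (P / D)`. -/
def toGame (V : IntMatrix) (hV : V.RowsFinite) (D P : ℤ) (s : Fin (V.n + 1)) : Game where
  m := V.n + 1
  n := V.p * V.n + 1
  minArc i j := V.gameMin D P i j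
  maxArc j l := V.gameMax D j l
  exists_minArc i := by
    by_cases hi : (i : ℕ) < V.n
    · obtain ⟨k, hk, h⟩ := hV i hi
      refine ⟨⟨k * V.n + i, (V.index_lt hi hk).trans (Nat.lt_succ_self _)⟩, ?_⟩
      rw [gameMin_index V D P hi hk]
      simpa [Option.isSome_iff_ne_none] using h
    · refine ⟨Fin.last _, ?_⟩
      simp [gameMin, show (i : ℕ) = V.n by omega]
  exists_maxArc j := ⟨Fin.last _, by simp [gameMax]⟩
  init := s

variable {V : IntMatrix} {hV : V.RowsFinite} {D P : ℤ} {s : Fin (V.n + 1)}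

/-- A node of Min where the mean payoff is at least `c` yields, through a subsolution of the
game, a tropical hyperplane at distance at most `(P - c) / D`. -/
theorem nearHyperplane_of_le_payoff (hD : 0 < D) {c : ℝ} (hc : 0 ≤ c) {i : Fin (V.n + 1)}
    (hi : c ≤ (V.toGame hV D P s).payoff i) : NearHyperplane V.vec ((P - c) / D) := by
  have hD' : (0 : ℝ) < D := by exact_mod_cast hD
  obtain ⟨x, hx, h⟩ : ∃ x : Fin (V.n + 1) → WithBot ℝ,
      (∀ i, x i ≠ ⊥ ↔ c ≤ (V.toGame hV D P s).payoff i) ∧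
      ∀ (i : Fin (V.n + 1)) (j : Fin (V.p * V.n + 1)) w, V.gameMin D P i j = some w →
        ∃ (l : Fin (V.n + 1)) (w' : ℤ), V.gameMax D j l = some w' ∧
          (c : WithBot ℝ) + x i ≤ ((w + w' : ℝ) : WithBot ℝ) + x l :=
    (V.toGame hV D P s).exists_subsolution c
  have hsink : x (Fin.last _) = ⊥ := by
    have h0 : V.gameMin D P (Fin.last V.n : Fin (V.n + 1)) (Fin.last (V.p * V.n) : Fin _) = some 0 :=
      gameMin_eq_some.2 (Or.inr ⟨by simp, by simp, rfl⟩)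
    obtain ⟨l, w, hw, hle⟩ := h (Fin.last V.n) (Fin.last (V.p * V.n)) 0 h0
    rcases gameMax_eq_some.1 hw with ⟨h1, rfl⟩ | ⟨-, h2, -⟩
    · have h2 : l = (Fin.last V.n : Fin (V.n + 1)) := Fin.ext h1
      subst h2
      cases hx : x (Fin.last V.n)
      · rfl
      · rw [hx] at hle
        norm_cast at hle
        push_cast at hle
        linarith
    · simp at h2
  have hin : i ≠ Fin.last V.n := fun h' => (hx i).2 hi (h' ▸ hsink)
  refine ⟨fun i => (x i.castSucc).map (· / (D : ℝ)), ?_, fun k i hi => ?_⟩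
  · intro h0
    have h1 := congrFun h0 (i.castPred hin)
    simp only [Fin.castSucc_castPred, Pi.bot_apply, WithBot.map_eq_bot_iff] at h1
    exact (hx i).2 hi h1
  · obtain ⟨z, hz, hvz⟩ := exists_vec_eq_coe (fun h' => hi (by rw [h', WithBot.add_bot]))
    have hlt := V.index_lt i.2 k.2
    have h0 : V.gameMin D P i (k * V.n + i) = some (P - D * z) := by
      rw [gameMin_index V D P i.2 k.2, hz]
      rfl
    obtain ⟨l, w, hw, hle⟩ := h i.castSucc ⟨k * V.n + i, Nat.lt_succ_of_lt hlt⟩ _ h0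
    obtain ⟨y, hy⟩ : ∃ y : ℝ, x i.castSucc = y := by
      cases hy : x i.castSucc
      · simp [hy] at hi
      · exact ⟨_, rfl⟩
    rw [hy] at hle
    have hlb : x l ≠ ⊥ := fun h' => by
      rw [h'] at hle
      simp [← WithBot.coe_add] at hle
    obtain ⟨y', hy'⟩ := WithBot.ne_bot_iff_exists.1 hlb
    have hln : l ≠ (Fin.last V.n : Fin (V.n + 1)) := fun h' => hlb (h' ▸ hsink)
    have h1 : (k * V.n + i : ℕ) % V.n = i := by rw [mul_comm, Nat.mul_add_mod, Nat.mod_eq_of_lt i.2]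
    have h2 : (k * V.n + i : ℕ) / V.n = k := by
      rw [mul_comm, Nat.mul_add_div V.n_pos, Nat.div_eq_of_lt i.2, add_zero]
    rcases gameMax_eq_some.1 hw with ⟨h3, -⟩ | ⟨-, -, h3, z', hz', rfl⟩
    · exact absurd (Fin.ext h3) hln
    · simp only [h1, h2] at h3 hz'
      obtain ⟨l', rfl⟩ : ∃ l' : Fin V.n, l = l'.castSucc := ⟨l.castPred hln, by simp⟩
      refine ⟨l', fun h' => h3 (by rw [h']; rfl), ?_⟩
      simp only
      rw [hvz, vec_eq_coe hz', hy, ← hy']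
      rw [← hy'] at hle
      simp only [WithBot.map_coe]
      norm_cast at hle ⊢
      push_cast at hle
      have e : (P - c) / (D : ℝ) + (y' / D + z') = (P - c + y' + D * z') / D := by
        field_simp
        ring
      rw [e, le_div_iff₀ hD', add_mul, div_mul_cancel₀ _ hD'.ne']
      linarith

/-- The parameter of a tropical hyperplane at distance at most `c` is a subsolution of the game, hence
there is a node of Min where the mean payoff is at least `P - D c`. -/
theorem exists_le_payoff_of_nearHyperplane (hD : 0 < D) {c : ℝ} (h : NearHyperplane V.vec c) :
    ∃ i : Fin V.n, P - D * c ≤ (V.toGame hV D P s).payoff i.castSucc := by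
  have hD' : (0 : ℝ) < D := by exact_mod_cast hD
  obtain ⟨a, ha, h⟩ := h
  obtain ⟨i₀, hi₀⟩ : ∃ i, a i ≠ ⊥ := Function.ne_iff.1 ha
  refine ⟨i₀, ?_⟩
  set x : Fin (V.n + 1) → WithBot ℝ :=
    fun l => if hl : (l : ℕ) < V.n then (a ⟨l, hl⟩).map ((D : ℝ) * ·) else ⊥
  have hxl : ∀ l : Fin V.n, x l.castSucc = (a l).map ((D : ℝ) * ·) := fun l => dif_pos l.2
  have hxn : x (Fin.last V.n) = ⊥ := by simp [x]
  suffices H : ∀ (i : Fin (V.n + 1)) (j : Fin (V.p * V.n + 1)) w, V.gameMin D P i j = some w →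
      ∃ (l : Fin (V.n + 1)) (w' : ℤ), V.gameMax D j l = some w' ∧
        ((P - D * c : ℝ) : WithBot ℝ) + x i ≤ ((w + w' : ℝ) : WithBot ℝ) + x l by
    refine Game.le_payoff_of_subsolution (V.toGame hV D P s) (x := x) H (i := i₀.castSucc) ?_
    rw [hxl]
    simpa [WithBot.map_eq_bot_iff] using hi₀
  intro i j w hw
  have hsink : V.gameMax D j (Fin.last V.n : Fin (V.n + 1)) = some (-1) :=
    gameMax_eq_some.2 (Or.inl ⟨by simp, rfl⟩)
  by_cases hxi : x i = ⊥
  · exact ⟨Fin.last V.n, _, hsink, by simp [hxi]⟩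
  obtain ⟨i, rfl⟩ : ∃ i' : Fin V.n, i = i'.castSucc :=
    ⟨i.castPred fun h' => hxi (h' ▸ hxn), by simp⟩
  rw [hxl] at hxi ⊢
  obtain ⟨y, hy⟩ : ∃ y : ℝ, a i = y := by
    cases h' : a i
    · simp [h'] at hxi
    · exact ⟨_, rfl⟩
  rcases gameMin_eq_some.1 hw with ⟨hj, hji, z, hz, rfl⟩ | ⟨-, h', -⟩
  swap
  · exact absurd h' i.2.ne
  have hk : (j : ℕ) / V.n < V.p := (Nat.div_lt_iff_lt_mul V.n_pos).2 hj
  have hvz := vec_eq_coe (V := V) (k := ⟨_, hk⟩) (i := i) hz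
  obtain ⟨l, hli, hle⟩ := h ⟨_, hk⟩ i (by rw [hvz, hy]; exact WithBot.coe_ne_bot)
  rw [hvz, hy] at hle
  have hlv : V.vec ⟨_, hk⟩ l ≠ ⊥ := fun h' => by
    rw [h'] at hle
    simp [← WithBot.coe_add] at hle
  obtain ⟨z', hz', hvz'⟩ := exists_vec_eq_coe hlv
  rw [hvz'] at hle
  have hmax : V.gameMax D j l.castSucc = some (D * z') :=
    gameMax_eq_some.2 (Or.inr ⟨l.2.ne, hj, fun h' => hli (Fin.ext (h'.symm.trans hji)), z', hz', rfl⟩)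
  refine ⟨l.castSucc, _, hmax, ?_⟩
  rw [hxl, hy]
  cases hl : a l
  · rw [hl] at hle
    simp [← WithBot.coe_add] at hle
  · rw [hl] at hle
    simp only [WithBot.map_coe]
    norm_cast at hle ⊢
    push_cast
    nlinarith

/-- If the mean payoffs are at most `c`, a supersolution of the game yields a Hilbert ball of
radius `(P - c) / D` in the cone. -/
theorem hasBall_of_payoff_le (hD : 0 < D) {c : ℝ}
    (h : ∀ i : Fin V.n, (V.toGame hV D P s).payoff i.castSucc ≤ c) :
    HasBall V.vec ((P - c) / D) := by
  have hD' : (0 : ℝ) < D := by exact_mod_cast hD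
  obtain ⟨b, hb⟩ : ∃ b : Fin (V.n + 1) → ℝ, ∀ i : Fin (V.n + 1), ∃ (j : Fin (V.p * V.n + 1)) (w : ℤ),
      V.gameMin D P i j = some w ∧ ∀ (l : Fin (V.n + 1)) (w' : ℤ), V.gameMax D j l = some w' →
        w + w' + b l ≤ b i + (V.toGame hV D P s).payoff i :=
    (V.toGame hV D P s).exists_supersolution
  refine ⟨fun i => b i.castSucc / D, fun i => ?_⟩
  obtain ⟨j, w, hw, hjl⟩ := hb i.castSucc
  rcases gameMin_eq_some.1 hw with ⟨hj, hji, z, hz, rfl⟩ | ⟨-, h', -⟩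
  swap
  · exact absurd h' i.2.ne
  have hk : (j : ℕ) / V.n < V.p := (Nat.div_lt_iff_lt_mul V.n_pos).2 hj
  have hvz := vec_eq_coe (V := V) (k := ⟨_, hk⟩) (i := i) hz
  refine ⟨⟨_, hk⟩, by rw [hvz]; exact WithBot.coe_ne_bot, fun l hli => ?_⟩
  by_cases hl : V.vec ⟨_, hk⟩ l = ⊥
  · simp [hl]
  obtain ⟨z', hz', hvz'⟩ := exists_vec_eq_coe hl
  have hmax : V.gameMax D j l.castSucc = some (D * z') :=
    gameMax_eq_some.2 (Or.inr ⟨l.2.ne, hj, fun h' => hli (Fin.ext (h'.symm.trans hji)), z', hz', rfl⟩)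
  have h1 := hjl l.castSucc _ hmax
  rw [hvz, hvz']
  norm_cast
  push_cast at h1
  have e : (P - c) / (D : ℝ) + (b l.castSucc / D + z') = (P - c + b l.castSucc + D * z') / D := by
    field_simp
    ring
  rw [e, div_le_iff₀ hD', add_mul, div_mul_cancel₀ _ hD'.ne']
  have h2 : (V.toGame hV D P s).payoff i.castSucc ≤ c := h i
  linarith

end IntMatrix
end TropReg

namespace TropReg

/-! ### The common value of the two problems -/

section

variable {K : Type*} {n : ℕ} {v : K → Fin n → WithBot ℝ}

theorem NearHyperplane.mono {c c' : ℝ} (h : NearHyperplane v c) (hc : c ≤ c') :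
    NearHyperplane v c' := by
  obtain ⟨a, ha, h⟩ := h
  refine ⟨a, ha, fun k i hi => ?_⟩
  obtain ⟨j, hj, hle⟩ := h k i hi
  exact ⟨j, hj, hle.trans (by gcongr; exact_mod_cast hc)⟩

theorem HasBall.mono {r r' : ℝ} (h : HasBall v r) (hr : r' ≤ r) : HasBall v r' := by
  obtain ⟨b, h⟩ := h
  refine ⟨b, fun i => ?_⟩
  obtain ⟨k, hk, hle⟩ := h i
  exact ⟨k, hk, fun l hl => le_trans (by gcongr; exact_mod_cast hr) (hle l hl)⟩

theorem NearHyperplane.nonneg_and_two_le {c : ℝ} (h : NearHyperplane v c)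
    (hv : ∀ i, ∃ k, v k i ≠ ⊥) : 0 ≤ c ∧ 2 ≤ n := by
  obtain ⟨a, ha, h⟩ := h
  obtain ⟨i₀, hi₀⟩ : ∃ i, a i ≠ ⊥ := Function.ne_iff.1 ha
  have : Nonempty (Fin n) := ⟨i₀⟩
  obtain ⟨k, hk⟩ := hv i₀
  obtain ⟨i, hi⟩ := Finite.exists_max fun i => a i + v k i
  have hib : a i + v k i ≠ ⊥ := fun h' => by
    have := hi i₀
    rw [h', le_bot_iff, WithBot.add_eq_bot] at this
    tauto
  obtain ⟨j, hji, hj⟩ := h k i hib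
  refine ⟨?_, ?_⟩
  · have h1 : a i + v k i ≤ c + (a i + v k i) := hj.trans (by have := hi j; gcongr)
    obtain ⟨y, hy⟩ := WithBot.ne_bot_iff_exists.1 hib
    rw [← hy] at h1
    norm_cast at h1
    linarith
  · by_contra hn
    exact hji (Fin.ext (by have := i.2; have := j.2; omega))

/-- If the bound on the entries of the vectors is `W`, then the regression problem has a value at
most `2 W` as soon as this value is finite: the zero vector with the same support is a good
parameter for the hyperplane. -/
theorem NearHyperplane.of_bound {c W : ℝ} (h : NearHyperplane v c)
    (hW : ∀ k i (y : ℝ), v k i = y → |y| ≤ W) : NearHyperplane v (2 * W) := by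
  obtain ⟨a, ha, h⟩ := h
  refine ⟨fun i => (a i).map fun _ => 0, fun h' => ha (funext fun i => ?_), fun k i hi => ?_⟩
  · exact WithBot.map_eq_bot_iff.1 (congrFun h' i)
  · simp only [ne_eq, WithBot.add_eq_bot, WithBot.map_eq_bot_iff, not_or] at hi
    obtain ⟨j, hj, hle⟩ := h k i (by simpa [not_or] using hi)
    refine ⟨j, hj, ?_⟩
    obtain ⟨A, hA⟩ := WithBot.ne_bot_iff_exists.1 hi.1
    obtain ⟨y, hy⟩ := WithBot.ne_bot_iff_exists.1 hi.2
    rw [← hA, ← hy] at hle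
    cases hB : a j
    · simp [hB, ← WithBot.coe_add] at hle
    cases hz : v k j with
    | bot => simp [hz, ← WithBot.coe_add] at hle
    | coe z =>
      simp only [← hA, ← hy, hB, WithBot.map_coe]
      norm_cast
      have h1 := abs_le.1 (hW k i y hy.symm)
      have h2 := abs_le.1 (hW k j z hz)
      linarith

theorem regressionValue_eq_of_nearHyperplane_of_hasBall [Finite K] [Nonempty K] {c : ℝ}
    (h : NearHyperplane v c) (h' : HasBall v c) :
    regressionValue (Set.range v) = c ∧ innerRadius (Set.range v) = c := by
  have hv : ∀ i, ∃ k, v k i ≠ ⊥ := fun i => by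
    obtain ⟨b, hb⟩ := h'
    obtain ⟨k, hk, -⟩ := hb i
    exact ⟨k, hk⟩
  obtain ⟨hc, hn⟩ := h.nonneg_and_two_le hv
  have : NeZero n := ⟨by omega⟩
  refine ⟨le_antisymm (regressionValue_le hn hc h) (not_lt.1 fun hlt => ?_), ?_⟩
  · obtain ⟨d, hd, hdc⟩ := EReal.lt_iff_exists_real_btwn.1 hlt
    have := h'.le_of_nearHyperplane (nearHyperplane_of_regressionValue_lt hd)
    exact absurd hdc (not_lt.2 (by exact_mod_cast this))
  · rw [innerRadius_eq]
    refine le_antisymm (sSup_le ?_) (le_sSup ⟨c, hc, h', rfl⟩)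
    rintro _ ⟨r, -, hr, rfl⟩
    exact_mod_cast hr.le_of_nearHyperplane h

theorem regressionValue_eq_top (h : ∀ c, ¬ NearHyperplane v c) :
    regressionValue (Set.range v) = ⊤ := by
  by_contra hne
  obtain ⟨d, hd, -⟩ := EReal.lt_iff_exists_real_btwn.1 (lt_top_iff_ne_top.2 hne)
  exact h d (nearHyperplane_of_regressionValue_lt hd)

theorem innerRadius_eq_top [NeZero n] (h : ∀ r, HasBall v r) :
    innerRadius (Set.range v) = ⊤ := by
  rw [innerRadius_eq, EReal.eq_top_iff_forall_lt]
  intro y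
  refine lt_of_lt_of_le ?_ (le_sSup ⟨max 0 (y + 1), le_max_left _ _, h _, rfl⟩)
  exact_mod_cast lt_max_of_lt_right (by linarith : y < y + 1)

theorem innerRadius_eq_bot [NeZero n] {i : Fin n} (h : ∀ k, v k i = ⊥) :
    innerRadius (Set.range v) = ⊥ := by
  rw [innerRadius_eq, sSup_eq_bot]
  rintro _ ⟨r, -, ⟨b, hb⟩, rfl⟩
  obtain ⟨k, hk, -⟩ := hb i
  exact absurd (h k) hk

theorem regressionValue_eq_zero [Finite K] [Nonempty K] (hn : 2 ≤ n) {i : Fin n}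
    (h : ∀ k, v k i = ⊥) : regressionValue (Set.range v) = 0 := by
  refine le_antisymm ?_ (regressionValue_nonneg v)
  refine (regressionValue_le hn le_rfl (c := 0) ?_).trans (by simp)
  refine ⟨fun l => if l = i then 0 else ⊥, fun h' => ?_, fun k l hl => absurd ?_ hl⟩
  · have := congrFun h' i
    simp at this
  · by_cases hli : l = i
    · rw [hli, h, WithBot.add_bot]
    · simp [hli]

end

namespace IntMatrix

variable {V : IntMatrix}

theorem columns_eq_range (V : IntMatrix) : V.columns = Set.range V.vec := rfl

instance (V : IntMatrix) : NeZero V.n := ⟨V.n_pos.ne'⟩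
instance (V : IntMatrix) : NeZero V.p := ⟨V.p_pos.ne'⟩

theorem RowsFinite.exists_vec_ne_bot (hV : V.RowsFinite) (i : Fin V.n) : ∃ k, V.vec k i ≠ ⊥ := by
  obtain ⟨k, hk, h⟩ := hV i i.2
  exact ⟨⟨k, hk⟩, fun h' => h (vec_eq_bot_iff.1 h')⟩

theorem exists_row_eq_bot (hV : ¬ V.RowsFinite) : ∃ i, ∀ k, V.vec k i = ⊥ := by
  simp only [RowsFinite, not_forall, not_exists, not_and, not_not] at hV
  obtain ⟨i, hi, h⟩ := hV
  exact ⟨⟨i, hi⟩, fun k => vec_eq_bot_iff.2 (h k k.2)⟩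

theorem nearHyperplane_iff_exists_payoff (hV : V.RowsFinite) {D : ℤ} (hD : 0 < D) (P : ℤ)
    (s : Fin (V.n + 1)) : NearHyperplane V.vec (P / D) ↔
      ∃ i : Fin V.n, 0 ≤ (V.toGame hV D P s).payoff i.castSucc := by
  have hD' : (D : ℝ) ≠ 0 := by exact_mod_cast hD.ne'
  constructor
  · intro h
    obtain ⟨i, hi⟩ := exists_le_payoff_of_nearHyperplane (hV := hV) (P := P) (s := s) hD h
    exact ⟨i, by rwa [mul_div_cancel₀ _ hD', sub_self] at hi⟩
  · rintro ⟨i, hi⟩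
    simpa using nearHyperplane_of_le_payoff hD le_rfl hi

/-- Strong duality: if the regression problem has a finite value, there is a number `z / q` which is
both a distance to a hyperplane and the radius of a ball; it is a mean of weights of the game. -/
theorem exists_nearHyperplane_and_hasBall (hV : V.RowsFinite)
    (h : ∃ c, NearHyperplane V.vec c) : ∃ (q : ℕ) (z : ℤ), 0 < q ∧ q ≤ V.n + 1 ∧
      NearHyperplane V.vec (z / q) ∧ HasBall V.vec (z / q) := by
  obtain ⟨c, hc⟩ := h
  set P : ℤ := ⌈c⌉
  have hP : NearHyperplane V.vec ((P : ℝ) / ((1 : ℤ) : ℝ)) := by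
    simpa using hc.mono (Int.le_ceil c)
  obtain ⟨i₀, hi₀⟩ := (nearHyperplane_iff_exists_payoff hV one_pos P 0).1 hP
  obtain ⟨i, hi⟩ := Finite.exists_max fun i : Fin V.n => (V.toGame hV 1 P 0).payoff i.castSucc
  obtain ⟨q, z, hq, hqn, hqz⟩ := (V.toGame hV 1 P 0).exists_denom_payoff i.castSucc
  have e : (((q * P - z : ℤ) : ℝ)) / q = (P - (V.toGame hV 1 P 0).payoff i.castSucc) / (1 : ℤ) := by
    have : (q : ℝ) ≠ 0 := by exact_mod_cast hq.ne'
    push_cast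
    rw [← hqz]
    field_simp
  refine ⟨q, q * P - z, hq, hqn, ?_, ?_⟩
  · rw [e]
    exact nearHyperplane_of_le_payoff one_pos (hi₀.trans (hi i₀)) le_rfl
  · rw [e]
    exact hasBall_of_payoff_le one_pos hi

theorem hasBall_of_not_nearHyperplane (hV : V.RowsFinite)
    (h : ∀ c, ¬ NearHyperplane V.vec c) (r : ℝ) : HasBall V.vec r := by
  have h1 : ∀ i : Fin V.n, (V.toGame hV 1 ⌈r⌉ 0).payoff i.castSucc ≤ 0 := fun i => by
    by_contra hi
    exact h _ ((nearHyperplane_iff_exists_payoff hV one_pos ⌈r⌉ 0).2 ⟨i, (not_le.1 hi).le⟩)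
  refine (hasBall_of_payoff_le one_pos h1).mono ?_
  simpa using Int.le_ceil r

end IntMatrix

end TropReg

namespace TropReg

/-! ### The tropical linear system of a game -/

/-- A finite set of reals can be moved by a nonexpansive increasing map that shrinks its large gaps
to the length `W`, while keeping small gaps. -/
theorem exists_gap_compression {W : ℝ} (hW : 0 ≤ W) (F : Finset ℝ) : ∃ φ : ℝ → ℝ,
    ∀ a ∈ F, ∀ b ∈ F, a ≤ b →
      φ b - φ a ≤ b - a ∧ min (b - a) W ≤ φ b - φ a ∧ φ b - φ a ≤ F.card * W := by
  induction F using Finset.induction_on_max with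
  | empty => exact ⟨id, by simp⟩
  | insert t F hF ih =>
    obtain ⟨φ, hφ⟩ := ih
    have htF : t ∉ F := fun h => (hF t h).false
    have hcard : ((insert t F).card : ℝ) = F.card + 1 := by
      rw [Finset.card_insert_of_notMem htF]
      push_cast
      ring
    rcases F.eq_empty_or_nonempty with rfl | hne
    · refine ⟨id, fun a ha b hb _ => ?_⟩
      simp only [insert_empty_eq, Finset.mem_singleton] at ha hb
      subst ha hb
      simp [hW]
    set s := F.max' hne
    have hs : s ∈ F := F.max'_mem hne
    have hst : s < t := hF s hs
    refine ⟨Function.update φ t (φ s + min (t - s) W), fun a ha b hb hab => ?_⟩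
    have hupd : ∀ c ∈ F, Function.update φ t (φ s + min (t - s) W) c = φ c := fun c hc =>
      Function.update_of_ne (hF c hc).ne _ _
    have hmin : min (t - s) W ≤ t - s := min_le_left _ _
    have hmin' : min (t - s) W ≤ W := min_le_right _ _
    have hmin0 : 0 ≤ min (t - s) W := le_min (by linarith) hW
    have hcW : (0 : ℝ) ≤ F.card * W := by positivity
    rw [hcard, add_mul, one_mul]
    rcases Finset.mem_insert.1 ha with rfl | ha'
    · rcases Finset.mem_insert.1 hb with rfl | hb'
      · simp only [sub_self]
        exact ⟨le_rfl, min_le_left _ _, by linarith⟩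
      · exact absurd hab (not_le.2 (hF b hb'))
    · rw [hupd a ha']
      rcases Finset.mem_insert.1 hb with rfl | hb'
      · rw [Function.update_self]
        have has : a ≤ s := F.le_max' a ha'
        obtain ⟨h1, h2, h3⟩ := hφ a ha' s hs has
        refine ⟨by linarith, ?_, by linarith⟩
        rcases le_total (s - a) W with h4 | h4
        · rw [min_eq_left h4] at h2
          rcases le_total (b - s) W with h5 | h5
          · rw [min_eq_left h5]
            exact (min_le_left _ _).trans (by linarith)
          · rw [min_eq_right h5]
            exact (min_le_right _ _).trans (by linarith)
        · rw [min_eq_right h4] at h2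
          exact (min_le_right _ _).trans (by linarith)
      · rw [hupd b hb']
        obtain ⟨h1, h2, h3⟩ := hφ a ha' b hb' hab
        exact ⟨h1, h2, by linarith⟩

namespace Game

/-- The arcs of Player Min, extended by `none` to all pairs of natural numbers, together with an
arc of weight `0` from every node `i < m` to an additional node `n` of Player Max. -/
def minE (G : Game) (i j : ℕ) : Option ℤ :=
  if h : i < G.m ∧ j < G.n then G.minArc ⟨i, h.1⟩ ⟨j, h.2⟩ else if j = G.n then some 0 else none

/-- The arcs of Player Max, extended by `none` to all pairs of natural numbers, together with an arc
of weight `M` from the additional node `n` to the initial node. -/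
def maxE (G : Game) (M : ℤ) (j l : ℕ) : Option ℤ :=
  if h : j < G.n ∧ l < G.m then G.maxArc ⟨j, h.1⟩ ⟨l, h.2⟩
  else if j = G.n ∧ l = G.init then some M else none

/-- The sum of two max-plus integers. -/
def optAdd (a b : Option ℤ) : Option ℤ :=
  if a.isSome ∧ b.isSome then some (a.getD 0 + b.getD 0) else none

theorem optAdd_eq_some {a b : Option ℤ} {z : ℤ} :
    optAdd a b = some z ↔ ∃ w w', a = some w ∧ b = some w' ∧ z = w + w' := by
  cases a <;> cases b <;> simp [optAdd, eq_comm]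

/-- The matrix of the tropical linear system of a game. There are three copies `k m + l`, `k < 3`,
of each variable `l < m`. For each `i` and `j` there is a column saying that the copy `0` of the
variable `i` is at most the maximum of the copies `1` and `2` of the variables that can be reached
from `j`, and there are `2 m` columns saying that the copies are equal. -/
def sysEntry (G : Game) (M : ℤ) (r c : ℕ) : Option ℤ :=
  if c < G.m * (G.n + 1) then
    if r / G.m = 0 then
      if r % G.m = c / (G.n + 1) ∧ (G.minE (c / (G.n + 1)) (c % (G.n + 1))).isSome then some 0
      else none
    else optAdd (G.minE (c / (G.n + 1)) (c % (G.n + 1))) (G.maxE M (c % (G.n + 1)) (r % G.m))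
  else if r % G.m = (c - G.m * (G.n + 1)) % G.m ∧ (r / G.m = (c - G.m * (G.n + 1)) / G.m ∨
      r / G.m = (c - G.m * (G.n + 1)) / G.m + 1) then some 0
  else none

theorem m_pos (G : Game) : 0 < G.m := G.init.pos

/-- The matrix of the tropical linear system of a game. -/
def toMatrix (G : Game) (M : ℤ) : IntMatrix where
  n := 3 * G.m
  p := G.m * (G.n + 1) + 2 * G.m
  n_pos := by have := G.m_pos; omega
  p_pos := by have := G.m_pos; omega
  entry r c := G.sysEntry M r c

theorem toMatrix_ent (G : Game) (M : ℤ) (r : Fin (3 * G.m)) (c : Fin (G.m * (G.n + 1) + 2 * G.m)) :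
    (G.toMatrix M).ent r c = G.sysEntry M r c :=
  (G.toMatrix M).ent_val r c

/-- The copy `k` of the variable `l`. -/
def copy (G : Game) (k : Fin 3) (l : Fin G.m) : Fin (3 * G.m) :=
  ⟨k * G.m + l, by
    have hk : (k : ℕ) + 1 ≤ 3 := k.2
    calc (k : ℕ) * G.m + l < k * G.m + G.m := by have := l.2; omega
      _ = (k + 1) * G.m := by ring
      _ ≤ 3 * G.m := Nat.mul_le_mul_right _ hk⟩

theorem copy_div (G : Game) (k : Fin 3) (l : Fin G.m) : (G.copy k l : ℕ) / G.m = k := by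
  rw [copy]
  simp only
  rw [mul_comm, Nat.mul_add_div G.m_pos, Nat.div_eq_of_lt l.2, add_zero]

theorem copy_mod (G : Game) (k : Fin 3) (l : Fin G.m) : (G.copy k l : ℕ) % G.m = l := by
  rw [copy]
  simp only
  rw [mul_comm, Nat.mul_add_mod, Nat.mod_eq_of_lt l.2]

theorem exists_copy (G : Game) (r : Fin (3 * G.m)) : ∃ k l, r = G.copy k l := by
  refine ⟨⟨r / G.m, (Nat.div_lt_iff_lt_mul G.m_pos).2 r.2⟩, ⟨r % G.m, Nat.mod_lt _ G.m_pos⟩, ?_⟩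
  exact Fin.ext (Nat.div_add_mod' _ _).symm

/-- The index of the column that relates the copies `t` and `t + 1` of the variable `l`. -/
def tie (G : Game) (t : Fin 2) (l : Fin G.m) : Fin (G.m * (G.n + 1) + 2 * G.m) :=
  ⟨G.m * (G.n + 1) + (t * G.m + l), by
    have ht : (t : ℕ) + 1 ≤ 2 := t.2
    have : (t : ℕ) * G.m + l < 2 * G.m :=
      calc (t : ℕ) * G.m + l < t * G.m + G.m := by have := l.2; omega
        _ = (t + 1) * G.m := by ring
        _ ≤ 2 * G.m := Nat.mul_le_mul_right _ ht
    omega⟩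

/-- The index of the column of the nodes `i` and `j`. -/
def arcCol (G : Game) (i : Fin G.m) (j : Fin (G.n + 1)) : Fin (G.m * (G.n + 1) + 2 * G.m) :=
  ⟨i * (G.n + 1) + j, by
    have hi : (i : ℕ) + 1 ≤ G.m := i.2
    calc (i : ℕ) * (G.n + 1) + j < i * (G.n + 1) + (G.n + 1) := by have := j.2; omega
      _ = (i + 1) * (G.n + 1) := by ring
      _ ≤ G.m * (G.n + 1) := Nat.mul_le_mul_right _ hi
      _ ≤ _ := Nat.le_add_right _ _⟩

theorem exists_col (G : Game) (c : Fin (G.m * (G.n + 1) + 2 * G.m)) :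
    (∃ i j, c = G.arcCol i j) ∨ ∃ t l, c = G.tie t l := by
  by_cases h : (c : ℕ) < G.m * (G.n + 1)
  · refine Or.inl ⟨⟨c / (G.n + 1), (Nat.div_lt_iff_lt_mul (Nat.succ_pos _)).2 h⟩,
      ⟨c % (G.n + 1), Nat.mod_lt _ (Nat.succ_pos _)⟩, Fin.ext (Nat.div_add_mod' _ _).symm⟩
  · have h2 : (c : ℕ) - G.m * (G.n + 1) < 2 * G.m := by have := c.2; omega
    refine Or.inr ⟨⟨(c - G.m * (G.n + 1)) / G.m, (Nat.div_lt_iff_lt_mul G.m_pos).2 h2⟩,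
      ⟨(c - G.m * (G.n + 1)) % G.m, Nat.mod_lt _ G.m_pos⟩, Fin.ext ?_⟩
    simp only [tie]
    rw [Nat.div_add_mod']
    omega

theorem sysEntry_tie (G : Game) (M : ℤ) (k : Fin 3) (l : Fin G.m) (t : Fin 2) (l' : Fin G.m) :
    G.sysEntry M (G.copy k l) (G.tie t l') =
      if l = l' ∧ ((k : ℕ) = t ∨ (k : ℕ) = t + 1) then some 0 else none := by
  have h1 : (t * G.m + l' : ℕ) / G.m = t := by
    rw [mul_comm, Nat.mul_add_div G.m_pos, Nat.div_eq_of_lt l'.2, add_zero]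
  have h2 : (t * G.m + l' : ℕ) % G.m = l' := by
    rw [mul_comm, Nat.mul_add_mod, Nat.mod_eq_of_lt l'.2]
  rw [sysEntry, if_neg (by simp [tie]), copy_div, copy_mod]
  simp only [tie, Nat.add_sub_cancel_left, h1, h2, Fin.val_inj]

theorem sysEntry_arcCol (G : Game) (M : ℤ) (k : Fin 3) (l : Fin G.m) (i : Fin G.m)
    (j : Fin (G.n + 1)) : G.sysEntry M (G.copy k l) (G.arcCol i j) =
      if k = 0 then if l = i ∧ (G.minE i j).isSome then some 0 else none
      else optAdd (G.minE i j) (G.maxE M j l) := by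
  have h0 : (i * (G.n + 1) + j : ℕ) < G.m * (G.n + 1) := by
    have hi : (i : ℕ) + 1 ≤ G.m := i.2
    calc (i : ℕ) * (G.n + 1) + j < i * (G.n + 1) + (G.n + 1) := by have := j.2; omega
      _ = (i + 1) * (G.n + 1) := by ring
      _ ≤ G.m * (G.n + 1) := Nat.mul_le_mul_right _ hi
  have h1 : (i * (G.n + 1) + j : ℕ) / (G.n + 1) = i := by
    rw [mul_comm, Nat.mul_add_div (Nat.succ_pos _), Nat.div_eq_of_lt j.2, add_zero]
  have h2 : (i * (G.n + 1) + j : ℕ) % (G.n + 1) = j := by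
    rw [mul_comm, Nat.mul_add_mod, Nat.mod_eq_of_lt j.2]
  rw [sysEntry, copy_div, copy_mod]
  simp only [arcCol, h0, h1, h2, if_true, Fin.val_inj, Fin.val_eq_zero_iff]

end Game

end TropReg

namespace TropReg
namespace Game

variable {G : Game} {M W : ℤ}

theorem minE_val (G : Game) (i : Fin G.m) (j : Fin G.n) : G.minE i j = G.minArc i j :=
  dif_pos ⟨i.2, j.2⟩

theorem maxE_val (G : Game) (M : ℤ) (j : Fin G.n) (l : Fin G.m) : G.maxE M j l = G.maxArc j l :=
  dif_pos ⟨j.2, l.2⟩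

theorem minE_last (G : Game) (i : Fin G.m) : G.minE i G.n = some 0 := by
  rw [minE, dif_neg (by simp), if_pos rfl]

theorem maxE_last (G : Game) (M : ℤ) (l : Fin G.m) :
    G.maxE M G.n l = if l = G.init then some M else none := by
  rw [maxE, dif_neg (by simp)]
  simp [Fin.val_inj]

theorem vec_tie (k : Fin 3) (l : Fin G.m) (t : Fin 2) (l' : Fin G.m) :
    (G.toMatrix M).vec (G.tie t l') (G.copy k l) =
      if l = l' ∧ ((k : ℕ) = t ∨ (k : ℕ) = t + 1) then 0 else ⊥ := by
  have h := (G.toMatrix_ent M (G.copy k l) (G.tie t l')).trans (G.sysEntry_tie M k l t l')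
  split_ifs at h ⊢
  · rw [IntMatrix.vec_eq_coe (V := G.toMatrix M) (k := G.tie t l') (i := G.copy k l) h]
    simp
  · exact IntMatrix.vec_eq_bot_iff.2 h

theorem vec_arcCol_zero (l i : Fin G.m) (j : Fin (G.n + 1)) :
    (G.toMatrix M).vec (G.arcCol i j) (G.copy 0 l) =
      if l = i ∧ (G.minE i j).isSome then 0 else ⊥ := by
  have h := (G.toMatrix_ent M (G.copy 0 l) (G.arcCol i j)).trans (G.sysEntry_arcCol M 0 l i j)
  rw [if_pos rfl] at h
  split_ifs at h ⊢
  · rw [IntMatrix.vec_eq_coe (V := G.toMatrix M) (k := G.arcCol i j) (i := G.copy 0 l) h]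
    simp
  · exact IntMatrix.vec_eq_bot_iff.2 h

theorem vec_arcCol_eq {k : Fin 3} (hk : k ≠ 0) {l i : Fin G.m} {j : Fin (G.n + 1)} {w w' : ℤ}
    (hw : G.minE i j = some w) (hw' : G.maxE M j l = some w') :
    (G.toMatrix M).vec (G.arcCol i j) (G.copy k l) = ((w + w' : ℝ) : WithBot ℝ) := by
  have h := (G.toMatrix_ent M (G.copy k l) (G.arcCol i j)).trans (G.sysEntry_arcCol M k l i j)
  rw [if_neg hk, optAdd_eq_some.2 ⟨w, w', hw, hw', rfl⟩] at h
  rw [IntMatrix.vec_eq_coe (V := G.toMatrix M) (k := G.arcCol i j) (i := G.copy k l) h]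
  push_cast
  rfl

theorem exists_of_vec_arcCol_ne_bot {k : Fin 3} (hk : k ≠ 0) {l i : Fin G.m} {j : Fin (G.n + 1)}
    (h : (G.toMatrix M).vec (G.arcCol i j) (G.copy k l) ≠ ⊥) :
    ∃ w w', G.minE i j = some w ∧ G.maxE M j l = some w' := by
  obtain ⟨z, hz, -⟩ := IntMatrix.exists_vec_eq_coe h
  replace hz := ((G.toMatrix_ent M (G.copy k l) (G.arcCol i j)).trans
    (G.sysEntry_arcCol M k l i j)).symm.trans hz
  rw [if_neg hk] at hz
  obtain ⟨w, w', hw, hw', -⟩ := optAdd_eq_some.1 hz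
  exact ⟨w, w', hw, hw'⟩

theorem copy_inj {k k' : Fin 3} {l l' : Fin G.m} : G.copy k l = G.copy k' l' ↔ k = k' ∧ l = l' := by
  refine ⟨fun h => ⟨Fin.ext ?_, Fin.ext ?_⟩, fun h => by rw [h.1, h.2]⟩
  · rw [← G.copy_div k l, h, copy_div]
  · rw [← G.copy_mod k l, h, copy_mod]

theorem toMatrix_rowsFinite (G : Game) (M : ℤ) : (G.toMatrix M).RowsFinite := by
  suffices H : ∀ r : Fin (3 * G.m), ∃ c, (G.toMatrix M).vec c r ≠ ⊥ by
    intro r hr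
    obtain ⟨c, hc⟩ := H ⟨r, hr⟩
    exact ⟨c, c.2, fun h => hc (IntMatrix.vec_eq_bot_iff.2 h)⟩
  intro r
  obtain ⟨k, l, rfl⟩ := G.exists_copy r
  by_cases hk : (k : ℕ) = 2
  · exact ⟨G.tie 1 l, by rw [vec_tie]; simp [hk]⟩
  · refine ⟨G.tie 0 l, ?_⟩
    rw [vec_tie, if_pos ⟨rfl, by have := k.2; simp; omega⟩]
    simp

/-- A solution of the tropical linear system restricts to a subsolution of the game; it is finite
at the initial node because of the additional node of Player Max. -/
theorem payoff_nonneg_of_nearHyperplane (h : NearHyperplane (G.toMatrix M).vec 0) :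
    0 ≤ G.payoff G.init := by
  obtain ⟨a, ha, h⟩ := h
  change Fin (3 * G.m) → WithBot ℝ at a
  replace h : ∀ (c : Fin (G.m * (G.n + 1) + 2 * G.m)) (r : Fin (3 * G.m)),
      a r + (G.toMatrix M).vec c r ≠ ⊥ → ∃ k l, G.copy k l ≠ r ∧
        a r + (G.toMatrix M).vec c r ≤ a (G.copy k l) + (G.toMatrix M).vec c (G.copy k l) := by
    intro c r hr
    obtain ⟨r', hr', hle⟩ := h c r hr
    obtain ⟨k, l, rfl⟩ := G.exists_copy r'
    exact ⟨k, l, hr', by simpa using hle⟩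
  have tie : ∀ (t : Fin 2) (k k' : Fin 3) (l : Fin G.m), ((k : ℕ) = t ∧ (k' : ℕ) = t + 1) ∨
      ((k' : ℕ) = t ∧ (k : ℕ) = t + 1) → a (G.copy k l) ≤ a (G.copy k' l) := by
    intro t k k' l hk
    by_cases hb : a (G.copy k l) = ⊥
    · rw [hb]; exact bot_le
    have e : (G.toMatrix M).vec (G.tie t l) (G.copy k l) = 0 := by
      rw [vec_tie, if_pos ⟨rfl, by omega⟩]
    obtain ⟨k₁, l₁, hne, hle⟩ := h (G.tie t l) (G.copy k l) (by rw [e]; simpa using hb)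
    rw [e, vec_tie, add_zero] at hle
    split_ifs at hle with h1
    · obtain ⟨rfl, h1⟩ := h1
      have : k₁ ≠ k := fun h' => hne (by rw [h'])
      have : k₁ = k' := Fin.ext (by have := Fin.val_ne_of_ne this; omega)
      subst this
      simpa using hle
    · simp [hb] at hle
  have h01 : ∀ l, a (G.copy 0 l) = a (G.copy 1 l) := fun l =>
    le_antisymm (tie 0 0 1 l (by simp)) (tie 0 1 0 l (by simp))
  have h12 : ∀ l, a (G.copy 1 l) = a (G.copy 2 l) := fun l =>
    le_antisymm (tie 1 1 2 l (by simp)) (tie 1 2 1 l (by simp))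
  have hk0 : ∀ k l, a (G.copy k l) = a (G.copy 0 l) := fun k l => by
    fin_cases k
    · rfl
    · exact (h01 l).symm
    · exact ((h01 l).trans (h12 l)).symm
  have arc : ∀ (i : Fin G.m) (j : Fin (G.n + 1)) w, G.minE i j = some w → a (G.copy 0 i) ≠ ⊥ →
      ∃ (l : Fin G.m) (w' : ℤ), G.maxE M j l = some w' ∧
        a (G.copy 0 i) ≤ ((w + w' : ℝ) : WithBot ℝ) + a (G.copy 0 l) := by
    intro i j w hw hb
    have e : (G.toMatrix M).vec (G.arcCol i j) (G.copy 0 i) = 0 := by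
      rw [vec_arcCol_zero, if_pos ⟨rfl, by simp [hw]⟩]
    obtain ⟨k, l, hne, hle⟩ := h (G.arcCol i j) (G.copy 0 i) (by rw [e]; simpa using hb)
    rw [e, add_zero] at hle
    have hvb : (G.toMatrix M).vec (G.arcCol i j) (G.copy k l) ≠ ⊥ := fun h' => by
      rw [h'] at hle
      simp [hb] at hle
    have hk : k ≠ 0 := fun h' => by
      subst h'
      rw [vec_arcCol_zero] at hvb
      split_ifs at hvb with h1
      · exact hne (by rw [h1.1])
      · exact hvb rfl
    obtain ⟨w₁, w', hw₁, hw'⟩ := exists_of_vec_arcCol_ne_bot hk hvb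
    obtain rfl : w₁ = w := Option.some_injective _ (hw₁.symm.trans hw)
    rw [vec_arcCol_eq hk hw hw', hk0 k, add_comm] at hle
    exact ⟨l, w', hw', hle⟩
  refine G.le_payoff_of_subsolution (c := 0) (x := fun l => a (G.copy 0 l)) (fun i j w hw => ?_) ?_
  · by_cases hb : a (G.copy 0 i) = ⊥
    · obtain ⟨l, hl⟩ := G.exists_maxArc j
      obtain ⟨w', hw'⟩ := Option.isSome_iff_exists.1 hl
      exact ⟨l, w', hw', by simp [hb]⟩
    · obtain ⟨l, w', hw', hle⟩ := arc i j.castSucc w ((G.minE_val i j).trans hw) hb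
      exact ⟨l, w', (G.maxE_val M j l).symm.trans hw', by simpa using hle⟩
  · obtain ⟨r, hr⟩ : ∃ r, a r ≠ ⊥ := Function.ne_iff.1 ha
    obtain ⟨k, i, rfl⟩ := G.exists_copy r
    rw [hk0] at hr
    obtain ⟨l, w', hw', hle⟩ := arc i (Fin.last _) 0 (G.minE_last i) hr
    simp only [Fin.val_last, maxE_last] at hw'
    split_ifs at hw' with hl
    subst hl
    intro h'
    rw [h'] at hle
    simp [hr] at hle

/-- A subsolution of the game that is finite at the initial node yields a solution of the tropical
linear system, after compression of its gaps. -/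
theorem nearHyperplane_of_payoff_nonneg (hW0 : 0 ≤ W)
    (hW : ∀ i j l w w', G.minArc i j = some w → G.maxArc j l = some w' → |w + w'| ≤ W)
    (hM : G.m * W ≤ M) (h : 0 ≤ G.payoff G.init) : NearHyperplane (G.toMatrix M).vec 0 := by
  obtain ⟨x, hx, hsub⟩ := G.exists_subsolution 0
  have hW0' : (0 : ℝ) ≤ W := by exact_mod_cast hW0
  set F : Finset ℝ := Finset.univ.image fun l => (x l).unbotD 0
  have hF : ∀ l (y : ℝ), x l = y → y ∈ F := fun l y hy =>
    Finset.mem_image.2 ⟨l, Finset.mem_univ _, by simp [hy]⟩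
  have hFc : (F.card : ℝ) ≤ G.m := by
    exact_mod_cast Finset.card_image_le.trans (by simp)
  obtain ⟨φ, hφ⟩ := exists_gap_compression hW0' F
  have sub : ∀ (i : Fin G.m) (j : Fin (G.n + 1)) w (y : ℝ), G.minE i j = some w → x i = y →
      ∃ (l : Fin G.m) (w' : ℤ) (z : ℝ), G.maxE M j l = some w' ∧ x l = z ∧ φ y ≤ w + w' + φ z := by
    intro i j w y hw hy
    by_cases hj : j = Fin.last _
    · subst hj
      obtain rfl : w = 0 := Option.some_injective _ (hw.symm.trans (G.minE_last i))
      obtain ⟨z, hz⟩ := WithBot.ne_bot_iff_exists.1 ((hx G.init).2 h)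
      refine ⟨G.init, M, z, by simp [maxE_last], hz.symm, ?_⟩
      have hM' : (G.m : ℝ) * W ≤ M := by exact_mod_cast hM
      have hFW : (F.card : ℝ) * W ≤ G.m * W := by gcongr
      rcases le_total z y with hzy | hzy
      · have := (hφ z (hF _ _ hz.symm) y (hF _ _ hy) hzy).2.2
        push_cast
        linarith
      · have h1 := (hφ y (hF _ _ hy) z (hF _ _ hz.symm) hzy).2.1
        have h2 : (0 : ℝ) ≤ min (z - y) W := le_min (by linarith) hW0'
        have h3 : (0 : ℝ) ≤ F.card * W := by positivity
        push_cast
        linarith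
    · obtain ⟨j, rfl⟩ : ∃ j' : Fin G.n, j = j'.castSucc := ⟨j.castPred hj, by simp⟩
      replace hw : G.minArc i j = some w := (G.minE_val i j).symm.trans hw
      obtain ⟨l, w', hw', hle⟩ := hsub i j w hw
      rw [hy] at hle
      obtain ⟨z, hz⟩ : ∃ z : ℝ, x l = z := by
        cases hz : x l
        · simp [hz, -WithBot.coe_add] at hle
        · exact ⟨_, rfl⟩
      refine ⟨l, w', z, (G.maxE_val M j l).trans hw', hz, ?_⟩
      rw [hz] at hle
      norm_cast at hle
      push_cast at hle
      have hWw := abs_le.1 (hW i j l w w' hw hw')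
      have hWw' : -(W : ℝ) ≤ w + w' := by exact_mod_cast hWw.1
      rcases le_total z y with hzy | hzy
      · have := (hφ z (hF _ _ hz) y (hF _ _ hy) hzy).1
        linarith
      · have h1 := (hφ y (hF _ _ hy) z (hF _ _ hz) hzy).2.1
        rcases min_le_iff.1 h1 with h2 | h2 <;> linarith
  set a : Fin (3 * G.m) → WithBot ℝ := fun r => (x ⟨r % G.m, Nat.mod_lt _ G.m_pos⟩).map φ
  have hak : ∀ k l, a (G.copy k l) = (x l).map φ := fun k l => by
    simp only [a, copy_mod]
  refine ⟨a, fun h' => ?_, ?_⟩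
  · have h1 : a (G.copy 0 G.init) = ⊥ := congrFun h' _
    rw [hak, WithBot.map_eq_bot_iff] at h1
    exact (hx _).2 h h1
  suffices H : ∀ (c : Fin (G.m * (G.n + 1) + 2 * G.m)) (k : Fin 3) (l : Fin G.m),
      a (G.copy k l) + (G.toMatrix M).vec c (G.copy k l) ≠ ⊥ → ∃ k' l', ¬ (k' = k ∧ l' = l) ∧
        a (G.copy k l) + (G.toMatrix M).vec c (G.copy k l) ≤
          a (G.copy k' l') + (G.toMatrix M).vec c (G.copy k' l') by
    intro c r hr
    obtain ⟨k, l, rfl⟩ := G.exists_copy r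
    obtain ⟨k', l', hne, hle⟩ := H c k l hr
    exact ⟨G.copy k' l', fun h' => hne (copy_inj.1 h'), by simpa using hle⟩
  intro c k l hne
  rcases G.exists_col c with ⟨i, j, rfl⟩ | ⟨t, l', rfl⟩
  · by_cases hk : k = 0
    · subst hk
      rw [vec_arcCol_zero] at hne ⊢
      split_ifs at hne ⊢ with h1
      swap
      · simp at hne
      obtain ⟨rfl, h1⟩ := h1
      obtain ⟨w, hw⟩ := Option.isSome_iff_exists.1 h1
      obtain ⟨y, hy⟩ : ∃ y : ℝ, x l = y := by
        cases hy : x l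
        · simp [hak, hy] at hne
        · exact ⟨_, rfl⟩
      obtain ⟨l', w', z, hw', hz, hle⟩ := sub l j w y hw hy
      refine ⟨1, l', by simp, ?_⟩
      rw [vec_arcCol_eq one_ne_zero hw hw', hak, hak, hy, hz]
      simp only [WithBot.map_coe, add_zero]
      norm_cast
      push_cast
      linarith
    · -- the copies `1` and `2` of the variable `l` have the same value and the same coefficient
      obtain ⟨w, w', hw, hw'⟩ := exists_of_vec_arcCol_ne_bot hk
        (fun h' => hne (by rw [h', WithBot.add_bot]))
      obtain ⟨k', hk', hkk⟩ : ∃ k' : Fin 3, k' ≠ 0 ∧ k' ≠ k := by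
        fin_cases k
        · exact absurd rfl hk
        · exact ⟨2, by decide, by decide⟩
        · exact ⟨1, by decide, by decide⟩
      refine ⟨k', l, fun h' => hkk h'.1, ?_⟩
      rw [vec_arcCol_eq hk hw hw', vec_arcCol_eq hk' hw hw', hak, hak]
  · rw [vec_tie] at hne ⊢
    split_ifs at hne ⊢ with h1
    swap
    · simp at hne
    obtain ⟨rfl, h1⟩ := h1
    obtain ⟨k', hkk, hk'⟩ : ∃ k' : Fin 3, k' ≠ k ∧ ((k' : ℕ) = t ∨ (k' : ℕ) = t + 1) := by
      have := t.2
      rcases h1 with h1 | h1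
      · exact ⟨⟨t + 1, by omega⟩, fun h' => by have := congrArg Fin.val h'; simp at this; omega,
          Or.inr rfl⟩
      · exact ⟨⟨t, by omega⟩, fun h' => by have := congrArg Fin.val h'; simp at this; omega,
          Or.inl rfl⟩
    refine ⟨k', l, fun h' => hkk h'.1, ?_⟩
    rw [vec_tie, if_pos ⟨rfl, hk'⟩, hak, hak]

end Game
end TropReg

namespace TropReg

/-! ### Functions computable in polynomial time -/

/-- Types whose elements are encoded as data. -/
class Enc (α : Type) where
  /-- The encoding. -/
  enc : α → Data

open Enc (enc)

instance : Enc Data := ⟨id⟩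
instance : Enc ℤ := ⟨.int⟩
instance : Enc ℕ := ⟨fun n => .int n⟩
instance : Enc (Option ℤ) := ⟨.ofOption⟩
instance {α β : Type} [Enc α] [Enc β] : Enc (α × β) := ⟨fun x => .pair (enc x.1) (enc x.2)⟩
instance {α : Type} [Enc α] : Enc (List α) := ⟨fun l => .ofList (l.map enc)⟩
instance : Enc Game := ⟨Game.enc⟩
instance : Enc IntMatrix := ⟨IntMatrix.enc⟩

/-- The bit size of the encoding of `x`. -/
def sz {α : Type} [Enc α] (x : α) : ℕ := (enc x).size

section Polynomial

variable {α β γ : Type} [Enc α] [Enc β] [Enc γ] {D D' : α → Prop}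

theorem eval_mono (B : Polynomial ℕ) {a b : ℕ} (h : a ≤ b) : B.eval a ≤ B.eval b := by
  rw [Polynomial.eval_eq_sum_range, Polynomial.eval_eq_sum_range]
  gcongr

/-- On the domain `D`, the function `f` is bounded by a polynomial in the size of the argument. -/
def PolyBounded (D : α → Prop) (f : α → ℕ) : Prop :=
  ∃ B : Polynomial ℕ, ∀ x, D x → f x ≤ B.eval (sz x)

namespace PolyBounded

theorem of_le {f g : α → ℕ} (hg : PolyBounded D g) (h : ∀ x, D x → f x ≤ g x) :
    PolyBounded D f :=
  let ⟨B, hB⟩ := hg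
  ⟨B, fun x hx => (h x hx).trans (hB x hx)⟩

theorem mono {f : α → ℕ} (hf : PolyBounded D' f) (h : ∀ x, D x → D' x) : PolyBounded D f :=
  let ⟨B, hB⟩ := hf
  ⟨B, fun x hx => hB x (h x hx)⟩

theorem size : PolyBounded D (fun x => sz x) := ⟨Polynomial.X, fun x _ => by simp⟩

theorem const (k : ℕ) : PolyBounded D (fun _ => k) := ⟨Polynomial.C k, fun x _ => by simp⟩

theorem add {f g : α → ℕ} (hf : PolyBounded D f) (hg : PolyBounded D g) :
    PolyBounded D (fun x => f x + g x) :=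
  let ⟨A, hA⟩ := hf
  let ⟨B, hB⟩ := hg
  ⟨A + B, fun x hx => by rw [Polynomial.eval_add]; exact add_le_add (hA x hx) (hB x hx)⟩

theorem mul {f g : α → ℕ} (hf : PolyBounded D f) (hg : PolyBounded D g) :
    PolyBounded D (fun x => f x * g x) :=
  let ⟨A, hA⟩ := hf
  let ⟨B, hB⟩ := hg
  ⟨A * B, fun x hx => by rw [Polynomial.eval_mul]; exact mul_le_mul' (hA x hx) (hB x hx)⟩

theorem eval (B : Polynomial ℕ) {f : α → ℕ} (hf : PolyBounded D f) :
    PolyBounded D (fun x => B.eval (f x)) :=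
  let ⟨A, hA⟩ := hf
  ⟨B.comp A, fun x hx => by rw [Polynomial.eval_comp]; exact eval_mono B (hA x hx)⟩

theorem comp {E : β → Prop} {g : β → ℕ} {f : α → β} (hg : PolyBounded E g)
    (hf : PolyBounded D (fun x => sz (f x))) (h : ∀ x, D x → E (f x)) :
    PolyBounded D (fun x => g (f x)) :=
  let ⟨B, hB⟩ := hg
  (hf.eval B).of_le fun x hx => hB (f x) (h x hx)

theorem comp_fst {E : α × β → Prop} {f : α → ℕ} (hf : PolyBounded D f) (h : ∀ p, E p → D p.1) :
    PolyBounded E (fun p => f p.1) :=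
  hf.comp (size.of_le fun p _ => by simp only [sz, enc, Data.size]; omega) h

theorem ite {p : α → Prop} [DecidablePred p] {f g : α → ℕ} (hf : PolyBounded (fun x => D x ∧ p x) f)
    (hg : PolyBounded (fun x => D x ∧ ¬ p x) g) :
    PolyBounded D (fun x => if p x then f x else g x) :=
  let ⟨A, hA⟩ := hf
  let ⟨B, hB⟩ := hg
  ⟨A + B, fun x hx => by
    rw [Polynomial.eval_add]
    beta_reduce
    split_ifs with h
    · exact (hA x ⟨hx, h⟩).trans (Nat.le_add_right _ _)
    · exact (hB x ⟨hx, h⟩).trans (Nat.le_add_left _ _)⟩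

end PolyBounded

/-- With any of the oracles in `𝒪`, one program computes the function `f` on the domain `D`, in a
time bounded by a polynomial in the size of the argument; the size of the result is bounded in the
same way. -/
def PolyTime (𝒪 : (Data → Data) → Prop) (D : α → Prop) (f : α → β) : Prop :=
  ∃ (c : Prog) (T : α → ℕ), PolyBounded D T ∧ ∀ x, D x → sz (f x) ≤ T x ∧
    ∀ O, 𝒪 O → ∃ t, Eval O c (enc x) (enc (f x)) t ∧ t ≤ T x

/-- On the domain `D`, the predicate `p` is decided in polynomial time by the sign of an integer. -/
def PolyDec (𝒪 : (Data → Data) → Prop) (D : α → Prop) (p : α → Prop) : Prop :=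
  ∃ c : α → ℤ, PolyTime 𝒪 D c ∧ ∀ x, D x → (0 < c x ↔ p x)

variable {𝒪 : (Data → Data) → Prop}

/-- An elementary operation increases the size by a constant at most. -/
theorem Op.exists_size_run_le (o : Op) : ∃ k, ∀ x, (o.run x).size ≤ x.size + k := by
  have h1 : ∀ x : Data, 1 ≤ x.size := fun x => by cases x <;> simp [Data.size]; omega
  have hadd : ∀ a b : ℤ, ∀ c : ℤ, c.natAbs ≤ a.natAbs + b.natAbs →
      (Data.int c).size ≤ (Data.pair (.int a) (.int b)).size + 1 := by
    intro a b c hc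
    have : Nat.size c.natAbs ≤ a.natAbs.size + b.natAbs.size + 1 := by
      refine Nat.size_le.2 (hc.trans_lt ?_)
      have h1 := Nat.lt_size_self a.natAbs
      have h2 := Nat.lt_size_self b.natAbs
      have h3 : 2 ^ a.natAbs.size ≤ 2 ^ (a.natAbs.size + b.natAbs.size) :=
        Nat.pow_le_pow_right two_pos (by omega)
      have h4 : 2 ^ b.natAbs.size ≤ 2 ^ (a.natAbs.size + b.natAbs.size) :=
        Nat.pow_le_pow_right two_pos (by omega)
      rw [pow_succ]
      omega
    simp only [Data.size]
    omega
  have h0 : ∀ x : Data, (Data.int 0).size ≤ x.size + 1 := fun x => by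
    simp [Data.size]
  cases o with
  | id => exact ⟨0, fun x => le_rfl⟩
  | const z => exact ⟨(Data.int z).size, fun x => Nat.le_add_left _ _⟩
  | fst =>
    refine ⟨1, fun x => ?_⟩
    cases x with
    | int z => exact h0 _
    | pair x y => simp only [Op.run, Data.size]; omega
  | snd =>
    refine ⟨1, fun x => ?_⟩
    cases x with
    | int z => exact h0 _
    | pair x y => simp only [Op.run, Data.size]; omega
  | isPair =>
    refine ⟨1, fun x => ?_⟩
    cases x with
    | int z => exact h0 _
    | pair x y =>
      have := h1 x
      simp only [Op.run, Data.size, Int.natAbs_one, Nat.size_one]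
      omega
  | add =>
    refine ⟨1, fun x => ?_⟩
    rcases x with z | ⟨a | _, b | _⟩
    · exact h0 _
    · exact hadd a b _ (Int.natAbs_add_le a b)
    all_goals exact h0 _
  | sub =>
    refine ⟨1, fun x => ?_⟩
    rcases x with z | ⟨a | _, b | _⟩
    · exact h0 _
    · exact hadd a b _ (Int.natAbs_sub_le a b)
    all_goals exact h0 _
  | mul =>
    refine ⟨1, fun x => ?_⟩
    rcases x with z | ⟨a | _, b | _⟩
    · exact h0 _
    · have : Nat.size (a * b).natAbs ≤ a.natAbs.size + b.natAbs.size := by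
        refine Nat.size_le.2 ?_
        rw [Int.natAbs_mul, pow_add]
        exact Nat.mul_lt_mul'' (Nat.lt_size_self _) (Nat.lt_size_self _)
      simp only [Op.run, Data.size]
      omega
    all_goals exact h0 _
  | div =>
    refine ⟨1, fun x => ?_⟩
    rcases x with z | ⟨a | _, b | _⟩
    · exact h0 _
    · exact hadd a b _ ((Int.natAbs_ediv_le_natAbs a b).trans (Nat.le_add_right _ _))
    all_goals exact h0 _

namespace PolyTime

theorem polyBounded {f : α → β} (hf : PolyTime 𝒪 D f) : PolyBounded D (fun x => sz (f x)) :=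
  let ⟨_, _, hT, h⟩ := hf
  hT.of_le fun x hx => (h x hx).1

theorem mono {f : α → β} (hf : PolyTime 𝒪 D' f) (h : ∀ x, D x → D' x) : PolyTime 𝒪 D f :=
  let ⟨c, T, hT, hc⟩ := hf
  ⟨c, T, hT.mono h, fun x hx => hc x (h x hx)⟩

/-- Only the encoding of the result matters. -/
theorem congr_enc {f : α → β} {g : α → γ} (hf : PolyTime 𝒪 D f)
    (h : ∀ x, D x → enc (f x) = enc (g x)) : PolyTime 𝒪 D g :=
  let ⟨c, T, hT, hc⟩ := hf
  ⟨c, T, hT, fun x hx => by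
    have := hc x hx
    rwa [sz, h x hx] at this⟩

theorem congr {f g : α → β} (hf : PolyTime 𝒪 D f) (h : ∀ x, D x → f x = g x) : PolyTime 𝒪 D g :=
  hf.congr_enc fun x hx => by rw [h x hx]

theorem of_op {f : α → β} (o : Op) (h : ∀ x, D x → o.run (enc x) = enc (f x)) :
    PolyTime 𝒪 D f := by
  obtain ⟨k, hk⟩ := o.exists_size_run_le
  have hs : ∀ x, D x → sz (f x) ≤ sz x + k := fun x hx => by
    rw [sz, ← h x hx]
    exact hk _
  refine ⟨.op o, fun x => 1 + sz x + sz (f x),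
    ((PolyBounded.const 1).add PolyBounded.size).add
      ((PolyBounded.size.add (PolyBounded.const k)).of_le hs), fun x hx => ⟨Nat.le_add_left _ _, fun O _ => ?_⟩⟩
  refine ⟨_, ?_, le_rfl⟩
  have := Eval.op (O := O) o (enc x)
  rw [h x hx] at this
  exact this

theorem comp {E : β → Prop} {g : β → γ} {f : α → β} (hg : PolyTime 𝒪 E g) (hf : PolyTime 𝒪 D f)
    (h : ∀ x, D x → E (f x)) : PolyTime 𝒪 D (fun x => g (f x)) := by
  have hb := hf.polyBounded
  obtain ⟨c, T, hT, hc⟩ := hf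
  obtain ⟨d, S, hS, hd⟩ := hg
  refine ⟨.seq c d, fun x => 1 + T x + S (f x),
    ((PolyBounded.const 1).add hT).add (hS.comp hb h), fun x hx => ⟨?_, fun O hO => ?_⟩⟩
  · exact (hd _ (h x hx)).1.trans (Nat.le_add_left _ _)
  · obtain ⟨t, ht, htT⟩ := (hc x hx).2 O hO
    obtain ⟨s, hs, hsS⟩ := (hd _ (h x hx)).2 O hO
    exact ⟨_, .seq ht hs, by beta_reduce; omega⟩

theorem pair {f : α → β} {g : α → γ} (hf : PolyTime 𝒪 D f) (hg : PolyTime 𝒪 D g) :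
    PolyTime 𝒪 D (fun x => (f x, g x)) := by
  obtain ⟨c, T, hT, hc⟩ := hf
  obtain ⟨d, S, hS, hd⟩ := hg
  refine ⟨.pair c d, fun x => 1 + T x + S x, ((PolyBounded.const 1).add hT).add hS,
    fun x hx => ⟨?_, fun O hO => ?_⟩⟩
  · have h1 := (hc x hx).1
    have h2 := (hd x hx).1
    simp only [sz] at h1 h2
    simp only [sz, enc, Data.size]
    omega
  · obtain ⟨t, ht, htT⟩ := (hc x hx).2 O hO
    obtain ⟨s, hs, hsS⟩ := (hd x hx).2 O hO
    exact ⟨_, .pair ht hs, by beta_reduce; omega⟩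

theorem id : PolyTime 𝒪 D (fun x => x) := of_op .id fun _ _ => rfl

theorem int (z : ℤ) : PolyTime 𝒪 D (fun _ => z) := of_op (.const z) fun _ _ => rfl

theorem nat (k : ℕ) : PolyTime 𝒪 D (fun _ => k) := of_op (.const k) fun _ _ => rfl

theorem nil : PolyTime 𝒪 D (fun _ => ([] : List β)) := of_op (.const 0) fun _ _ => rfl

theorem none : PolyTime 𝒪 D (fun _ => (Option.none : Option ℤ)) := of_op (.const 0) fun _ _ => rfl

theorem fst {f : α → β × γ} (hf : PolyTime 𝒪 D f) : PolyTime 𝒪 D (fun x => (f x).1) :=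
  (of_op (D := fun _ : β × γ => True) .fst fun _ _ => rfl).comp hf fun _ _ => trivial

theorem snd {f : α → β × γ} (hf : PolyTime 𝒪 D f) : PolyTime 𝒪 D (fun x => (f x).2) :=
  (of_op (D := fun _ : β × γ => True) .snd fun _ _ => rfl).comp hf fun _ _ => trivial

theorem cons {f : α → β} {l : α → List β} (hf : PolyTime 𝒪 D f) (hl : PolyTime 𝒪 D l) :
    PolyTime 𝒪 D (fun x => f x :: l x) := (hf.pair hl).congr_enc fun _ _ => rfl

theorem tail {l : α → List β} (hl : PolyTime 𝒪 D l) : PolyTime 𝒪 D (fun x => (l x).tail) :=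
  (of_op (D := fun _ : List β => True) .snd fun l _ => by cases l <;> rfl).comp hl fun _ _ => trivial

theorem headD {l : α → List β} {d : β} (hd : enc d = .int 0) (hl : PolyTime 𝒪 D l) :
    PolyTime 𝒪 D (fun x => (l x).headD d) :=
  (of_op (D := fun _ : List β => True) (f := fun l => l.headD d) .fst fun l _ => by
    cases l
    · exact hd.symm
    · rfl).comp hl fun _ _ => trivial

theorem some {f : α → ℤ} (hf : PolyTime 𝒪 D f) : PolyTime 𝒪 D (fun x => Option.some (f x)) :=
  ((int 0).pair hf).congr_enc fun _ _ => rfl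

theorem getD_zero {f : α → Option ℤ} (hf : PolyTime 𝒪 D f) :
    PolyTime 𝒪 D (fun x => (f x).getD 0) :=
  (of_op (D := fun _ : Option ℤ => True) (f := fun o => o.getD 0) .snd fun o _ => by cases o <;> rfl).comp hf
    fun _ _ => trivial

section Arithmetic

variable {f g : α → ℤ} {a b : α → ℕ}

theorem add (hf : PolyTime 𝒪 D f) (hg : PolyTime 𝒪 D g) : PolyTime 𝒪 D (fun x => f x + g x) :=
  (of_op (D := fun _ : ℤ × ℤ => True) (f := fun p => p.1 + p.2) .add fun _ _ => rfl).comp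
    (hf.pair hg) fun _ _ => trivial

theorem sub (hf : PolyTime 𝒪 D f) (hg : PolyTime 𝒪 D g) : PolyTime 𝒪 D (fun x => f x - g x) :=
  (of_op (D := fun _ : ℤ × ℤ => True) (f := fun p => p.1 - p.2) .sub fun _ _ => rfl).comp
    (hf.pair hg) fun _ _ => trivial

theorem mul (hf : PolyTime 𝒪 D f) (hg : PolyTime 𝒪 D g) : PolyTime 𝒪 D (fun x => f x * g x) :=
  (of_op (D := fun _ : ℤ × ℤ => True) (f := fun p => p.1 * p.2) .mul fun _ _ => rfl).comp
    (hf.pair hg) fun _ _ => trivial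

theorem div (hf : PolyTime 𝒪 D f) (hg : PolyTime 𝒪 D g) : PolyTime 𝒪 D (fun x => f x / g x) :=
  (of_op (D := fun _ : ℤ × ℤ => True) (f := fun p => p.1 / p.2) .div fun _ _ => rfl).comp
    (hf.pair hg) fun _ _ => trivial

theorem cast (ha : PolyTime 𝒪 D a) : PolyTime 𝒪 D (fun x => (a x : ℤ)) :=
  ha.congr_enc fun _ _ => rfl

theorem of_cast (ha : PolyTime 𝒪 D f) (h : ∀ x, D x → f x = a x) : PolyTime 𝒪 D a :=
  ha.congr_enc fun x hx => congrArg Data.int (h x hx)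

theorem nat_add (ha : PolyTime 𝒪 D a) (hb : PolyTime 𝒪 D b) : PolyTime 𝒪 D (fun x => a x + b x) :=
  (ha.cast.add hb.cast).of_cast fun _ _ => (Nat.cast_add _ _).symm

theorem nat_mul (ha : PolyTime 𝒪 D a) (hb : PolyTime 𝒪 D b) : PolyTime 𝒪 D (fun x => a x * b x) :=
  (ha.cast.mul hb.cast).of_cast fun _ _ => (Nat.cast_mul _ _).symm

theorem nat_div (ha : PolyTime 𝒪 D a) (hb : PolyTime 𝒪 D b) : PolyTime 𝒪 D (fun x => a x / b x) :=
  (ha.cast.div hb.cast).of_cast fun _ _ => (Int.natCast_div _ _).symm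

theorem nat_mod (ha : PolyTime 𝒪 D a) (hb : PolyTime 𝒪 D b) : PolyTime 𝒪 D (fun x => a x % b x) :=
  (ha.cast.sub (hb.cast.mul (ha.cast.div hb.cast))).of_cast fun x _ => by
    rw [Int.natCast_mod, Int.emod_def]

theorem nat_sub (ha : PolyTime 𝒪 D a) (hb : PolyTime 𝒪 D b) (h : ∀ x, D x → b x ≤ a x) :
    PolyTime 𝒪 D (fun x => a x - b x) :=
  (ha.cast.sub hb.cast).of_cast fun x hx => (Nat.cast_sub (h x hx)).symm

end Arithmetic

end PolyTime

end Polynomial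

end TropReg

namespace TropReg

open Enc (enc)

/-! ### Branching and loops -/

section Loops

variable {α β γ : Type} [Enc α] [Enc β] [Enc γ] {D D' : α → Prop} {𝒪 : (Data → Data) → Prop}

namespace PolyDec

variable {p q : α → Prop}

theorem congr (hp : PolyDec 𝒪 D p) (h : ∀ x, D x → (p x ↔ q x)) : PolyDec 𝒪 D q :=
  let ⟨c, hc, hcp⟩ := hp
  ⟨c, hc, fun x hx => (hcp x hx).trans (h x hx)⟩

theorem mono (hp : PolyDec 𝒪 D' p) (h : ∀ x, D x → D' x) : PolyDec 𝒪 D p :=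
  let ⟨c, hc, hcp⟩ := hp
  ⟨c, hc.mono h, fun x hx => hcp x (h x hx)⟩

theorem comp {E : β → Prop} {q : β → Prop} {f : α → β} (hq : PolyDec 𝒪 E q)
    (hf : PolyTime 𝒪 D f) (h : ∀ x, D x → E (f x)) : PolyDec 𝒪 D (fun x => q (f x)) :=
  let ⟨c, hc, hcp⟩ := hq
  ⟨fun x => c (f x), hc.comp hf h, fun x hx => hcp (f x) (h x hx)⟩

theorem lt {f g : α → ℤ} (hf : PolyTime 𝒪 D f) (hg : PolyTime 𝒪 D g) :
    PolyDec 𝒪 D (fun x => f x < g x) :=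
  ⟨_, hg.sub hf, fun _ _ => sub_pos⟩

theorem not (hp : PolyDec 𝒪 D p) : PolyDec 𝒪 D (fun x => ¬ p x) :=
  let ⟨c, hc, hcp⟩ := hp
  ⟨_, (PolyTime.int 1).sub hc, fun x hx => by beta_reduce; rw [← hcp x hx]; omega⟩

theorem eq {f g : α → ℤ} (hf : PolyTime 𝒪 D f) (hg : PolyTime 𝒪 D g) :
    PolyDec 𝒪 D (fun x => f x = g x) :=
  ⟨_, (PolyTime.int 1).sub ((hf.sub hg).mul (hf.sub hg)), fun x _ => by
    beta_reduce
    rw [← sub_eq_zero (a := f x)]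
    constructor
    · intro h
      by_contra h'
      have : 0 < (f x - g x) * (f x - g x) := mul_self_pos.2 h'
      omega
    · intro h
      rw [h]
      norm_num⟩

theorem nat_lt {f g : α → ℕ} (hf : PolyTime 𝒪 D f) (hg : PolyTime 𝒪 D g) :
    PolyDec 𝒪 D (fun x => f x < g x) :=
  (lt hf.cast hg.cast).congr fun _ _ => Nat.cast_lt

theorem nat_eq {f g : α → ℕ} (hf : PolyTime 𝒪 D f) (hg : PolyTime 𝒪 D g) :
    PolyDec 𝒪 D (fun x => f x = g x) :=
  (eq hf.cast hg.cast).congr fun _ _ => Nat.cast_inj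

theorem isSome {f : α → Option ℤ} (hf : PolyTime 𝒪 D f) :
    PolyDec 𝒪 D (fun x => (f x).isSome) :=
  ⟨fun x => if (f x).isSome then 1 else 0,
    (PolyTime.of_op (D := fun _ : Option ℤ => True)
      (f := fun o : Option ℤ => ((if o.isSome then 1 else 0 : ℤ))) .isPair
      fun o _ => by cases o <;> rfl).comp hf fun _ _ => trivial,
    fun x _ => by beta_reduce; split_ifs with h <;> simp [h]⟩

end PolyDec

theorem PolyTime.ite {p : α → Prop} [DecidablePred p] {f g : α → β} (hp : PolyDec 𝒪 D p)
    (hf : PolyTime 𝒪 (fun x => D x ∧ p x) f) (hg : PolyTime 𝒪 (fun x => D x ∧ ¬ p x) g) :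
    PolyTime 𝒪 D (fun x => if p x then f x else g x) := by
  obtain ⟨d, ⟨cc, U, hU, hc⟩, hd⟩ := hp
  obtain ⟨cf, T, hT, hf⟩ := hf
  obtain ⟨cg, S, hS, hg⟩ := hg
  refine ⟨.cond cc cf cg, fun x => 1 + U x + (if p x then T x else S x),
    ((PolyBounded.const 1).add hU).add (PolyBounded.ite hT hS), fun x hx => ⟨?_, fun O hO => ?_⟩⟩
  · beta_reduce
    split_ifs with h
    · exact (hf x ⟨hx, h⟩).1.trans (Nat.le_add_left _ _)
    · exact (hg x ⟨hx, h⟩).1.trans (Nat.le_add_left _ _)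
  · obtain ⟨u, hu, huU⟩ := (hc x hx).2 O hO
    beta_reduce
    split_ifs with h
    · obtain ⟨t, ht, htT⟩ := (hf x ⟨hx, h⟩).2 O hO
      exact ⟨_, .cond_true hu ((hd x hx).2 h) ht, by omega⟩
    · obtain ⟨t, ht, htT⟩ := (hg x ⟨hx, h⟩).2 O hO
      exact ⟨_, .cond_false hu (fun h' => h ((hd x hx).1 h')) ht, by omega⟩

namespace PolyDec

variable {p q : α → Prop}

/-- Conjunction; the second predicate only has to be decidable where the first one holds. -/
theorem and (hp : PolyDec 𝒪 D p) (hq : PolyDec 𝒪 (fun x => D x ∧ p x) q) :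
    PolyDec 𝒪 D (fun x => p x ∧ q x) := by
  classical
  obtain ⟨c, hc, hcq⟩ := hq
  refine ⟨_, PolyTime.ite hp hc (PolyTime.int 0), fun x hx => ?_⟩
  beta_reduce
  split_ifs with h
  · rw [hcq x ⟨hx, h⟩]
    tauto
  · simp [h]

theorem or (hp : PolyDec 𝒪 D p) (hq : PolyDec 𝒪 D q) : PolyDec 𝒪 D (fun x => p x ∨ q x) :=
  ((hp.not.and (hq.not.mono fun _ h => h.1)).not).congr fun _ _ => by tauto

end PolyDec

/-- While loops: if the body preserves an invariant that bounds the size of the state by a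
polynomial, and decreases a measure that is polynomially bounded at the beginning, then some
function computable in polynomial time yields a state where the invariant holds and the test
fails. -/
theorem PolyTime.exists_while {X S : Type} [Enc X] [Enc S] {D : X → Prop} {Inv : X → S → Prop}
    {c : X × S → Prop} {F : X × S → S} {s₀ : X → S} (μ : X → S → ℕ) (B : X → ℕ)
    (hc : PolyDec 𝒪 (fun p => D p.1 ∧ Inv p.1 p.2) c)
    (hF : PolyTime 𝒪 (fun p => (D p.1 ∧ Inv p.1 p.2) ∧ c p) F) (hs₀ : PolyTime 𝒪 D s₀)
    (h0 : ∀ x, D x → Inv x (s₀ x))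
    (hstep : ∀ x s, D x → Inv x s → c (x, s) → Inv x (F (x, s)) ∧ μ x (F (x, s)) < μ x s)
    (hμ : PolyBounded D fun x => μ x (s₀ x)) (hB : PolyBounded D B)
    (hsz : ∀ x s, D x → Inv x s → sz s ≤ B x) :
    ∃ f : X → S, PolyTime 𝒪 D f ∧ ∀ x, D x → Inv x (f x) ∧ ¬ c (x, f x) := by
  obtain ⟨d, ⟨cc, U, ⟨PU, hPU⟩, hcc⟩, hd⟩ := hc
  obtain ⟨cF, T, ⟨PT, hPT⟩, hcF⟩ := hF
  obtain ⟨c₀, T₀, hT₀, hc₀⟩ := hs₀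
  set R : X → ℕ := fun x => 1 + sz x + B x with hR
  set K : X → ℕ := fun x => PU.eval (R x) + PT.eval (R x) + 2 * R x + 3 with hK
  have hRb : PolyBounded D R := ((PolyBounded.const 1).add PolyBounded.size).add hB
  have hKb : PolyBounded D K :=
    (((hRb.eval PU).add (hRb.eval PT)).add ((PolyBounded.const 2).mul hRb)).add (PolyBounded.const 3)
  have hpair : ∀ x s, D x → Inv x s → sz (x, s) ≤ R x := fun x s hx hs => by
    have := hsz x s hx hs
    simp only [sz, enc, Data.size, hR] at this ⊢
    omega
  have hU : ∀ x s, D x → Inv x s → U (x, s) ≤ PU.eval (R x) := fun x s hx hs =>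
    (hPU _ ⟨hx, hs⟩).trans (eval_mono _ (hpair x s hx hs))
  have hT : ∀ x s, D x → Inv x s → c (x, s) → T (x, s) ≤ PT.eval (R x) := fun x s hx hs h =>
    (hPT _ ⟨⟨hx, hs⟩, h⟩).trans (eval_mono _ (hpair x s hx hs))
  -- the loop runs on the pairs formed by the input and the current state
  set lp : Prog := .loop cc (.pair (.op .fst) cF)
  have main : ∀ N x s, D x → Inv x s → μ x s ≤ N → ∃ s', Inv x s' ∧ ¬ c (x, s') ∧
      ∀ O, 𝒪 O → ∃ t, Eval O lp (enc (x, s)) (enc (x, s')) t ∧ t ≤ (N + 1) * K x := by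
    intro N
    induction N with
    | zero =>
      intro x s hx hs hμ
      have hcs : ¬ c (x, s) := fun h => by have := (hstep x s hx hs h).2; omega
      refine ⟨s, hs, hcs, fun O hO => ?_⟩
      obtain ⟨u, hu, huU⟩ := (hcc (x, s) ⟨hx, hs⟩).2 O hO
      refine ⟨_, .loop_false hu (fun h => hcs ((hd _ ⟨hx, hs⟩).1 h)), ?_⟩
      have := hU x s hx hs
      simp only [hK]
      omega
    | succ N ih =>
      intro x s hx hs hμ
      by_cases hcs : c (x, s)
      · obtain ⟨hs', hlt⟩ := hstep x s hx hs hcs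
        obtain ⟨s', hinv, hc', hev⟩ := ih x (F (x, s)) hx hs' (by omega)
        refine ⟨s', hinv, hc', fun O hO => ?_⟩
        obtain ⟨u, hu, huU⟩ := (hcc (x, s) ⟨hx, hs⟩).2 O hO
        obtain ⟨t, ht, htT⟩ := (hcF (x, s) ⟨⟨hx, hs⟩, hcs⟩).2 O hO
        obtain ⟨v, hv, hvK⟩ := hev O hO
        have hfst : Eval O (.op .fst) (enc (x, s)) (enc x) (1 + sz (x, s) + sz x) :=
          Eval.op Op.fst (enc (x, s))
        refine ⟨_, .loop_true hu ((hd _ ⟨hx, hs⟩).2 hcs) (.pair hfst ht) hv, ?_⟩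
        have h1 := hU x s hx hs
        have h2 := hT x s hx hs hcs
        have h3 := hpair x s hx hs
        have h4 : sz x ≤ R x := by simp only [hR]; omega
        have h5 : (N + 1 + 1) * K x = (N + 1) * K x + K x := by ring
        have h6 : K x = PU.eval (R x) + PT.eval (R x) + 2 * R x + 3 := rfl
        omega
      · refine ⟨s, hs, hcs, fun O hO => ?_⟩
        obtain ⟨u, hu, huU⟩ := (hcc (x, s) ⟨hx, hs⟩).2 O hO
        refine ⟨_, .loop_false hu (fun h => hcs ((hd _ ⟨hx, hs⟩).1 h)), ?_⟩
        have h1 := hU x s hx hs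
        have h5 : (N + 1 + 1) * K x = (N + 1) * K x + K x := by ring
        have h6 : K x = PU.eval (R x) + PT.eval (R x) + 2 * R x + 3 := rfl
        omega
  have main' : ∀ x, ∃ s', D x → Inv x s' ∧ ¬ c (x, s') ∧
      ∀ O, 𝒪 O → ∃ t, Eval O lp (enc (x, s₀ x)) (enc (x, s')) t ∧ t ≤ (μ x (s₀ x) + 1) * K x := by
    intro x
    by_cases hx : D x
    · obtain ⟨s', h⟩ := main _ x (s₀ x) hx (h0 x hx) le_rfl
      exact ⟨s', fun _ => h⟩
    · exact ⟨s₀ x, fun h => absurd h hx⟩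
  choose f hf using main'
  refine ⟨f, ⟨.seq (.pair (.op .id) c₀) (.seq lp (.op .snd)),
    fun x => (T₀ x + 2 * R x + 4) + (μ x (s₀ x) + 1) * K x + 2 * R x, ?_, fun x hx => ⟨?_, ?_⟩⟩,
    fun x hx => ⟨(hf x hx).1, (hf x hx).2.1⟩⟩
  · exact (((hT₀.add ((PolyBounded.const 2).mul hRb)).add (PolyBounded.const 4)).add
      ((hμ.add (PolyBounded.const 1)).mul hKb)).add ((PolyBounded.const 2).mul hRb)
  · have := hsz x _ hx (hf x hx).1
    simp only [hR]
    omega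
  · intro O hO
    obtain ⟨t, ht, htT⟩ := (hc₀ x hx).2 O hO
    obtain ⟨v, hv, hvK⟩ := (hf x hx).2.2 O hO
    have hid : Eval O (.op .id) (enc x) (enc x) (1 + sz x + sz x) := Eval.op Op.id (enc x)
    have hsnd : Eval O (.op .snd) (enc (x, f x)) (enc (f x)) (1 + sz (x, f x) + sz (f x)) :=
      Eval.op Op.snd (enc (x, f x))
    refine ⟨_, .seq (.pair hid ht) (.seq hv hsnd), ?_⟩
    have h1 := hpair x _ hx (hf x hx).1
    have h2 := hsz x _ hx (hf x hx).1
    have h3 : R x = 1 + sz x + B x := rfl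
    beta_reduce
    omega

/-- For loops: `acc x i` is the content of the accumulator after `i` steps. -/
theorem PolyTime.fold {X A : Type} [Enc X] [Enc A] {D : X → Prop} {n : X → ℕ} {acc : X → ℕ → A}
    {F : X × (ℕ × A) → A} (B : X → ℕ) (hn : PolyTime 𝒪 D n) (hnb : PolyBounded D n)
    (h0 : PolyTime 𝒪 D fun x => acc x 0)
    (hF : PolyTime 𝒪 (fun p => D p.1 ∧ p.2.1 < n p.1 ∧ p.2.2 = acc p.1 p.2.1) F)
    (hacc : ∀ x i, D x → i < n x → F (x, i, acc x i) = acc x (i + 1))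
    (hB : PolyBounded D B) (hsz : ∀ x i, D x → i ≤ n x → sz (acc x i) ≤ B x) :
    PolyTime 𝒪 D fun x => acc x (n x) := by
  have hszn : ∀ i : ℕ, sz i ≤ 1 + i := fun i => by
    simp only [sz, enc, Data.size, Int.natAbs_natCast]
    have := Nat.size_le.2 (Nat.lt_two_pow_self (n := i))
    omega
  obtain ⟨f, hf, hfs⟩ := PolyTime.exists_while (𝒪 := 𝒪) (D := D)
    (Inv := fun x (s : ℕ × A) => s.1 ≤ n x ∧ s.2 = acc x s.1) (c := fun p => p.2.1 < n p.1)
    (F := fun p => (p.2.1 + 1, F p)) (s₀ := fun x => (0, acc x 0)) (fun x s => n x - s.1)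
    (fun x => 2 + n x + B x)
    (PolyDec.nat_lt PolyTime.id.snd.fst (hn.comp PolyTime.id.fst fun _ h => h.1))
    ((PolyTime.id.snd.fst.nat_add (PolyTime.nat 1)).pair (hF.mono fun p h => ⟨h.1.1, h.2, h.1.2.2⟩))
    ((PolyTime.nat 0).pair h0) (fun x _ => ⟨Nat.zero_le _, rfl⟩)
    (fun x s hx hs h => ⟨⟨h, by
      obtain ⟨i, a⟩ := s
      obtain rfl : a = acc x i := hs.2
      exact hacc x i hx h⟩, by simp only at h ⊢; omega⟩)
    (hnb.of_le fun x _ => Nat.sub_le _ _) (((PolyBounded.const 2).add hnb).add hB)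
    (fun x s hx hs => by
      obtain ⟨i, a⟩ := s
      obtain ⟨h1, rfl⟩ : i ≤ n x ∧ a = acc x i := hs
      have h2 := hszn i
      have h3 := hsz x i hx h1
      simp only [sz, enc, Data.size] at h2 h3 ⊢
      omega)
  refine hf.snd.congr fun x hx => ?_
  obtain ⟨⟨h1, h2⟩, h3⟩ := hfs x hx
  rw [h2, show (f x).1 = n x by simp only at h3; omega]

theorem natAbs_lt_two_pow_sz (z : ℤ) : z.natAbs < 2 ^ sz z :=
  (Nat.lt_size_self _).trans_le (Nat.pow_le_pow_right two_pos (Nat.le_add_left _ _))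

theorem sz_int_le {z : ℤ} {k : ℕ} (h : z.natAbs < 2 ^ k) : sz z ≤ 1 + k :=
  Nat.add_le_add_left (Nat.size_le.2 h) 1

/-- A polynomially bounded function of `(x, k)`, where `k` ranges below a polynomial bound, is
bounded by a polynomial in the size of `x`, uniformly in `k`. -/
theorem PolyBounded.sz_prod {X : Type} [Enc X] {D : X → Prop} {n : X → ℕ} (hnb : PolyBounded D n)
    {g : X × ℕ → ℕ} (hg : PolyBounded (fun p : X × ℕ => D p.1 ∧ p.2 < n p.1) g) :
    ∃ B : X → ℕ, PolyBounded D B ∧ ∀ x k, D x → k < n x → g (x, k) ≤ B x := by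
  obtain ⟨P, hP⟩ := hg
  refine ⟨fun x => P.eval (1 + sz x + (1 + n x)),
    (((PolyBounded.const 1).add PolyBounded.size).add ((PolyBounded.const 1).add hnb)).eval P,
    fun x k hx hk => (hP (x, k) ⟨hx, hk⟩).trans (eval_mono _ ?_)⟩
  simp only [sz, enc, Data.size, Int.natAbs_natCast]
  have := Nat.size_le.2 (Nat.lt_two_pow_self (n := k))
  omega

theorem PolyTime.sum {X : Type} [Enc X] {D : X → Prop} {n : X → ℕ} {g : X × ℕ → ℤ}
    (hn : PolyTime 𝒪 D n) (hnb : PolyBounded D n)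
    (hg : PolyTime 𝒪 (fun p => D p.1 ∧ p.2 < n p.1) g) :
    PolyTime 𝒪 D fun x => ∑ k ∈ Finset.range (n x), g (x, k) := by
  obtain ⟨B, hB, hgB⟩ := hnb.sz_prod hg.polyBounded
  refine PolyTime.fold (acc := fun x i => ∑ k ∈ Finset.range i, g (x, k))
    (F := fun p => p.2.2 + g (p.1, p.2.1)) (fun x => 1 + (n x + B x)) hn hnb (PolyTime.int 0)
    (PolyTime.id.snd.snd.add (hg.comp (PolyTime.id.fst.pair PolyTime.id.snd.fst)
      fun p hp => ⟨hp.1, hp.2.1⟩))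
    (fun x i _ _ => (Finset.sum_range_succ _ _).symm)
    ((PolyBounded.const 1).add (hnb.add hB)) fun x i hx hi => sz_int_le ?_
  have h1 : (∑ k ∈ Finset.range i, g (x, k)).natAbs ≤ i * 2 ^ B x := by
    refine (Int.natAbs_sum_le _ _).trans ?_
    refine (Finset.sum_le_card_nsmul _ _ (2 ^ B x) fun k hk => ?_).trans (by simp)
    exact (natAbs_lt_two_pow_sz _).le.trans (Nat.pow_le_pow_right two_pos
      (hgB x k hx ((Finset.mem_range.1 hk).trans_le hi)))
  refine h1.trans_lt ?_
  rw [pow_add]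
  exact Nat.mul_lt_mul_of_pos_right (hi.trans_lt Nat.lt_two_pow_self) (by positivity)

/-- Bounded search. -/
theorem PolyDec.exists_lt {X : Type} [Enc X] {D : X → Prop} {n : X → ℕ} {p : X × ℕ → Prop}
    (hn : PolyTime 𝒪 D n) (hnb : PolyBounded D n)
    (hp : PolyDec 𝒪 (fun q => D q.1 ∧ q.2 < n q.1) p) :
    PolyDec 𝒪 D fun x => ∃ k, k < n x ∧ p (x, k) := by
  classical
  refine ⟨_, PolyTime.sum hn hnb (PolyTime.ite hp (PolyTime.int 1) (PolyTime.int 0)),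
    fun x _ => ?_⟩
  rw [Finset.sum_pos_iff_of_nonneg fun k _ => by split_ifs <;> norm_num]
  simp only [Finset.mem_range]
  refine exists_congr fun k => and_congr_right fun _ => ?_
  split_ifs with h <;> simp [h]

/-- The list of the values of a function on an initial segment of the natural numbers. It is built
from its end, as an element is added at the head of a list. -/
theorem PolyTime.tabulate {X A : Type} [Enc X] [Enc A] {D : X → Prop} {n : X → ℕ} {g : X × ℕ → A}
    (hn : PolyTime 𝒪 D n) (hnb : PolyBounded D n)
    (hg : PolyTime 𝒪 (fun p => D p.1 ∧ p.2 < n p.1) g) :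
    PolyTime 𝒪 D fun x => (List.range (n x)).map fun k => g (x, k) := by
  obtain ⟨B, hB, hgB⟩ := hnb.sz_prod hg.polyBounded
  have hidx : PolyTime 𝒪 (fun p : X × (ℕ × List A) => D p.1 ∧ p.2.1 < n p.1 ∧
      p.2.2 = (List.range' (n p.1 - p.2.1) p.2.1).map fun k => g (p.1, k))
      fun p => n p.1 - (p.2.1 + 1) :=
    (hn.comp PolyTime.id.fst fun _ h => h.1).nat_sub (PolyTime.id.snd.fst.nat_add (PolyTime.nat 1))
      fun p hp => hp.2.1
  refine (PolyTime.fold (acc := fun x i => (List.range' (n x - i) i).map fun k => g (x, k))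
    (F := fun p => g (p.1, n p.1 - (p.2.1 + 1)) :: p.2.2) (fun x => 1 + n x * (1 + B x)) hn hnb
    PolyTime.nil ((hg.comp (PolyTime.id.fst.pair hidx) fun p hp => ⟨hp.1, ?_⟩).cons
      PolyTime.id.snd.snd) (fun x i _ hi => ?_)
    ((PolyBounded.const 1).add (hnb.mul ((PolyBounded.const 1).add hB))) fun x i hx hi => ?_).congr
    fun x _ => ?_
  · have := hp.2.1
    simp only
    omega
  · simp only
    rw [List.range'_succ, List.map_cons, show n x - (i + 1) + 1 = n x - i by omega]
  · have key : ∀ l : List ℕ, (∀ k ∈ l, k < n x) →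
        sz (l.map fun k => g (x, k)) ≤ 1 + l.length * (1 + B x) := by
      intro l hl
      induction l with
      | nil => simp [sz, enc, Data.ofList, Data.size]
      | cons k l ih =>
        have h1 := ih fun k hk => hl k (List.mem_cons_of_mem _ hk)
        have h2 := hgB x k hx (hl k List.mem_cons_self)
        simp only [sz, enc, List.map_cons, Data.ofList, Data.size, List.length_cons, add_mul,
          one_mul] at h1 h2 ⊢
        omega
    refine (key _ fun k hk => ?_).trans ?_
    · have := List.mem_range'_1.1 hk
      omega
    · rw [List.length_range']
      gcongr
  · simp only [Nat.sub_self, List.range_eq_range']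

/-- Access to an entry of a list. -/
theorem PolyTime.getD {X A : Type} [Enc X] [Enc A] {D : X → Prop} {l : X → List A} {i : X → ℕ}
    {d : A} (hd : enc d = .int 0) (hl : PolyTime 𝒪 D l) (hi : PolyTime 𝒪 D i)
    (hib : PolyBounded D i) : PolyTime 𝒪 D fun x => (l x).getD (i x) d := by
  refine ((PolyTime.fold (acc := fun x k => (l x).drop k) (F := fun p => p.2.2.tail)
    (fun x => sz (l x)) hi hib hl PolyTime.id.snd.snd.tail (fun x k _ _ => by simp)
    hl.polyBounded fun x k _ _ => ?_).headD hd).congr fun x _ => ?_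
  · have key : ∀ (l : List A) (k : ℕ), sz (l.drop k) ≤ sz l := by
      intro l
      induction l with
      | nil => intro k; simp
      | cons a l ih =>
        intro k
        cases k with
        | zero => exact le_rfl
        | succ k =>
          refine (ih k).trans ?_
          simp only [sz, enc, List.map_cons, Data.ofList, Data.size]
          omega
    exact key _ _
  · rw [List.headD_eq_head?_getD, List.head?_drop, List.getD_eq_getElem?_getD]

end Loops

end TropReg

namespace TropReg

open Enc (enc)

/-! ### Access to matrices and games, construction of matrices and games -/

/-- The matrix of size `m × n` with the entries `A i j`, as a list of rows. -/
def tab (A : ℕ → ℕ → Option ℤ) (m n : ℕ) : List (List (Option ℤ)) :=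
  (List.range m).map fun i => (List.range n).map fun j => A i j

theorem ofFn_eq_map_range {α : Type*} (f : ℕ → α) (n : ℕ) :
    (List.ofFn fun i : Fin n => f i) = (List.range n).map f := by
  apply List.ext_getElem <;> simp

theorem enc_tab (A : ℕ → ℕ → Option ℤ) (m n : ℕ) :
    enc (tab A m n) = Data.ofMatrix .ofOption fun (i : Fin m) (j : Fin n) => A i j := by
  simp only [Data.ofMatrix, tab, enc, Function.comp_def, ← ofFn_eq_map_range, List.map_ofFn]

theorem getD_tab (A : ℕ → ℕ → Option ℤ) {m n : ℕ} (hA : ∀ i j, ¬ (i < m ∧ j < n) → A i j = none)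
    (i j : ℕ) : ((tab A m n).getD i []).getD j none = A i j := by
  by_cases hi : i < m
  · by_cases hj : j < n
    · simp [tab, List.getD_eq_getElem?_getD, hi, hj]
    · simp [tab, List.getD_eq_getElem?_getD, hi, hj, hA i j (fun h => hj h.2)]
  · simp [tab, List.getD_eq_getElem?_getD, hi, hA i j (fun h => hi h.1)]

theorem length_le_size_ofList (l : List Data) : l.length ≤ (Data.ofList l).size := by
  induction l with
  | nil => simp
  | cons a l ih =>
    simp only [List.length_cons, Data.ofList, Data.size]
    omega

theorem size_le_size_ofList {l : List Data} {a : Data} (h : a ∈ l) :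
    a.size ≤ (Data.ofList l).size := by
  induction l with
  | nil => simp at h
  | cons b l ih =>
    simp only [Data.ofList, Data.size]
    rcases List.mem_cons.1 h with rfl | h
    · omega
    · have := ih h
      omega

theorem le_size_ofMatrix {α : Type} (e : α → Data) {m n : ℕ} (A : Fin m → Fin n → α) :
    m ≤ (Data.ofMatrix e A).size :=
  le_trans (by simp) (length_le_size_ofList _)

theorem le_size_ofMatrix' {α : Type} (e : α → Data) {m n : ℕ} (A : Fin m → Fin n → α)
    (hm : 0 < m) : n ≤ (Data.ofMatrix e A).size := by
  refine le_trans ?_ (size_le_size_ofList (a := Data.ofList (List.ofFn fun j => e (A ⟨0, hm⟩ j))) ?_)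
  · exact le_trans (by simp) (length_le_size_ofList _)
  · exact (List.mem_ofFn' _ _).2 ⟨⟨0, hm⟩, rfl⟩

section

variable {X : Type} [Enc X] {D : X → Prop} {𝒪 : (Data → Data) → Prop}

theorem PolyTime.tab {A : X → ℕ → ℕ → Option ℤ} {m n : X → ℕ} (hm : PolyTime 𝒪 D m)
    (hmb : PolyBounded D m) (hn : PolyTime 𝒪 D n) (hnb : PolyBounded D n)
    (hA : PolyTime 𝒪 (fun p : (X × ℕ) × ℕ => (D p.1.1 ∧ p.1.2 < m p.1.1) ∧ p.2 < n p.1.1)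
      fun p => A p.1.1 p.1.2 p.2) : PolyTime 𝒪 D fun x => tab (A x) (m x) (n x) :=
  hm.tabulate hmb (PolyTime.tabulate (hn.comp PolyTime.id.fst fun _ h => h.1)
    (hnb.comp_fst fun _ h => h.1) hA)

/-- Access to an entry of a matrix that is given as a list of rows. -/
theorem PolyTime.getD_getD {l : X → List (List (Option ℤ))} {i j : X → ℕ} (hl : PolyTime 𝒪 D l)
    (hi : PolyTime 𝒪 D i) (hib : PolyBounded D i) (hj : PolyTime 𝒪 D j) (hjb : PolyBounded D j) :
    PolyTime 𝒪 D fun x => ((l x).getD (i x) []).getD (j x) Option.none :=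
  (hl.getD rfl hi hib).getD rfl hj hjb

/-- Oracle calls. -/
theorem PolyTime.of_oracle {Y Z : Type} [Enc Y] [Enc Z] {Q : Problem} {d : X → Y} {y : X → Z}
    (hd : PolyTime Q.SolvedBy D d) (h : ∀ x, D x → ∃ i : Q.Inst, Q.enc i = enc (d x) ∧
      ∀ z, Q.IsAnswer i z → z = enc (y x)) (hy : PolyBounded D fun x => sz (y x)) :
    PolyTime Q.SolvedBy D y := by
  have hdb := hd.polyBounded
  obtain ⟨c, T, hT, hc⟩ := hd
  refine ⟨.seq c .oracle, fun x => 1 + T x + (1 + sz (d x) + sz (y x)),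
    ((PolyBounded.const 1).add hT).add (((PolyBounded.const 1).add hdb).add hy),
    fun x hx => ⟨by beta_reduce; omega, fun O hO => ?_⟩⟩
  obtain ⟨t, ht, htT⟩ := (hc x hx).2 O hO
  obtain ⟨i, hi, hz⟩ := h x hx
  have hO' : O (enc (d x)) = enc (y x) := hz _ (hi ▸ hO i)
  have ho := Eval.oracle (O := O) (enc (d x))
  rw [hO'] at ho
  exact ⟨_, .seq ht ho, by beta_reduce; simp only [sz]; omega⟩

theorem polyTimeTuringReduces_of_polyTime {I Z : Type} [Enc I] [Enc Z] {A : I → Data → Prop}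
    {hI : Function.Injective (enc : I → Data)} {Q : Problem} {f : I → Z}
    (hf : PolyTime Q.SolvedBy (fun _ => True) f) (h : ∀ i, A i (enc (f i))) :
    PolyTimeTuringReduces ⟨I, enc, hI, A⟩ Q := by
  obtain ⟨c, T, ⟨B, hB⟩, hc⟩ := hf
  refine ⟨c, B, fun O hO i => ?_⟩
  obtain ⟨t, ht, htT⟩ := (hc i trivial).2 O hO
  exact ⟨_, t, ht, h i, htT.trans (hB i trivial)⟩

end

namespace IntMatrix

/-- The input data of a matrix, with the list of rows. -/
def tuple (V : IntMatrix) : (ℕ × ℕ) × List (List (Option ℤ)) := ((V.n, V.p), tab V.ent V.n V.p)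

theorem enc_tuple (V : IntMatrix) : Enc.enc V.tuple = Enc.enc V := by
  change Data.pair (.pair (.int V.n) (.int V.p)) (Enc.enc (tab V.ent V.n V.p)) = V.enc
  rw [enc_tab, IntMatrix.enc]
  congr
  funext i k
  exact V.ent_val i k

theorem ent_eq_none (V : IntMatrix) (i k : ℕ) (h : ¬ (i < V.n ∧ k < V.p)) : V.ent i k = none :=
  dif_neg h

theorem n_le_sz (V : IntMatrix) : V.n ≤ sz V := by
  have := le_size_ofMatrix Data.ofOption V.entry
  change V.n ≤ 1 + _ + (Data.ofMatrix Data.ofOption V.entry).size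
  omega

theorem p_le_sz (V : IntMatrix) : V.p ≤ sz V := by
  have := le_size_ofMatrix' Data.ofOption V.entry V.n_pos
  change V.p ≤ 1 + _ + (Data.ofMatrix Data.ofOption V.entry).size
  omega

variable {X : Type} [Enc X] {D : X → Prop} {𝒪 : (Data → Data) → Prop} {V : X → IntMatrix}

theorem polyTime_tuple (hV : PolyTime 𝒪 D V) : PolyTime 𝒪 D fun x => (V x).tuple :=
  hV.congr_enc fun _ _ => (enc_tuple _).symm

theorem polyTime_n (hV : PolyTime 𝒪 D V) : PolyTime 𝒪 D fun x => (V x).n :=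
  (polyTime_tuple hV).fst.fst

theorem polyTime_p (hV : PolyTime 𝒪 D V) : PolyTime 𝒪 D fun x => (V x).p :=
  (polyTime_tuple hV).fst.snd

theorem polyBounded_n (hV : PolyTime 𝒪 D V) : PolyBounded D fun x => (V x).n :=
  hV.polyBounded.of_le fun _ _ => n_le_sz _

theorem polyBounded_p (hV : PolyTime 𝒪 D V) : PolyBounded D fun x => (V x).p :=
  hV.polyBounded.of_le fun _ _ => p_le_sz _

theorem polyTime_ent {i k : X → ℕ} (hV : PolyTime 𝒪 D V) (hi : PolyTime 𝒪 D i)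
    (hib : PolyBounded D i) (hk : PolyTime 𝒪 D k) (hkb : PolyBounded D k) :
    PolyTime 𝒪 D fun x => (V x).ent (i x) (k x) :=
  ((polyTime_tuple hV).snd.getD_getD hi hib hk hkb).congr fun _ _ =>
    getD_tab _ (ent_eq_none _) _ _

end IntMatrix

namespace Game

/-- The arcs of Player Min, extended by `none` to all pairs of natural numbers. -/
def minA (G : Game) (i j : ℕ) : Option ℤ :=
  if h : i < G.m ∧ j < G.n then G.minArc ⟨i, h.1⟩ ⟨j, h.2⟩ else none

/-- The arcs of Player Max, extended by `none` to all pairs of natural numbers. -/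
def maxA (G : Game) (j l : ℕ) : Option ℤ :=
  if h : j < G.n ∧ l < G.m then G.maxArc ⟨j, h.1⟩ ⟨l, h.2⟩ else none

theorem minE_eq (G : Game) (i j : ℕ) : G.minE i j = if j = G.n then some 0 else G.minA i j := by
  rw [minE, minA]
  split_ifs <;> first | rfl | omega

theorem maxE_eq (G : Game) (M : ℤ) (j l : ℕ) :
    G.maxE M j l = if j = G.n ∧ l = G.init then some M else G.maxA j l := by
  rw [maxE, maxA]
  split_ifs <;> first | rfl | omega

/-- The input data of a game, with lists of rows. -/
def tuple (G : Game) : (ℕ × ℕ) × (ℕ × (List (List (Option ℤ)) × List (List (Option ℤ)))) :=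
  ((G.m, G.n), (G.init, (tab G.minA G.m G.n, tab G.maxA G.n G.m)))

theorem enc_tuple (G : Game) : Enc.enc G.tuple = Enc.enc G := by
  change Data.pair (.pair (.int G.m) (.int G.n)) (.pair (.int (G.init : ℕ))
    (.pair (Enc.enc (tab G.minA G.m G.n)) (Enc.enc (tab G.maxA G.n G.m)))) = G.enc
  rw [enc_tab, enc_tab, Game.enc]
  congr
  · funext i k
    exact dif_pos ⟨i.2, k.2⟩
  · funext i k
    exact dif_pos ⟨i.2, k.2⟩

theorem m_le_sz (G : Game) : G.m ≤ sz G := by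
  have := le_size_ofMatrix Data.ofOption G.minArc
  change G.m ≤ 1 + _ + (1 + _ + (1 + (Data.ofMatrix Data.ofOption G.minArc).size + _))
  omega

theorem n_le_sz (G : Game) : G.n ≤ sz G := by
  have := le_size_ofMatrix' Data.ofOption G.minArc G.m_pos
  change G.n ≤ 1 + _ + (1 + _ + (1 + (Data.ofMatrix Data.ofOption G.minArc).size + _))
  omega

variable {X : Type} [Enc X] {D : X → Prop} {𝒪 : (Data → Data) → Prop} {G : X → Game}

theorem polyTime_tuple (hG : PolyTime 𝒪 D G) : PolyTime 𝒪 D fun x => (G x).tuple :=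
  hG.congr_enc fun _ _ => (enc_tuple _).symm

theorem polyTime_m (hG : PolyTime 𝒪 D G) : PolyTime 𝒪 D fun x => (G x).m :=
  (polyTime_tuple hG).fst.fst

theorem polyTime_n (hG : PolyTime 𝒪 D G) : PolyTime 𝒪 D fun x => (G x).n :=
  (polyTime_tuple hG).fst.snd

theorem polyTime_init (hG : PolyTime 𝒪 D G) : PolyTime 𝒪 D fun x => ((G x).init : ℕ) :=
  (polyTime_tuple hG).snd.fst

theorem polyBounded_m (hG : PolyTime 𝒪 D G) : PolyBounded D fun x => (G x).m :=
  hG.polyBounded.of_le fun _ _ => m_le_sz _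

theorem polyBounded_n (hG : PolyTime 𝒪 D G) : PolyBounded D fun x => (G x).n :=
  hG.polyBounded.of_le fun _ _ => n_le_sz _

theorem polyTime_minA {i j : X → ℕ} (hG : PolyTime 𝒪 D G) (hi : PolyTime 𝒪 D i)
    (hib : PolyBounded D i) (hj : PolyTime 𝒪 D j) (hjb : PolyBounded D j) :
    PolyTime 𝒪 D fun x => (G x).minA (i x) (j x) :=
  ((polyTime_tuple hG).snd.snd.fst.getD_getD hi hib hj hjb).congr fun _ _ =>
    getD_tab _ (fun _ _ h => dif_neg h) _ _

theorem polyTime_maxA {j l : X → ℕ} (hG : PolyTime 𝒪 D G) (hj : PolyTime 𝒪 D j)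
    (hjb : PolyBounded D j) (hl : PolyTime 𝒪 D l) (hlb : PolyBounded D l) :
    PolyTime 𝒪 D fun x => (G x).maxA (j x) (l x) :=
  ((polyTime_tuple hG).snd.snd.snd.getD_getD hj hjb hl hlb).congr fun _ _ =>
    getD_tab _ (fun _ _ h => dif_neg h) _ _

end Game

end TropReg

namespace TropReg

open Enc (enc)

/-! ### Reduction of the value of a matrix to mean payoff games -/

theorem PolyTime.option_map {X : Type} [Enc X] {D : X → Prop} {𝒪 : (Data → Data) → Prop}
    {o : X → Option ℤ} {f : X → ℤ → ℤ} (ho : PolyTime 𝒪 D o)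
    (hf : PolyTime 𝒪 D fun x => f x ((o x).getD 0)) :
    PolyTime 𝒪 D fun x => (o x).map (f x) :=
  (PolyTime.ite (PolyDec.isSome ho) (hf.mono fun _ h => h.1).some PolyTime.none).congr
    fun x _ => by cases o x <;> rfl

/-- An index below a polynomial bound is polynomially bounded. -/
theorem PolyBounded.fst_snd {X : Type} [Enc X] {D : X → Prop} {m : X → ℕ} (hm : PolyBounded D m)
    {E : (X × ℕ) × ℕ → Prop} (h : ∀ p, E p → D p.1.1 ∧ p.1.2 < m p.1.1) :
    PolyBounded E fun p => p.1.2 :=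
  ((hm.comp_fst (E := fun p : X × ℕ => D p.1) fun _ h => h).comp_fst (fun p hp => (h p hp).1)).of_le
    fun p hp => (h p hp).2.le

theorem PolyBounded.snd {X : Type} [Enc X] {D : X → Prop} {m : X → ℕ} (hm : PolyBounded D m)
    {E : (X × ℕ) × ℕ → Prop} (h : ∀ p, E p → D p.1.1 ∧ p.2 < m p.1.1) :
    PolyBounded E fun p => p.2 :=
  ((hm.comp_fst (E := fun p : X × ℕ => D p.1) fun _ h => h).comp_fst (fun p hp => (h p hp).1)).of_le
    fun p hp => (h p hp).2.le

/-- The sum of the squares of the entries of a matrix, a bound for their absolute values. -/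
def sumSq (A : ℕ → ℕ → Option ℤ) (m n : ℕ) : ℤ :=
  ∑ i ∈ Finset.range m, ∑ j ∈ Finset.range n, (A i j).getD 0 * (A i j).getD 0

theorem sumSq_nonneg (A : ℕ → ℕ → Option ℤ) (m n : ℕ) : 0 ≤ sumSq A m n :=
  Finset.sum_nonneg fun _ _ => Finset.sum_nonneg fun _ _ => mul_self_nonneg _

theorem abs_le_sumSq {A : ℕ → ℕ → Option ℤ} {m n i j : ℕ} {z : ℤ} (h : A i j = some z)
    (hi : i < m) (hj : j < n) : |z| ≤ sumSq A m n := by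
  have h1 : z * z ≤ sumSq A m n := by
    have h2 : z * z = (A i j).getD 0 * (A i j).getD 0 := by rw [h]; rfl
    rw [h2]
    exact (Finset.single_le_sum (f := fun j => (A i j).getD 0 * (A i j).getD 0)
      (fun _ _ => mul_self_nonneg _) (Finset.mem_range.2 hj)).trans
      (Finset.single_le_sum (f := fun i => ∑ j ∈ Finset.range n, (A i j).getD 0 * (A i j).getD 0)
      (fun _ _ => Finset.sum_nonneg fun _ _ => mul_self_nonneg _) (Finset.mem_range.2 hi))
  rcases (abs_nonneg z).eq_or_lt with h2 | h2
  · rw [← h2]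
    exact sumSq_nonneg _ _ _
  · rw [← abs_mul_abs_self z] at h1
    nlinarith

theorem PolyTime.sumSq {X : Type} [Enc X] {D : X → Prop} {𝒪 : (Data → Data) → Prop}
    {A : X → ℕ → ℕ → Option ℤ} {m n : X → ℕ} (hm : PolyTime 𝒪 D m)
    (hmb : PolyBounded D m) (hn : PolyTime 𝒪 D n) (hnb : PolyBounded D n)
    (hA : PolyTime 𝒪 (fun p : (X × ℕ) × ℕ => (D p.1.1 ∧ p.1.2 < m p.1.1) ∧ p.2 < n p.1.1)
      fun p => A p.1.1 p.1.2 p.2) : PolyTime 𝒪 D fun x => sumSq (A x) (m x) (n x) :=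
  PolyTime.sum (g := fun p : X × ℕ => ∑ j ∈ Finset.range (n p.1),
    (A p.1 p.2 j).getD 0 * (A p.1 p.2 j).getD 0) hm hmb
    (PolyTime.sum (g := fun p : (X × ℕ) × ℕ =>
      (A p.1.1 p.1.2 p.2).getD 0 * (A p.1.1 p.1.2 p.2).getD 0)
      (hn.comp PolyTime.id.fst fun _ h => h.1) (hnb.comp_fst fun _ h => h.1)
      (hA.getD_zero.mul hA.getD_zero))

namespace IntMatrix

section

variable {X : Type} [Enc X] {D : X → Prop} {𝒪 : (Data → Data) → Prop} {V : X → IntMatrix}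
  {d P : X → ℤ} {i j : X → ℕ}

theorem polyTime_gameMin (hV : PolyTime 𝒪 D V) (hd : PolyTime 𝒪 D d) (hP : PolyTime 𝒪 D P)
    (hi : PolyTime 𝒪 D i) (hib : PolyBounded D i) (hj : PolyTime 𝒪 D j) (hjb : PolyBounded D j) :
    PolyTime 𝒪 D fun x => (V x).gameMin (d x) (P x) (i x) (j x) := by
  have hn := polyTime_n hV
  have hent := polyTime_ent hV hi hib (hj.nat_div hn) (hjb.of_le fun _ _ => Nat.div_le_self _ _)
  refine PolyTime.ite (PolyDec.nat_lt hj ((polyTime_p hV).nat_mul hn)) ?_ ?_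
  · exact PolyTime.ite ((PolyDec.nat_eq (hj.nat_mod hn) hi).mono fun _ h => h.1)
      ((PolyTime.option_map (f := fun x z => P x - d x * z) hent
        (hP.sub (hd.mul hent.getD_zero))).mono fun _ h => h.1.1) PolyTime.none
  · exact PolyTime.ite ((PolyDec.nat_eq hi hn).mono fun _ h => h.1) (PolyTime.int 0).some
      PolyTime.none

theorem polyTime_gameMax (hV : PolyTime 𝒪 D V) (hd : PolyTime 𝒪 D d)
    (hj : PolyTime 𝒪 D j) (hjb : PolyBounded D j) (hi : PolyTime 𝒪 D i) (hib : PolyBounded D i) :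
    PolyTime 𝒪 D fun x => (V x).gameMax (d x) (j x) (i x) := by
  have hn := polyTime_n hV
  have hent := polyTime_ent hV hi hib (hj.nat_div hn) (hjb.of_le fun _ _ => Nat.div_le_self _ _)
  refine PolyTime.ite (PolyDec.nat_eq hi hn) (PolyTime.int (-1)).some ?_
  refine PolyTime.ite (((PolyDec.nat_lt hj ((polyTime_p hV).nat_mul hn)).and
    ((PolyDec.nat_eq (hj.nat_mod hn) hi).not.mono fun _ h => h.1)).mono fun _ h => h.1) ?_
    PolyTime.none
  exact (PolyTime.option_map (f := fun x z => d x * z) hent (hd.mul hent.getD_zero)).mono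
    fun _ h => h.1.1

theorem polyDec_rowsFinite (hV : PolyTime 𝒪 D V) : PolyDec 𝒪 D fun x => (V x).RowsFinite := by
  have h1 : PolyDec 𝒪 (fun p : (X × ℕ) × ℕ => (D p.1.1 ∧ p.1.2 < (V p.1.1).n) ∧ p.2 < (V p.1.1).p)
      fun p => ((V p.1.1).ent p.1.2 p.2).isSome :=
    PolyDec.isSome (polyTime_ent (hV.comp PolyTime.id.fst.fst fun _ h => h.1.1) PolyTime.id.fst.snd
      ((polyBounded_n hV).fst_snd fun _ h => h.1) PolyTime.id.snd
      ((polyBounded_p hV).snd fun _ h => ⟨h.1.1, h.2⟩))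
  have h2 := PolyDec.exists_lt ((polyTime_p hV).comp (D := fun p : X × ℕ => D p.1 ∧ p.2 < (V p.1).n)
    PolyTime.id.fst fun _ h => h.1) ((polyBounded_p hV).comp_fst fun _ h => h.1) h1
  refine (PolyDec.exists_lt (polyTime_n hV) (polyBounded_n hV) h2.not).not.congr fun x _ => ?_
  simp only [RowsFinite, Option.isSome_iff_ne_none]
  push Not
  rfl

end

/-- The input data of the game of a matrix. -/
def gameTuple (z : (IntMatrix × (ℤ × ℤ)) × ℕ) :
    (ℕ × ℕ) × (ℕ × (List (List (Option ℤ)) × List (List (Option ℤ)))) :=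
  ((z.1.1.n + 1, z.1.1.p * z.1.1.n + 1), (z.2,
    (tab (z.1.1.gameMin z.1.2.1 z.1.2.2) (z.1.1.n + 1) (z.1.1.p * z.1.1.n + 1),
      tab (z.1.1.gameMax z.1.2.1) (z.1.1.p * z.1.1.n + 1) (z.1.1.n + 1))))

theorem enc_gameTuple (V : IntMatrix) (hV : V.RowsFinite) (d P : ℤ) (s : Fin (V.n + 1)) :
    Enc.enc (gameTuple ((V, (d, P)), s)) = (V.toGame hV d P s).enc := by
  change Data.pair (.pair (.int (V.n + 1 : ℕ)) (.int (V.p * V.n + 1 : ℕ))) (.pair (.int (s : ℕ))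
    (.pair (Enc.enc (tab (V.gameMin d P) (V.n + 1) (V.p * V.n + 1)))
      (Enc.enc (tab (V.gameMax d) (V.p * V.n + 1) (V.n + 1))))) = _
  rw [enc_tab, enc_tab]
  rfl

theorem polyTime_gameTuple {𝒪 : (Data → Data) → Prop} {E : (IntMatrix × (ℤ × ℤ)) × ℕ → Prop} :
    PolyTime 𝒪 E gameTuple := by
  have hV : PolyTime 𝒪 E fun z : (IntMatrix × (ℤ × ℤ)) × ℕ => z.1.1 := PolyTime.id.fst.fst
  have hm := (polyTime_n hV).nat_add (PolyTime.nat 1)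
  have hmb := (polyBounded_n hV).add (PolyBounded.const 1)
  have hn := ((polyTime_p hV).nat_mul (polyTime_n hV)).nat_add (PolyTime.nat 1)
  have hnb := ((polyBounded_p hV).mul (polyBounded_n hV)).add (PolyBounded.const 1)
  refine (hm.pair hn).pair (PolyTime.id.snd.pair (PolyTime.pair ?_ ?_))
  · exact PolyTime.tab hm hmb hn hnb (polyTime_gameMin PolyTime.id.fst.fst.fst.fst
      PolyTime.id.fst.fst.fst.snd.fst PolyTime.id.fst.fst.fst.snd.snd PolyTime.id.fst.snd
      (hmb.fst_snd fun _ h => h.1) PolyTime.id.snd (hnb.snd fun _ h => ⟨h.1.1, h.2⟩))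
  · exact PolyTime.tab hn hnb hm hmb (polyTime_gameMax PolyTime.id.fst.fst.fst.fst
      PolyTime.id.fst.fst.fst.snd.fst PolyTime.id.fst.snd
      (hnb.fst_snd fun _ h => h.1) PolyTime.id.snd (hmb.snd fun _ h => ⟨h.1.1, h.2⟩))

theorem payoff_toGame_eq (V : IntMatrix) (hV : V.RowsFinite) (d P : ℤ) (s s' : Fin (V.n + 1)) :
    (V.toGame hV d P s).payoff = (V.toGame hV d P s').payoff :=
  funext fun i => tendsto_nhds_unique ((V.toGame hV d P s).tendsto_payoff i)
    ((V.toGame hV d P s').tendsto_payoff i)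

/-- The system `NearHyperplane V (P / d)` is decided by one oracle call for each row. -/
theorem polyDec_nearHyperplane : PolyDec meanPayoffGames.SolvedBy
    (fun y : IntMatrix × (ℤ × ℤ) => y.1.RowsFinite ∧ 0 < y.2.1)
    fun y => NearHyperplane y.1.vec (y.2.2 / y.2.1) := by
  classical
  set ans : (IntMatrix × (ℤ × ℤ)) × ℕ → ℤ := fun z =>
    if ∃ (hV : z.1.1.RowsFinite) (hs : z.2 < z.1.1.n + 1),
      0 ≤ (z.1.1.toGame hV z.1.2.1 z.1.2.2 ⟨z.2, hs⟩).payoff ⟨z.2, hs⟩ then 1 else 0 with hans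
  have h1 : PolyTime meanPayoffGames.SolvedBy
      (fun z => (z.1.1.RowsFinite ∧ 0 < z.1.2.1) ∧ z.2 < z.1.1.n) ans := by
    refine PolyTime.of_oracle polyTime_gameTuple ?_ ((PolyBounded.const 2).of_le fun z _ => ?_)
    · rintro ⟨⟨V, d, P⟩, s⟩ ⟨⟨hV, hd⟩, hs⟩
      simp only at hV hd hs
      refine ⟨V.toGame hV d P ⟨s, hs.trans (Nat.lt_succ_self _)⟩, (enc_gameTuple _ _ _ _ _).symm, ?_⟩
      rintro y ⟨c, hc, h⟩
      rw [Game.hasMeanPayoff_iff] at hc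
      subst hc
      rcases h with ⟨h, rfl⟩ | ⟨h, rfl⟩
      · have : ans ((V, d, P), s) = 1 := if_pos ⟨hV, hs.trans (Nat.lt_succ_self _), h⟩
        rw [this]
        rfl
      · have : ans ((V, d, P), s) = 0 := if_neg fun ⟨_, _, h'⟩ => absurd h' (not_le.2 h)
        rw [this]
        rfl
    · simp only [hans]
      split_ifs <;> simp [sz, Enc.enc, Data.size, Nat.size_one]
  have h2 := PolyDec.exists_lt
    (D := fun y : IntMatrix × (ℤ × ℤ) => y.1.RowsFinite ∧ 0 < y.2.1) (n := fun y => y.1.n)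
    (polyTime_n PolyTime.id.fst) (polyBounded_n (𝒪 := meanPayoffGames.SolvedBy) PolyTime.id.fst)
    (PolyDec.lt (PolyTime.int 0) h1)
  refine h2.congr ?_
  rintro ⟨V, d, P⟩ ⟨hV, hd⟩
  simp only at hV hd ⊢
  rw [nearHyperplane_iff_exists_payoff hV hd P 0]
  constructor
  · rintro ⟨s, hs, h⟩
    simp only [hans] at h
    split_ifs at h with h'
    · obtain ⟨_, hs', h'⟩ := h'
      exact ⟨⟨s, hs⟩, by rwa [payoff_toGame_eq V hV d P 0 ⟨s, hs'⟩]⟩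
    · exact absurd h (lt_irrefl _)
  · rintro ⟨i, h⟩
    refine ⟨i, i.2, ?_⟩
    simp only [hans]
    rw [if_pos]
    · exact one_pos
    · exact ⟨hV, i.castSucc.2, by rwa [payoff_toGame_eq V hV d P _ 0]⟩

end IntMatrix

end TropReg

namespace TropReg

open Enc (enc)

/-! ### Computing the value by dichotomy -/

/-- The encoding of `ℚ ∪ {+∞}` that is used for the answers. -/
instance : Enc (Option ℚ) :=
  ⟨fun o => o.elim (.int 1) fun q => .pair (.int q.num) (.int q.den)⟩

theorem Encodes.unique {v : EReal} {y z : Data} (hy : Encodes v y) (hz : Encodes v z) : y = z := by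
  rcases hy with ⟨rfl, rfl⟩ | ⟨rfl, rfl⟩ | ⟨q, rfl, rfl⟩ <;>
    rcases hz with ⟨h, rfl⟩ | ⟨h, rfl⟩ | ⟨q', h, rfl⟩ <;> first | rfl | simp at h; done | skip
  obtain rfl : q = q' := by exact_mod_cast h
  rfl

namespace IntMatrix

/-- The common value of the regression problem and of the inner radius, when there is no empty row;
`none` stands for `+∞`. -/
noncomputable def value (V : IntMatrix) : Option ℚ :=
  open Classical in
  if h : ∃ r : ℚ, NearHyperplane V.vec r ∧ HasBall V.vec r then some h.choose else none

theorem value_eq_some {V : IntMatrix} {r : ℚ} (h : NearHyperplane V.vec r) (h' : HasBall V.vec r) :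
    V.value = some r := by
  have hex : ∃ r : ℚ, NearHyperplane V.vec r ∧ HasBall V.vec r := ⟨r, h, h'⟩
  rw [value, dif_pos hex]
  have h1 := h'.le_of_nearHyperplane hex.choose_spec.1
  have h2 := hex.choose_spec.2.le_of_nearHyperplane h
  norm_cast at h1 h2
  rw [le_antisymm h2 h1]

theorem value_eq_none {V : IntMatrix} (h : ∀ c, ¬ NearHyperplane V.vec c) : V.value = none :=
  dif_neg fun ⟨_, hr, _⟩ => h _ hr

/-- The regression value and the inner radius coincide when there is no empty row. -/
theorem RowsFinite.encodes_value {V : IntMatrix} (hV : V.RowsFinite) :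
    Encodes (regressionValue V.columns) (Enc.enc V.value) ∧
      Encodes (innerRadius V.columns) (Enc.enc V.value) := by
  rw [columns_eq_range]
  by_cases h : ∃ c, NearHyperplane V.vec c
  · obtain ⟨q, z, hq, -, h1, h2⟩ := exists_nearHyperplane_and_hasBall hV h
    have hr : ((z : ℝ) / q) = (((z : ℚ) / q : ℚ) : ℝ) := by push_cast; rfl
    have h3 := regressionValue_eq_of_nearHyperplane_of_hasBall h1 h2
    rw [hr] at h1 h2 h3
    rw [value_eq_some h1 h2]
    exact ⟨.inr (.inr ⟨_, h3.1, rfl⟩), .inr (.inr ⟨_, h3.2, rfl⟩)⟩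
  · rw [not_exists] at h
    rw [value_eq_none h]
    exact ⟨.inr (.inl ⟨regressionValue_eq_top h, rfl⟩),
      .inr (.inl ⟨innerRadius_eq_top (hasBall_of_not_nearHyperplane hV h), rfl⟩)⟩

/-- The denominator of the grid on which the value is searched for: a common multiple of the
integers up to `n + 1`, hence of all the possible denominators of the value. -/
def scale (V : IntMatrix) : ℕ := (V.n + 1).factorial

/-- A bound for the absolute values of the entries. -/
def bound (V : IntMatrix) : ℤ := sumSq V.ent V.n V.p

/-- A bound for the finite values, as a multiple of `1 / scale`. -/
def top (V : IntMatrix) : ℤ := 2 * V.bound * V.scale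

theorem bound_nonneg (V : IntMatrix) : 0 ≤ V.bound :=
  sumSq_nonneg _ _ _

theorem scale_pos (V : IntMatrix) : 0 < V.scale := Nat.factorial_pos _

theorem top_nonneg (V : IntMatrix) : 0 ≤ V.top :=
  mul_nonneg (mul_nonneg two_pos.le V.bound_nonneg) (Int.natCast_nonneg _)

theorem abs_le_bound {V : IntMatrix} {k : Fin V.p} {i : Fin V.n} {y : ℝ} (h : V.vec k i = y) :
    |y| ≤ V.bound := by
  obtain ⟨z, hz, hzy⟩ := exists_vec_eq_coe (h.trans_ne WithBot.coe_ne_bot)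
  obtain rfl : y = z := WithBot.coe_injective (h.symm.trans hzy)
  exact_mod_cast abs_le_sumSq hz i.2 k.2

/-- A finite value is at most `top / scale`. -/
theorem nearHyperplane_top {V : IntMatrix} {c : ℝ} (h : NearHyperplane V.vec c) :
    NearHyperplane V.vec (V.top / (V.scale : ℤ)) := by
  have h1 := h.of_bound (W := V.bound) fun k i y hy => abs_le_bound hy
  have : (V.scale : ℝ) ≠ 0 := by exact_mod_cast V.scale_pos.ne'
  rwa [top, Int.cast_mul, Int.cast_natCast, mul_div_cancel_right₀ _ this, Int.cast_mul]

/-- If `z / scale` is the least point of the grid that is the distance bound of a hyperplane, then it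
is the value, since the value belongs to the grid. -/
theorem value_eq_div {V : IntMatrix} (hV : V.RowsFinite) {z : ℤ}
    (h : NearHyperplane V.vec (z / (V.scale : ℤ)))
    (h' : ¬ NearHyperplane V.vec ((z - 1 : ℤ) / (V.scale : ℤ))) :
    V.value = some ((z : ℚ) / V.scale) ∧ ((z : ℚ) / V.scale).den ≤ V.n + 1 := by
  obtain ⟨q, m, hq, hqn, h1, h2⟩ := exists_nearHyperplane_and_hasBall hV ⟨_, h⟩
  have hs : (0 : ℝ) < V.scale := by exact_mod_cast V.scale_pos
  have hq' : (0 : ℝ) < q := by exact_mod_cast hq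
  obtain ⟨u, hu⟩ : q ∣ V.scale := Nat.dvd_factorial hq hqn
  have hsu : (V.scale : ℝ) = q * u := by exact_mod_cast hu
  have hu' : (u : ℝ) ≠ 0 := fun h => by rw [hsu, h, mul_zero] at hs; exact lt_irrefl _ hs
  have hm : (m : ℝ) / q = ((m * u : ℤ) : ℝ) / ((V.scale : ℤ) : ℝ) := by
    push_cast
    rw [hsu]
    field_simp
  have hz : m * u = z := by
    refine le_antisymm ?_ ?_
    · have h3 := h2.le_of_nearHyperplane h
      rw [hm, div_le_div_iff_of_pos_right (by exact_mod_cast hs)] at h3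
      exact_mod_cast h3
    · by_contra h3
      refine h' (NearHyperplane.mono (hm ▸ h1) ?_)
      rw [div_le_div_iff_of_pos_right (by exact_mod_cast hs)]
      exact_mod_cast (by omega : m * u ≤ z - 1)
  have hr : (m : ℝ) / q = (((z : ℚ) / V.scale : ℚ) : ℝ) := by
    rw [hm, hz]
    push_cast
    rfl
  refine ⟨value_eq_some (hr ▸ h1) (hr ▸ h2), ?_⟩
  have hr' : ((z : ℚ) / V.scale) = ((m : ℤ) : ℚ) / ((q : ℤ) : ℚ) := by
    have : (((z : ℚ) / V.scale : ℚ) : ℝ) = ((((m : ℤ) : ℚ) / ((q : ℤ) : ℚ) : ℚ) : ℝ) := by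
      rw [← hr]
      push_cast
      rfl
    exact_mod_cast this
  rw [hr']
  have hd : (((((m : ℤ) : ℚ) / ((q : ℤ) : ℚ)).den : ℕ) : ℤ) ∣ (q : ℤ) :=
    Rat.divInt_eq_div m q ▸ Rat.den_dvd m q
  exact (Nat.le_of_dvd hq (by exact_mod_cast hd)).trans hqn

section

variable {X : Type} [Enc X] {D : X → Prop} {𝒪 : (Data → Data) → Prop} {V : X → IntMatrix}

theorem polyTime_scale (hV : PolyTime 𝒪 D V) : PolyTime 𝒪 D fun x => (V x).scale := by
  have hn := (polyTime_n hV).nat_add (PolyTime.nat 1)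
  have hnb := (polyBounded_n hV).add (PolyBounded.const 1)
  refine PolyTime.fold (acc := fun _ i => i.factorial) (F := fun p => (p.2.1 + 1) * p.2.2)
    (fun x => 1 + (((V x).n + 1) * ((V x).n + 1) + 1)) hn hnb (PolyTime.nat 1)
    ((PolyTime.id.snd.fst.nat_add (PolyTime.nat 1)).nat_mul PolyTime.id.snd.snd)
    (fun _ i _ _ => (Nat.factorial_succ i).symm)
    ((PolyBounded.const 1).add ((hnb.mul hnb).add (PolyBounded.const 1))) fun x i _ hi => ?_
  refine sz_int_le (z := (i.factorial : ℕ)) ?_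
  rw [Int.natAbs_natCast]
  calc i.factorial ≤ i ^ i := Nat.factorial_le_pow i
    _ ≤ (2 ^ i) ^ i := Nat.pow_le_pow_left Nat.lt_two_pow_self.le _
    _ = 2 ^ (i * i) := (pow_mul _ _ _).symm
    _ < 2 ^ (((V x).n + 1) * ((V x).n + 1) + 1) :=
      Nat.pow_lt_pow_right one_lt_two (Nat.lt_succ_of_le (Nat.mul_le_mul hi hi))

theorem polyTime_bound (hV : PolyTime 𝒪 D V) : PolyTime 𝒪 D fun x => (V x).bound :=
  PolyTime.sumSq (polyTime_n hV) (polyBounded_n hV) (polyTime_p hV) (polyBounded_p hV)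
    (polyTime_ent (hV.comp PolyTime.id.fst.fst fun _ h => h.1.1) PolyTime.id.fst.snd
      ((polyBounded_n hV).fst_snd fun _ h => h.1) PolyTime.id.snd
      ((polyBounded_p hV).snd fun _ h => ⟨h.1.1, h.2⟩))

theorem polyTime_top (hV : PolyTime 𝒪 D V) : PolyTime 𝒪 D fun x => (V x).top :=
  ((PolyTime.int 2).mul (polyTime_bound hV)).mul (polyTime_scale hV).cast

end

theorem polyDec_nearHyperplane_scale {X : Type} [Enc X] {D : X → Prop} {V : X → IntMatrix}
    {P : X → ℤ} (hV : PolyTime meanPayoffGames.SolvedBy D V)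
    (hP : PolyTime meanPayoffGames.SolvedBy D P) (h : ∀ x, D x → (V x).RowsFinite) :
    PolyDec meanPayoffGames.SolvedBy D
      fun x => NearHyperplane (V x).vec (P x / ((V x).scale : ℤ)) :=
  polyDec_nearHyperplane.comp (hV.pair ((polyTime_scale hV).cast.pair hP))
    fun x hx => ⟨h x hx, Int.natCast_pos.2 (V x).scale_pos⟩

/-- Dichotomy: the state is a pair `(lo, hi)` such that the condition holds at `hi` and fails at
`lo`. Initially `lo = -1`, as the value is nonnegative; the bit size of `hi - lo - 1` decreases. -/
theorem exists_polyTime_least : ∃ f : IntMatrix → ℤ,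
    PolyTime meanPayoffGames.SolvedBy
      (fun V => V.RowsFinite ∧ NearHyperplane V.vec (V.top / (V.scale : ℤ))) f ∧
    ∀ V : IntMatrix, V.RowsFinite → NearHyperplane V.vec (V.top / (V.scale : ℤ)) →
      NearHyperplane V.vec (f V / (V.scale : ℤ)) ∧
        ¬ NearHyperplane V.vec ((f V - 1 : ℤ) / (V.scale : ℤ)) := by
  classical
  refine Exists.elim (PolyTime.exists_while (𝒪 := meanPayoffGames.SolvedBy)
    (D := fun V : IntMatrix => V.RowsFinite ∧ NearHyperplane V.vec (V.top / (V.scale : ℤ)))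
    (Inv := fun V (s : ℤ × ℤ) => (-1 ≤ s.1 ∧ s.1 < s.2 ∧ s.2 ≤ V.top) ∧
      NearHyperplane V.vec (s.2 / (V.scale : ℤ)) ∧ ¬ NearHyperplane V.vec (s.1 / (V.scale : ℤ)))
    (c := fun p => 1 < p.2.2 - p.2.1)
    (F := fun p => if NearHyperplane p.1.vec (((p.2.1 + p.2.2) / 2 : ℤ) / (p.1.scale : ℤ)) then
      (p.2.1, (p.2.1 + p.2.2) / 2) else ((p.2.1 + p.2.2) / 2, p.2.2))
    (s₀ := fun V => (-1, V.top)) (fun _ s => Nat.size (s.2 - s.1 - 1).toNat)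
    (fun V => 1 + (sz V.top + 1) + (sz V.top + 1))
    (PolyDec.lt (PolyTime.int 1) (PolyTime.id.snd.snd.sub PolyTime.id.snd.fst)) ?_
    ((PolyTime.int _).pair (polyTime_top PolyTime.id)) ?_ ?_ ?_ ?_ ?_) ?_
  · have hmid : ∀ {E}, PolyTime meanPayoffGames.SolvedBy E
        fun p : IntMatrix × (ℤ × ℤ) => (p.2.1 + p.2.2) / 2 :=
      (PolyTime.id.snd.fst.add PolyTime.id.snd.snd).div (PolyTime.int 2)
    exact PolyTime.ite (polyDec_nearHyperplane_scale PolyTime.id.fst hmid fun p h => h.1.1.1)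
      (PolyTime.id.snd.fst.pair hmid) (hmid.pair PolyTime.id.snd.snd)
  · rintro V ⟨h1, h2⟩
    refine ⟨⟨le_rfl, by have := V.top_nonneg; simp only; omega, le_rfl⟩, h2, fun h => ?_⟩
    have h3 := (h.nonneg_and_two_le h1.exists_vec_ne_bot).1
    have h4 : (0 : ℝ) < ((V.scale : ℤ) : ℝ) := by exact_mod_cast V.scale_pos
    rw [le_div_iff₀ h4] at h3
    norm_num at h3
  · rintro V ⟨lo, hi⟩ - ⟨⟨h3, h4, h5⟩, h6, h7⟩ h8
    simp only at h3 h4 h5 h6 h7 h8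
    have key : ∀ d : ℕ, d ≤ (hi - lo - 1).toNat / 2 → Nat.size d < Nat.size (hi - lo - 1).toNat := by
      intro d hd
      have h0 : 0 < Nat.size (hi - lo - 1).toNat := Nat.size_pos.2 (by omega)
      obtain ⟨s, hs⟩ := Nat.exists_eq_succ_of_ne_zero h0.ne'
      have h9 := Nat.lt_size_self (hi - lo - 1).toNat
      rw [hs, pow_succ] at h9
      rw [hs]
      exact Nat.lt_succ_of_le (Nat.size_le.2 (by omega))
    simp only
    split_ifs with h
    · exact ⟨⟨⟨h3, by simp only; omega, by simp only; omega⟩, h, h7⟩, key _ (by simp only; omega)⟩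
    · exact ⟨⟨⟨by simp only; omega, by simp only; omega, h5⟩, h6, h⟩, key _ (by simp only; omega)⟩
  · refine (polyTime_top (𝒪 := fun _ => True) PolyTime.id).polyBounded.of_le
      (D := fun V : IntMatrix => V.RowsFinite ∧ NearHyperplane V.vec (V.top / (V.scale : ℤ)))
      fun V _ => Nat.size_le.2 ?_
    have h1 := natAbs_lt_two_pow_sz V.top
    have h2 := V.top_nonneg
    simp only
    omega
  · have h : PolyBounded (fun V : IntMatrix => V.RowsFinite ∧
        NearHyperplane V.vec (V.top / (V.scale : ℤ))) fun V => sz V.top :=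
      (polyTime_top (𝒪 := fun _ => True) PolyTime.id).polyBounded
    exact ((PolyBounded.const 1).add (h.add (PolyBounded.const 1))).add
      (h.add (PolyBounded.const 1))
  · rintro V ⟨lo, hi⟩ - ⟨⟨h3, h4, h5⟩, -, -⟩
    have key : ∀ z : ℤ, -1 ≤ z → z ≤ V.top → (Data.int z).size ≤ sz V.top + 1 := by
      intro z hz hz'
      have : Nat.size z.natAbs ≤ V.top.natAbs.size + 1 := by
        have := Nat.lt_size_self V.top.natAbs
        refine Nat.size_le.2 ?_
        rw [pow_succ]
        have := V.top_nonneg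
        omega
      simp only [sz, Enc.enc, Data.size]
      omega
    have h1 := key lo h3 (by simp only at h4 h5; omega)
    have h2 := key hi (by simp only at h3 h4; omega) h5
    change 1 + (Data.int lo).size + (Data.int hi).size ≤ _
    omega
  · rintro f ⟨hf, hfs⟩
    refine ⟨fun V => (f V).2, hf.snd, fun V h1 h2 => ?_⟩
    obtain ⟨⟨⟨h3, h4, h5⟩, h6, h7⟩, h8⟩ := hfs V ⟨h1, h2⟩
    rw [show (f V).2 - 1 = (f V).1 by simp only at h8; omega]
    exact ⟨h6, h7⟩

/-- The value is computed in polynomial time with an oracle for mean payoff games. The dichotomy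
gives it as a fraction with denominator `scale`; the reduced denominator is then found by trying the
integers from `1` to `n + 1`. -/
theorem polyTime_value : PolyTime meanPayoffGames.SolvedBy RowsFinite value := by
  classical
  obtain ⟨f, hf, hfs⟩ := exists_polyTime_least
  set E : IntMatrix → Prop := fun V =>
    V.RowsFinite ∧ NearHyperplane V.vec (V.top / (V.scale : ℤ)) with hE
  set r : IntMatrix → ℚ := fun V => (f V : ℚ) / V.scale with hr
  have hval : ∀ V, E V → V.value = some (r V) ∧ (r V).den ≤ V.n + 1 := fun V hV =>
    value_eq_div hV.1 (hfs V hV.1 hV.2).1 (hfs V hV.1 hV.2).2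
  have hmul : ∀ V, (V.scale : ℚ) * r V = f V := fun V =>
    mul_div_cancel₀ _ (by exact_mod_cast V.scale_pos.ne')
  have hdvd : ∀ V : IntMatrix, (V.scale : ℤ) ∣ (r V).den * f V := fun V => by
    refine ⟨(r V).num, ?_⟩
    have h1 : ((r V).den : ℚ) * r V = (r V).num := Rat.den_mul_eq_num _
    have : (((r V).den * f V : ℤ) : ℚ) = ((V.scale * (r V).num : ℤ) : ℚ) := by
      push_cast
      rw [← hmul, ← h1]
      ring
    exact_mod_cast this
  have hle : ∀ (V : IntMatrix) (q : ℕ), 0 < q → (V.scale : ℤ) ∣ q * f V → (r V).den ≤ q := by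
    rintro V q hq ⟨u, hu⟩
    have hs : (V.scale : ℚ) ≠ 0 := by exact_mod_cast V.scale_pos.ne'
    have hq' : (q : ℚ) ≠ 0 := by exact_mod_cast hq.ne'
    have h1 : r V = (u : ℚ) / ((q : ℤ) : ℚ) := by
      have : (q : ℚ) * f V = V.scale * u := by exact_mod_cast hu
      rw [hr]
      push_cast
      field_simp
      linarith
    have hd : (((r V).den : ℕ) : ℤ) ∣ (q : ℤ) := by
      rw [h1, ← Rat.divInt_eq_div]
      exact Rat.den_dvd u q
    exact Nat.le_of_dvd hq (by exact_mod_cast hd)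
  have hs : ∀ {E'}, PolyTime meanPayoffGames.SolvedBy E' fun V : IntMatrix => (V.scale : ℤ) :=
    (polyTime_scale PolyTime.id).cast
  have hnb : ∀ {E'}, PolyBounded E' fun V : IntMatrix => V.n + 1 :=
    (polyBounded_n (𝒪 := meanPayoffGames.SolvedBy) PolyTime.id).add (PolyBounded.const 1)
  have hszn : ∀ i : ℕ, sz i ≤ 1 + i := fun i =>
    sz_int_le (z := (i : ℤ)) (by rw [Int.natAbs_natCast]; exact Nat.lt_two_pow_self)
  have hprod : ∀ {E' : IntMatrix × ℕ → Prop}, (∀ p, E' p → E p.1) →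
      PolyTime meanPayoffGames.SolvedBy E' fun p : IntMatrix × ℕ => (p.2 : ℤ) * f p.1 := fun h =>
    PolyTime.id.snd.cast.mul (hf.comp PolyTime.id.fst h)
  refine Exists.elim (PolyTime.exists_while (𝒪 := meanPayoffGames.SolvedBy) (D := E)
    (Inv := fun V (q : ℕ) => 0 < q ∧ q ≤ (r V).den)
    (c := fun p => ¬ (p.2 : ℤ) * f p.1 / p.1.scale * p.1.scale = p.2 * f p.1)
    (F := fun p => p.2 + 1) (s₀ := fun _ => 1) (fun V q => (r V).den - q) (fun V => 1 + (V.n + 1))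
    (PolyDec.not (PolyDec.eq (((hprod fun _ h => h.1).div (hs.comp PolyTime.id.fst
      (E := fun _ => True) fun _ _ => trivial)).mul (hs.comp PolyTime.id.fst
      (E := fun _ => True) fun _ _ => trivial)) (hprod fun _ h => h.1)))
    (PolyTime.id.snd.nat_add (PolyTime.nat 1)) (PolyTime.nat 1)
    (fun V _ => ⟨one_pos, (r V).den_pos⟩) ?_ ?_
    ((PolyBounded.const 1).add hnb) ?_) ?_
  · rintro V q hV ⟨h1, h2⟩ h3
    have h4 : q ≠ (r V).den := fun h => h3 (by
      simp only [h]
      exact Int.ediv_mul_cancel (hdvd V))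
    simp only
    omega
  · exact hnb.of_le fun V hV => (Nat.sub_le _ _).trans (hval V hV).2
  · rintro V q hV ⟨h1, h2⟩
    have h3 := hszn q
    have h4 := (hval V hV).2
    omega
  · rintro g ⟨hg, hgs⟩
    have hden : PolyTime meanPayoffGames.SolvedBy E fun V => (r V).den := hg.congr fun V hV => by
      obtain ⟨⟨h1, h2⟩, h3⟩ := hgs V hV
      rw [not_not] at h3
      exact le_antisymm h2 (hle V _ h1 ⟨_, by rw [← h3, mul_comm]⟩)
    have hnum : PolyTime meanPayoffGames.SolvedBy E fun V => (r V).num := by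
      refine ((hden.cast.mul hf).div hs).congr fun V hV => ?_
      refine Int.ediv_eq_of_eq_mul_right (by exact_mod_cast V.scale_pos.ne') ?_
      have h1 : ((r V).den : ℚ) * r V = (r V).num := Rat.den_mul_eq_num _
      have : (((r V).den * f V : ℤ) : ℚ) = ((V.scale * (r V).num : ℤ) : ℚ) := by
        push_cast
        rw [← hmul, ← h1]
        ring
      exact_mod_cast this
    refine (PolyTime.ite (p := fun V : IntMatrix => NearHyperplane V.vec (V.top / (V.scale : ℤ)))
      (f := value) (g := value)
      (polyDec_nearHyperplane_scale PolyTime.id (polyTime_top PolyTime.id) fun _ h => h)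
      ((hnum.pair hden).congr_enc fun V hV => ?_)
      ((PolyTime.int 1).congr_enc fun V hV => ?_)).congr fun V _ => ite_self _
    · rw [(hval V hV).1]
      rfl
    · rw [value_eq_none fun c hc => hV.2 (nearHyperplane_top hc)]
      rfl

end IntMatrix

end TropReg

namespace TropReg

open Enc (enc)

/-! ### The reductions -/

namespace IntMatrix

theorem of_value_eq_some {V : IntMatrix} {r : ℚ} (h : V.value = some r) :
    NearHyperplane V.vec r ∧ HasBall V.vec r := by
  rw [value] at h
  split_ifs at h with hex
  obtain rfl := Option.some_injective _ h
  exact hex.choose_spec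

/-- The value is nonnegative, hence it vanishes as soon as it is at most `0`. -/
theorem RowsFinite.value_eq_zero_iff {V : IntMatrix} (hV : V.RowsFinite) :
    V.value = some 0 ↔ NearHyperplane V.vec 0 := by
  refine ⟨fun h => by simpa using (of_value_eq_some h).1, fun h => ?_⟩
  obtain ⟨q, z, -, -, h1, h2⟩ := exists_nearHyperplane_and_hasBall hV ⟨_, h⟩
  have h3 := (h1.nonneg_and_two_le hV.exists_vec_ne_bot).1
  have h4 := le_antisymm (h2.le_of_nearHyperplane h) h3
  rw [h4] at h2
  exact value_eq_some (by simpa using h) (by simpa using h2)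

/-- In dimension `1`, tropical hyperplanes are empty. -/
theorem regressionValue_eq_top_of_lt_two {V : IntMatrix} (h : V.n < 2) :
    regressionValue V.columns = ⊤ := by
  rw [columns_eq_range, regressionValue]
  refine top_unique (le_iInf₂ fun a _ => ?_)
  refine le_trans ?_ (le_iSup₂ (f := fun v _ => ⨅ x ∈ tropicalHyperplane a, hilbertDist v x)
    (V.vec 0) ⟨0, rfl⟩)
  refine le_iInf₂ fun x hx => ?_
  obtain ⟨i, j, hij, -⟩ := hx
  exact absurd (Fin.ext (by omega)) hij

end IntMatrix

/-- Without empty row, the answer is computed by `IntMatrix.polyTime_value`. If the row `i` is empty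
and `2 ≤ n`, all the columns are on the hyperplane whose parameter is supported by `i`. -/
theorem regressionProblem_reduces :
    PolyTimeTuringReduces regressionProblem meanPayoffGames := by
  classical
  refine polyTimeTuringReduces_of_polyTime (Z := Data)
    (A := fun V : IntMatrix => Encodes (regressionValue V.columns)) (hI := IntMatrix.enc_injective)
    (f := fun V : IntMatrix => if V.RowsFinite then enc V.value else
      if V.n < 2 then enc (1 : ℤ) else enc ((0 : ℤ), (1 : ℤ))) ?_ fun V => ?_
  · refine PolyTime.ite (IntMatrix.polyDec_rowsFinite PolyTime.id)
      ((IntMatrix.polyTime_value.mono fun _ h => h.2).congr_enc fun _ _ => rfl) ?_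
    exact PolyTime.ite (PolyDec.nat_lt (IntMatrix.polyTime_n PolyTime.id) (PolyTime.nat 2))
      ((PolyTime.int 1).congr_enc fun _ _ => rfl)
      (((PolyTime.int 0).pair (PolyTime.int 1)).congr_enc fun _ _ => rfl)
  · change Encodes _ (ite _ _ _)
    split_ifs with h h2
    · exact h.encodes_value.1
    · exact .inr (.inl ⟨IntMatrix.regressionValue_eq_top_of_lt_two h2, rfl⟩)
    · obtain ⟨i, hi⟩ := IntMatrix.exists_row_eq_bot h
      refine .inr (.inr ⟨0, ?_, rfl⟩)
      rw [IntMatrix.columns_eq_range, regressionValue_eq_zero (not_lt.1 h2) hi]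
      simp

/-- If a row is empty, the cone does not contain any finite vector. -/
theorem innerRadiusProblem_reduces :
    PolyTimeTuringReduces innerRadiusProblem meanPayoffGames := by
  classical
  refine polyTimeTuringReduces_of_polyTime (Z := Data)
    (A := fun V : IntMatrix => Encodes (innerRadius V.columns)) (hI := IntMatrix.enc_injective)
    (f := fun V : IntMatrix => if V.RowsFinite then enc V.value else enc (-1 : ℤ)) ?_ fun V => ?_
  · exact PolyTime.ite (IntMatrix.polyDec_rowsFinite PolyTime.id)
      ((IntMatrix.polyTime_value.mono fun _ h => h.2).congr_enc fun _ _ => rfl)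
      ((PolyTime.int (-1)).congr_enc fun _ _ => rfl)
  · change Encodes _ (ite _ _ _)
    split_ifs with h
    · exact h.encodes_value.2
    · obtain ⟨i, hi⟩ := IntMatrix.exists_row_eq_bot h
      exact .inl ⟨innerRadius_eq_bot hi, rfl⟩

namespace Game

section

variable {X : Type} [Enc X] {D : X → Prop} {𝒪 : (Data → Data) → Prop} {G : X → Game}
  {i j r c : X → ℕ} {M : X → ℤ}

theorem polyTime_minE (hG : PolyTime 𝒪 D G) (hi : PolyTime 𝒪 D i) (hib : PolyBounded D i)
    (hj : PolyTime 𝒪 D j) (hjb : PolyBounded D j) :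
    PolyTime 𝒪 D fun x => (G x).minE (i x) (j x) :=
  (PolyTime.ite (PolyDec.nat_eq hj (polyTime_n hG)) (PolyTime.int 0).some
    ((polyTime_minA hG hi hib hj hjb).mono fun _ h => h.1)).congr fun _ _ => (minE_eq _ _ _).symm

theorem polyTime_maxE (hG : PolyTime 𝒪 D G) (hM : PolyTime 𝒪 D M) (hi : PolyTime 𝒪 D i)
    (hib : PolyBounded D i) (hj : PolyTime 𝒪 D j) (hjb : PolyBounded D j) :
    PolyTime 𝒪 D fun x => (G x).maxE (M x) (i x) (j x) :=
  (PolyTime.ite ((PolyDec.nat_eq hi (polyTime_n hG)).and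
    ((PolyDec.nat_eq hj (polyTime_init hG)).mono fun _ h => h.1))
    (hM.some.mono fun _ h => h.1)
    ((polyTime_maxA hG hi hib hj hjb).mono fun _ h => h.1)).congr fun _ _ => (maxE_eq _ _ _ _).symm

theorem polyTime_optAdd {a b : X → Option ℤ} (ha : PolyTime 𝒪 D a) (hb : PolyTime 𝒪 D b) :
    PolyTime 𝒪 D fun x => optAdd (a x) (b x) :=
  PolyTime.ite ((PolyDec.isSome ha).and ((PolyDec.isSome hb).mono fun _ h => h.1))
    ((ha.getD_zero.add hb.getD_zero).some.mono fun _ h => h.1) PolyTime.none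

theorem polyTime_sysEntry (hG : PolyTime 𝒪 D G) (hM : PolyTime 𝒪 D M) (hr : PolyTime 𝒪 D r)
    (hrb : PolyBounded D r) (hc : PolyTime 𝒪 D c) (hcb : PolyBounded D c) :
    PolyTime 𝒪 D fun x => (G x).sysEntry (M x) (r x) (c x) := by
  have hm := polyTime_m hG
  have hn := (polyTime_n hG).nat_add (PolyTime.nat 1)
  have hmn := hm.nat_mul hn
  have hcd : PolyBounded D fun x => c x / ((G x).n + 1) := hcb.of_le fun _ _ => Nat.div_le_self _ _
  have hcm : PolyBounded D fun x => c x % ((G x).n + 1) := hcb.of_le fun _ _ => Nat.mod_le _ _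
  have hmin := polyTime_minE hG (hc.nat_div hn) hcd (hc.nat_mod hn) hcm
  have hmax := polyTime_maxE hG hM (hc.nat_mod hn) hcm (hr.nat_mod hm)
    (hrb.of_le fun _ _ => Nat.mod_le _ _)
  refine PolyTime.ite (PolyDec.nat_lt hc hmn) ?_ ?_
  · refine PolyTime.ite ((PolyDec.nat_eq (hr.nat_div hm) (PolyTime.nat 0)).mono fun _ h => h.1) ?_
      ((polyTime_optAdd hmin hmax).mono fun _ h => h.1.1)
    exact PolyTime.ite (((PolyDec.nat_eq (hr.nat_mod hm) (hc.nat_div hn)).and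
      ((PolyDec.isSome hmin).mono fun _ h => h.1)).mono fun _ h => h.1.1)
      (PolyTime.int 0).some PolyTime.none
  · have hs : PolyTime 𝒪 (fun x => D x ∧ ¬ c x < (G x).m * ((G x).n + 1))
        fun x => c x - (G x).m * ((G x).n + 1) :=
      (hc.mono fun _ h => h.1).nat_sub (hmn.mono fun _ h => h.1) fun _ h => not_lt.1 h.2
    have hm' := hm.mono (D := fun x => D x ∧ ¬ c x < (G x).m * ((G x).n + 1)) fun _ h => h.1
    have hr' := hr.mono (D := fun x => D x ∧ ¬ c x < (G x).m * ((G x).n + 1)) fun _ h => h.1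
    exact PolyTime.ite ((PolyDec.nat_eq (hr'.nat_mod hm') (hs.nat_mod hm')).and
      (((PolyDec.nat_eq (hr'.nat_div hm') (hs.nat_div hm')).or
        (PolyDec.nat_eq (hr'.nat_div hm') ((hs.nat_div hm').nat_add (PolyTime.nat 1)))).mono
          fun _ h => h.1))
      (PolyTime.int 0).some PolyTime.none

end

/-- A bound for the absolute values of the sums of two weights. -/
def weightBound (G : Game) : ℤ := sumSq G.minA G.m G.n + sumSq G.maxA G.n G.m

theorem abs_le_weightBound {G : Game} {i : Fin G.m} {j : Fin G.n} {l : Fin G.m} {w w' : ℤ}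
    (hw : G.minArc i j = some w) (hw' : G.maxArc j l = some w') : |w + w'| ≤ G.weightBound := by
  have h1 : G.minA i j = some w := (dif_pos ⟨i.2, j.2⟩).trans hw
  have h2 : G.maxA j l = some w' := (dif_pos ⟨j.2, l.2⟩).trans hw'
  exact (abs_add_le _ _).trans (add_le_add (abs_le_sumSq h1 i.2 j.2) (abs_le_sumSq h2 j.2 l.2))

/-- The matrix associated with a game, with a sufficiently large weight `M`. -/
def matrix (G : Game) : IntMatrix := G.toMatrix (G.m * G.weightBound)

/-- The mean payoff game is a question about the value of a matrix. -/
theorem value_matrix_eq_zero_iff (G : Game) :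
    G.matrix.value = some 0 ↔ 0 ≤ G.payoff G.init :=
  (G.toMatrix_rowsFinite _).value_eq_zero_iff.trans
    ⟨payoff_nonneg_of_nearHyperplane, nearHyperplane_of_payoff_nonneg
      (add_nonneg (sumSq_nonneg _ _ _) (sumSq_nonneg _ _ _))
      (fun _ _ _ _ _ => abs_le_weightBound) le_rfl⟩

theorem polyTime_weightBound {D : Game → Prop} {𝒪 : (Data → Data) → Prop} :
    PolyTime 𝒪 D weightBound := by
  have hm : PolyTime 𝒪 D fun G => G.m := polyTime_m PolyTime.id
  have hn : PolyTime 𝒪 D fun G => G.n := polyTime_n PolyTime.id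
  have hmb : PolyBounded D fun G => G.m := polyBounded_m (𝒪 := 𝒪) PolyTime.id
  have hnb : PolyBounded D fun G => G.n := polyBounded_n (𝒪 := 𝒪) PolyTime.id
  exact (PolyTime.sumSq hm hmb hn hnb (polyTime_minA PolyTime.id.fst.fst PolyTime.id.fst.snd
    (hmb.fst_snd fun _ h => h.1) PolyTime.id.snd (hnb.snd fun _ h => ⟨h.1.1, h.2⟩))).add
    (PolyTime.sumSq hn hnb hm hmb (polyTime_maxA PolyTime.id.fst.fst PolyTime.id.fst.snd
    (hnb.fst_snd fun _ h => h.1) PolyTime.id.snd (hmb.snd fun _ h => ⟨h.1.1, h.2⟩)))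

theorem polyTime_matrix {D : Game → Prop} {𝒪 : (Data → Data) → Prop} : PolyTime 𝒪 D matrix := by
  have hm : ∀ {E}, PolyTime 𝒪 E fun G : Game => G.m := polyTime_m PolyTime.id
  have hn : PolyTime 𝒪 D fun G => G.n := polyTime_n PolyTime.id
  have hmb : PolyBounded D fun G => G.m := polyBounded_m (𝒪 := 𝒪) PolyTime.id
  have hnb : PolyBounded D fun G => G.n := polyBounded_n (𝒪 := 𝒪) PolyTime.id
  have h3m : PolyTime 𝒪 D fun G => 3 * G.m := (PolyTime.nat 3).nat_mul hm
  have h3b : PolyBounded D fun G => 3 * G.m := (PolyBounded.const 3).mul hmb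
  have hp : PolyTime 𝒪 D fun G => G.m * (G.n + 1) + 2 * G.m :=
    (hm.nat_mul (hn.nat_add (PolyTime.nat 1))).nat_add ((PolyTime.nat 2).nat_mul hm)
  have hpb : PolyBounded D fun G => G.m * (G.n + 1) + 2 * G.m :=
    (hmb.mul (hnb.add (PolyBounded.const 1))).add ((PolyBounded.const 2).mul hmb)
  have hM : ∀ {E}, PolyTime 𝒪 E fun G : Game => (G.m : ℤ) * G.weightBound :=
    hm.cast.mul polyTime_weightBound
  refine ((h3m.pair hp).pair (PolyTime.tab (A := fun G => G.sysEntry (G.m * G.weightBound))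
    h3m h3b hp hpb (polyTime_sysEntry PolyTime.id.fst.fst
      (hM.comp PolyTime.id.fst.fst (E := fun _ => True) fun _ _ => trivial) PolyTime.id.fst.snd
      (h3b.fst_snd fun _ h => h.1) PolyTime.id.snd
      (hpb.snd fun _ h => ⟨h.1.1, h.2⟩)))).congr_enc fun G _ => ?_
  change Data.pair (.pair (.int (3 * G.m : ℕ)) (.int (G.m * (G.n + 1) + 2 * G.m : ℕ)))
    (Enc.enc (tab _ _ _)) = _
  rw [enc_tab]
  rfl

end Game

/-- Mean payoff games reduce to any problem whose answer is the value of a matrix, for the matrices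
without empty rows. -/
theorem meanPayoffGames_reduces {A : IntMatrix → Data → Prop}
    (hA : ∀ V : IntMatrix, V.RowsFinite → ∀ y, A V y → y = enc V.value) :
    PolyTimeTuringReduces meanPayoffGames ⟨IntMatrix, IntMatrix.enc, IntMatrix.enc_injective, A⟩ := by
  classical
  set Q : Problem := ⟨IntMatrix, IntMatrix.enc, IntMatrix.enc_injective, A⟩
  have hy : PolyTime Q.SolvedBy (fun _ => True) fun G : Game => G.matrix.value :=
    PolyTime.of_oracle Game.polyTime_matrix
      (fun G _ => ⟨G.matrix, rfl, hA _ (G.toMatrix_rowsFinite _)⟩)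
      (IntMatrix.polyTime_value.comp Game.polyTime_matrix
        fun G _ => G.toMatrix_rowsFinite _).polyBounded
  have h1 : PolyTime Q.SolvedBy (fun _ => True) fun G : Game =>
      ((if G.matrix.value.isSome then 1 else 0 : ℤ)) :=
    (PolyTime.of_op (D := fun _ : Option ℚ => True)
      (f := fun o : Option ℚ => ((if o.isSome then 1 else 0 : ℤ))) .isPair
      fun o _ => by cases o <;> rfl).comp hy fun _ _ => trivial
  have h2 : PolyTime Q.SolvedBy (fun _ => True) fun G : Game =>
      G.matrix.value.elim 0 Rat.num :=
    (PolyTime.of_op (D := fun _ : Option ℚ => True)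
      (f := fun o : Option ℚ => o.elim 0 Rat.num) .fst
      fun o _ => by cases o <;> rfl).comp hy fun _ _ => trivial
  have h3 : PolyDec Q.SolvedBy (fun _ => True) fun G : Game => 0 ≤ G.payoff G.init := by
    refine ((PolyDec.lt (PolyTime.int 0) h1).and ((PolyDec.eq h2 (PolyTime.int 0)).mono
      fun _ h => h.1)).congr fun G _ => ?_
    rw [← G.value_matrix_eq_zero_iff]
    cases G.matrix.value <;> simp
  refine polyTimeTuringReduces_of_polyTime (hI := Game.enc_injective)
    (f := fun G : Game => if 0 ≤ G.payoff G.init then (1 : ℤ) else 0)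
    (PolyTime.ite h3 (PolyTime.int 1) (PolyTime.int 0)) fun G => ?_
  refine ⟨_, (Game.hasMeanPayoff_iff _ _).2 rfl, ?_⟩
  split_ifs with h
  · exact .inl ⟨h, rfl⟩
  · exact .inr ⟨not_le.1 h, rfl⟩

end TropReg

theorem mainTheorem4 :
    TropReg.PolyTimeTuringEquivalent TropReg.regressionProblem TropReg.meanPayoffGames ∧
      TropReg.PolyTimeTuringEquivalent TropReg.innerRadiusProblem TropReg.meanPayoffGames :=
  ⟨⟨TropReg.regressionProblem_reduces,
      TropReg.meanPayoffGames_reduces fun _ hV _ hy => hy.unique hV.encodes_value.1⟩,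
    ⟨TropReg.innerRadiusProblem_reduces,
      TropReg.meanPayoffGames_reduces fun _ hV _ hy => hy.unique hV.encodes_value.2⟩⟩
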